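/- Theorem. Let $\mathbb{K}$ be a perfect field and let $F\in\mathbb{K}[[x]][y]$ be a square-free Weierstrass polynomial of degree $d\ge 1$ (monic in $y$, all other coefficients vanishing at $x=0$), where $\mathrm{char}\,\mathbb{K}$ is $0$ or greater than $d$. Conventions. For $H=\sum_i a_i(x)y^i=\sum a_{ij}x^jy^i$ over a field $\mathbb{L}$, the Newton polygon $\mathcal{N}(H)$ is the lower convex hull of the points $(i,\mathrm{val}(a_i))$ with $a_i\neq 0$, and the boundary polynomial is $\bar H=\sum_{(i,j)\in\mathcal{N}(H)}a_{ij}x^jy^i$. The lowest edge of a Newton polygon is the edge that contains its lowest point (the polygon itself if it is a single point). A Weierstrass polynomial $H$ is degenerated over $\mathbb{L}$, with edge data $(q,m,P,N)$, if $\mathcal{N}(H)$ is straight of slope $-m/q$ with $q>0$ and $q,m$ coprime and $\bar H=c\,(P(y^q/x^m)x^{m\deg P})^N$ with $c\in\mathbb{L}^\times$ and $P\in\mathbb{L}[Z]$ monic irreducible. The sequence $H_k$. Let $\mathbb{K}_0=\mathbb{K}$, $N_0=d$, $c_0=-\mathrm{coeff}(F,y^{d-1})/d$, $\pi_0(x,y)=(x,y+c_0(x))$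 and $H_0=F(x,y+c_0)$. If $N_{k-1}>1$ and $H_{k-1}$ is degenerated over $\mathbb{K}_{k-1}$ with edge data $(q_k,m_k,P_k,N_k)$, let $\ell_k=\deg P_k$, $\mathbb{K}_k=\mathbb{K}_{k-1}[Z]/(P_k)$, $z_k$ the class of $Z$, and $q_ks_k-t_km_k=1$ with $0\le t_k<q_k$. Write $$H_{k-1}(z_k^{t_k}x^{q_k},x^{m_k}(y+z_k^{s_k}))=x^{q_km_k\ell_kN_k}\,G_kV_k$$ with $G_k\in\mathbb{K}_k[[x]][y]$ Weierstrass of degree $N_k$ and $V_k\in\mathbb{K}_k[[x,y]]^\times$, and put $c_k=-\mathrm{coeff}(G_k,y^{N_k-1})/N_k$, $H_k=G_k(x,y+c_k)$ and $\pi_k=\pi_{k-1}\circ\sigma_k$, where $\sigma_k(x,y)=(z_k^{t_k}x^{q_k},x^{m_k}(y+z_k^{s_k}+c_k(x)))$. This stops at a smallest index $g$ such that $N_g=1$ or $H_g$ is not degenerated. For $0\le k\le g$, write $\pi_k(x,0)=(\mu_kx^{e_k},S_k(x))$, where $e_k=q_1\cdots q_k$ and $\mu_k\in\mathbb{K}_k^\times$.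 Let $\phi_{-1}=x$ and let $\phi_k\in\mathbb{K}[[x]][y]$ be the unique monic irreducible polynomial of degree $e_k[\mathbb{K}_k:\mathbb{K}]$ with $\phi_k(\mu_kx^{e_k},S_k(x))=0$. For nonzero $Q\in\mathbb{K}[[x]][y]$ let $v_k(Q)$ be the $x$-adic valuation of $\pi_k^*Q$ and let $\lambda_k(Q)\in\mathbb{K}_k$ be the trailing coefficient in $y$ of $(\pi_k^*Q/x^{v_k(Q)})|_{x=0}$. Put $V=(v_k(\phi_{-1}),\dots,v_k(\phi_k))$ and $\Lambda=(\lambda_k(\phi_{-1}),\dots,\lambda_k(\phi_k))$. Let $\psi_{-1}=x$ and let $\psi_k$ be the $N_k$-th approximate root of $F$, i.e. the unique monic polynomial of degree $d/N_k$ with $\deg(F-\psi_k^{N_k})<d-d/N_k$. Let $F=\sum_{B}f'_B\Psi^B$, $f'_B\in\mathbb{K}$, be the unique $\Psi=(\psi_{-1},\dots,\psi_k)$-adic expansion of $F$, where $B=(b_{-1},\dots,b_k)\in\mathbb{N}^{k+2}$, $\Psi^B=\prod_{i=-1}^k\psi_i^{b_i}$ and $b_{i-1}<q_i\ell_i$ for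 $1\le i\le k$. Let $$w'_i=\min\{\langle B,V\rangle : b_k=i,\ f'_B\neq0\}-v_k(F)$$ ($\infty$ if there is no such $B$), $B_0=(0,\dots,0,N_k)$, and $$\bar H'_k=\sum_{(i,w'_i)\in\mathcal{N}}\Bigl(\sum_{b_k=i,\ \langle B,V\rangle=w'_i+v_k(F)}f'_B\,\Lambda^{B-B_0}\Bigr)x^{w'_i}y^i,$$ where $\mathcal{N}$ is either $\mathcal{N}(H_k)$ or the lower convex hull of the points $(i,w'_i)$, $0\le i\le N_k$, $w'_i<\infty$. Then the index $g$ exists and, for both choices of $\mathcal{N}$, $\bar H_k=\bar H'_k$ for all $0\le k<g$, while the Newton polygons of $\bar H_g$ and $\bar H'_g$ have the same lowest edge and $\bar H_g$ and $\bar H'_g$ have the same restriction to that edge. -/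

import Mathlib

open scoped Polynomial PowerSeries

universe u

noncomputable section

namespace NewtonPuiseux

/-! ### Newton polygons and boundary polynomials

Elements of `R⟦X⟧[X]` are polynomials in `y` (the outer variable) over `R⟦x⟧`. A point `(i, j)` of
the plane stands for the monomial `x ^ j * y ^ i`. -/

/-- A Weierstrass polynomial: monic in `y`, the other coefficients vanishing at `x = 0`. -/
def IsWeierstrass {L : Type u} [Field L] (H : L⟦X⟧[X]) : Prop :=
  H.Monic ∧ ∀ i < H.natDegree, PowerSeries.constantCoeff (H.coeff i) = 0

/-- The lower convex hull of a set of points: the lower boundary of its convex hull. -/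
def lowerHull (S : Set (ℝ × ℝ)) : Set (ℝ × ℝ) :=
  {p | p ∈ convexHull ℝ S ∧ ∀ b : ℝ, (p.1, b) ∈ convexHull ℝ S → p.2 ≤ b}

/-- The Newton polygon of `∑ i, a_i(x) y ^ i`: the lower convex hull of the points
`(i, val a_i)` with `a_i ≠ 0`. -/
def newtonPolygon {L : Type u} [Field L] (H : L⟦X⟧[X]) : Set (ℝ × ℝ) :=
  lowerHull {p | ∃ i j : ℕ, (H.coeff i).order = (j : ℕ∞) ∧ p = ((i : ℝ), (j : ℝ))}

open Classical in
/-- The part of `H = ∑ a_ij x ^ j y ^ i` made of the terms with `(i, j) ∈ E`. -/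
def restrictTo {L : Type u} [Field L] (E : Set (ℝ × ℝ)) (H : L⟦X⟧[X]) : L⟦X⟧[X] :=
  ∑ i ∈ Finset.range (H.natDegree + 1), Polynomial.monomial i
    (PowerSeries.mk fun j =>
      if ((i : ℝ), (j : ℝ)) ∈ E then PowerSeries.coeff j (H.coeff i) else 0)

/-- The boundary polynomial of `H`. -/
def boundaryPoly {L : Type u} [Field L] (H : L⟦X⟧[X]) : L⟦X⟧[X] :=
  restrictTo (newtonPolygon H) H

/-- The lowest edge of a polygon: the points joined to its lowest point by a segment that stays
in the polygon. For the polygon of a Weierstrass polynomial, a convex strictly decreasing graph,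
this is the last edge; it is the whole polygon if that is a single point. -/
def lowestEdge (E : Set (ℝ × ℝ)) : Set (ℝ × ℝ) :=
  {p | p ∈ E ∧ ∃ r ∈ E, (∀ p' ∈ E, r.2 ≤ p'.2) ∧ segment ℝ p r ⊆ E}

/-- The quasi-homogeneous polynomial `P(y ^ q / x ^ m) * x ^ (m * deg P)`. -/
def quasiHom {L : Type u} [Field L] (q m : ℕ) (P : L[X]) : L⟦X⟧[X] :=
  P.sum fun j a => Polynomial.monomial (q * j) (PowerSeries.monomial (m * (P.natDegree - j)) a)

/-- Edge data `(q, m, P, N)` of a degenerated polynomial, together with the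
(unique) `s`, `t` such that `q s - t m = 1` and `0 ≤ t < q`. -/
structure EdgeData {L : Type u} [Field L] (H : L⟦X⟧[X]) where
  q : ℕ
  m : ℕ
  P : L[X]
  N : ℕ
  s : ℕ
  t : ℕ
  q_pos : 0 < q
  coprime : Nat.Coprime q m
  straight : ∀ p ∈ newtonPolygon H, ∀ p' ∈ newtonPolygon H,
    (q : ℝ) * (p'.2 - p.2) = -(m : ℝ) * (p'.1 - p.1)
  monic : P.Monic
  irreducible : Irreducible P
  boundary_eq : ∃ c : L, c ≠ 0 ∧
    boundaryPoly H = Polynomial.C (PowerSeries.C c) * quasiHom q m P ^ N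
  bezout : q * s = t * m + 1
  t_lt : t < q

/-- `H` is degenerated: its boundary polynomial is a power of an irreducible quasi-homogeneous
polynomial. -/
def IsDegenerated {L : Type u} [Field L] (H : L⟦X⟧[X]) : Prop :=
  Nonempty (EdgeData H)

/-! ### Substitutions -/

/-- The ring homomorphism `a(x) ↦ a(μ x ^ e)`, for `e > 0`. -/
def scaleHom (K : Type u) {L : Type u} [Field K] [Field L] [Algebra K L] (μ : L) (e : ℕ)
    (he : 0 < e) : K⟦X⟧ →+* L⟦X⟧ :=
  (PowerSeries.substAlgHom (R := K) (S := L)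
    (PowerSeries.HasSubst.of_constantCoeff_zero'
      (show PowerSeries.constantCoeff (PowerSeries.monomial e μ) = 0 by
        rw [← PowerSeries.coeff_zero_eq_constantCoeff_apply, PowerSeries.coeff_monomial,
          if_neg he.ne]))).toRingHom

/-- The pull-back `Q(x, y) ↦ Q(μ x ^ e, T(x, y))`. -/
def pull {K L : Type u} [Field K] [Field L] [Algebra K L] (μ : L) (e : ℕ) (he : 0 < e)
    (T : L⟦X⟧[X]) (Q : K⟦X⟧[X]) : L⟦X⟧[X] :=
  Q.eval₂ (Polynomial.C.comp (scaleHom K μ e he)) T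

/-! ### The Newton-Puiseux type algorithm -/

/-- The state of the algorithm at some rank `k`: the residue field `L = K_k`, the
polynomial `H = H_k` and the map `π_k(x, y) = (μ x ^ e, Y(x, y))`. -/
structure Stage (K : Type u) [Field K] where
  L : Type u
  [field : Field L]
  [algebra : Algebra K L]
  H : L⟦X⟧[X]
  μ : L
  e : ℕ
  e_pos : 0 < e
  Y : L⟦X⟧[X]

attribute [instance] Stage.field Stage.algebra

/-- `- coeff(G, y ^ (N - 1)) / N`, where `N` is the degree of `G`. -/
def tschirnhausShift {L : Type u} [Field L] (G : L⟦X⟧[X]) : L⟦X⟧ :=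
  -(PowerSeries.C (G.natDegree : L)⁻¹ * G.coeff (G.natDegree - 1))

/-- Rank `0`: `K_0 = K`, `H_0 = F(x, y + c_0(x))` and `π_0(x, y) = (x, y + c_0(x))`. -/
def initialStage {K : Type u} [Field K] (F : K⟦X⟧[X]) : Stage K where
  L := K
  H := F.comp (Polynomial.X + Polynomial.C (tschirnhausShift F))
  μ := 1
  e := 1
  e_pos := one_pos
  Y := Polynomial.X + Polynomial.C (tschirnhausShift F)

/-- `G` is the Weierstrass polynomial of degree `N` such that `M = x ^ n * G * V` for a unit `V`
of `L⟦x, y⟧ = L⟦x⟧⟦y⟧`. -/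
def IsWeierstrassPart {L : Type u} [Field L] (M : L⟦X⟧[X]) (n N : ℕ) (G : L⟦X⟧[X]) : Prop :=
  IsWeierstrass G ∧ G.natDegree = N ∧ ∃ V : L⟦X⟧⟦X⟧, IsUnit V ∧
    (M : L⟦X⟧⟦X⟧) = PowerSeries.C ((PowerSeries.X : L⟦X⟧) ^ n) * (G : L⟦X⟧⟦X⟧) * V

/-- The polynomial `G_{k+1}` over the field `K_{k+1} = K_k[Z] / (P)`, with `z` the class of `Z`. -/
def weierstrassPart {L : Type u} [Field L] {H : L⟦X⟧[X]} (D : EdgeData H)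
    [Fact (Irreducible D.P)] : (AdjoinRoot D.P)⟦X⟧[X] :=
  let z : AdjoinRoot D.P := AdjoinRoot.root D.P
  Classical.epsilon (IsWeierstrassPart
    (pull (z ^ D.t) D.q D.q_pos
      (Polynomial.C (PowerSeries.X ^ D.m) *
        (Polynomial.X + Polynomial.C (PowerSeries.C (z ^ D.s)))) H)
    (D.q * D.m * D.P.natDegree * D.N) D.N)

/-- The passage from rank `k` to rank `k + 1`, given the edge data of `H_k`:
`H_{k+1} = G_{k+1}(x, y + c)` and `π_{k+1} = π_k ∘ σ`, where
`σ(x, y) = (z ^ t x ^ q, x ^ m (y + z ^ s + c))`. -/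
def nextStage {K : Type u} [Field K] (S : Stage K) (D : EdgeData S.H) : Stage K :=
  haveI : Fact (Irreducible D.P) := ⟨D.irreducible⟩
  let z : AdjoinRoot D.P := AdjoinRoot.root D.P
  let G := weierstrassPart D
  let c := tschirnhausShift G
  { L := AdjoinRoot D.P
    H := G.comp (Polynomial.X + Polynomial.C c)
    μ := algebraMap S.L (AdjoinRoot D.P) S.μ * (z ^ D.t) ^ S.e
    e := S.e * D.q
    e_pos := Nat.mul_pos S.e_pos D.q_pos
    Y := pull (z ^ D.t) D.q D.q_pos
      (Polynomial.C (PowerSeries.X ^ D.m) *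
        (Polynomial.X + Polynomial.C (PowerSeries.C (z ^ D.s) + c))) S.Y }

open Classical in
/-- The state at rank `k`. (It is only meaningful up to the rank where the sequence stops.) -/
def stage {K : Type u} [Field K] (F : K⟦X⟧[X]) : ℕ → Stage K
  | 0 => initialStage F
  | k + 1 =>
    if h : IsDegenerated (stage F k).H then nextStage (stage F k) h.some else stage F k

/-- The residue field `K_k`. -/
abbrev resField {K : Type u} [Field K] (F : K⟦X⟧[X]) (k : ℕ) : Type u := (stage F k).L

/-- The Weierstrass polynomial `H_k`. -/
def polyH {K : Type u} [Field K] (F : K⟦X⟧[X]) (k : ℕ) : (resField F k)⟦X⟧[X] := (stage F k).H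

/-- The degree `N_k` of `H_k`. -/
def degN {K : Type u} [Field K] (F : K⟦X⟧[X]) (k : ℕ) : ℕ := (polyH F k).natDegree

/-- The stopping condition: `N_k = 1`, or `H_k` is not degenerated. -/
def Stops {K : Type u} [Field K] (F : K⟦X⟧[X]) (k : ℕ) : Prop :=
  degN F k = 1 ∨ ¬ IsDegenerated (polyH F k)

open Classical in
/-- `q_{k+1} * ℓ_{k+1}`, with `q_{k+1}` and `ℓ_{k+1} = deg P_{k+1}` taken from the edge data
of `H_k`. -/
def qell {K : Type u} [Field K] (F : K⟦X⟧[X]) (k : ℕ) : ℕ :=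
  if h : IsDegenerated (stage F k).H then h.some.q * h.some.P.natDegree else 0

/-- The pull-back `π_k^*`. -/
def pullPi {K : Type u} [Field K] (F : K⟦X⟧[X]) (k : ℕ) (Q : K⟦X⟧[X]) :
    (resField F k)⟦X⟧[X] :=
  pull (stage F k).μ (stage F k).e (stage F k).e_pos (stage F k).Y Q

/-- `φ` is the `k`-th minimal polynomial of `F`: the monic irreducible polynomial of degree
`e_k * [K_k : K]` that vanishes at `π_k(x, 0)`. -/
def IsMinimalPoly {K : Type u} [Field K] (F : K⟦X⟧[X]) (k : ℕ) (φ : K⟦X⟧[X]) : Prop :=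
  φ.Monic ∧ Irreducible φ ∧
    φ.natDegree = (stage F k).e * Module.finrank K (resField F k) ∧
    φ.eval₂ (scaleHom K (stage F k).μ (stage F k).e (stage F k).e_pos)
      ((stage F k).Y.coeff 0) = 0

/-- The `k`-th minimal polynomial `φ_k` of `F`. -/
def minimalPoly {K : Type u} [Field K] (F : K⟦X⟧[X]) (k : ℕ) : K⟦X⟧[X] :=
  Classical.epsilon (IsMinimalPoly F k)

/-! ### The valuation `v_k` and the morphism `λ_k` -/

/-- The `x`-valuation on `L⟦x⟧[y]`. -/
def xVal {L : Type u} [Field L] (Q : L⟦X⟧[X]) : ℕ∞ :=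
  ⨅ i, (Q.coeff i).order

/-- The trailing coefficient with respect to `y` of `(Q / x ^ (val Q))` at `x = 0`. -/
def lead {L : Type u} [Field L] (Q : L⟦X⟧[X]) : L :=
  (Q.sum fun i a => (Polynomial.monomial i (PowerSeries.coeff (xVal Q).toNat a) : L[X])).trailingCoeff

/-- `v_k(Q)`, for `Q ≠ 0`. -/
def val {K : Type u} [Field K] (F : K⟦X⟧[X]) (k : ℕ) (Q : K⟦X⟧[X]) : ℕ :=
  (xVal (pullPi F k Q)).toNat

/-- `λ_k(Q)`. -/
def lam {K : Type u} [Field K] (F : K⟦X⟧[X]) (k : ℕ) (Q : K⟦X⟧[X]) : resField F k :=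
  lead (pullPi F k Q)

/-- Exponents `B = (b_{-1}, (b_0, …, b_k))`. -/
abbrev Exponent (k : ℕ) : Type := ℕ × (Fin (k + 1) → ℕ)

/-- `⟨B, V⟩`, where `V = (v_k(x), v_k(φ_0), …, v_k(φ_k))`. -/
def weight {K : Type u} [Field K] (F : K⟦X⟧[X]) (k : ℕ) (B : Exponent k) : ℕ :=
  B.1 * val F k (Polynomial.C PowerSeries.X) + ∑ i : Fin (k + 1), B.2 i * val F k (minimalPoly F i)

/-- `Λ ^ B`, where `Λ = (λ_k(x), λ_k(φ_0), …, λ_k(φ_k))`. -/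
def lamPow {K : Type u} [Field K] (F : K⟦X⟧[X]) (k : ℕ) (B : Exponent k) : resField F k :=
  lam F k (Polynomial.C PowerSeries.X) ^ B.1 * ∏ i : Fin (k + 1), lam F k (minimalPoly F i) ^ B.2 i

/-- `B_0 = (0, …, 0, N_k)`. -/
def baseExponent {K : Type u} [Field K] (F : K⟦X⟧[X]) (k : ℕ) : Exponent k :=
  (0, Pi.single (Fin.last k) (degN F k))

/-! ### Approximate roots and adic expansions -/

/-- `ψ` is the `N`-th approximate root of `F`. -/
def IsApproxRoot {K : Type u} [Field K] (F : K⟦X⟧[X]) (N : ℕ) (ψ : K⟦X⟧[X]) : Prop :=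
  ψ.Monic ∧ ψ.natDegree = F.natDegree / N ∧
    (F - ψ ^ N).degree < ((F.natDegree - F.natDegree / N : ℕ) : WithBot ℕ)

/-- `ψ_k`, the `N_k`-th approximate root of `F`. -/
def approxRoot {K : Type u} [Field K] (F : K⟦X⟧[X]) (k : ℕ) : K⟦X⟧[X] :=
  Classical.epsilon (IsApproxRoot F (degN F k))

/-- `a` is the `(ψ_{-1}, ψ_0, …, ψ_k)`-adic expansion `F = ∑_B f_B Ψ ^ B`, where `ψ_{-1} = x` and
`b_{i-1} < q_i ℓ_i` for `1 ≤ i ≤ k`. The (infinitely many) powers of `x` are collected: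
`a (b_0, …, b_k)` is the series `∑ n, f_(n, b_0, …, b_k) x ^ n`. -/
def IsPsiExpansion {K : Type u} [Field K] (F : K⟦X⟧[X]) (k : ℕ)
    (a : (Fin (k + 1) → ℕ) →₀ K⟦X⟧) : Prop :=
  (∀ b ∈ a.support, ∀ i : Fin k, b i.castSucc < qell F i) ∧
    F = a.sum fun b c => Polynomial.C c * ∏ i : Fin (k + 1), approxRoot F i ^ b i

/-- The coefficient `f'_B` of the `Ψ`-adic expansion of `F`. -/
def psiCoeff {K : Type u} [Field K] (F : K⟦X⟧[X]) (k : ℕ) (B : Exponent k) : K :=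
  PowerSeries.coeff B.1 (Classical.epsilon (IsPsiExpansion F k) B.2)

/-! ### The polynomial `H̄'_k` -/

/-- `w'_i = min {⟨B, V⟩ | b_k = i, f'_B ≠ 0} - v_k(F)`, which is `⊤` if there is no such `B`. -/
def psiHeight {K : Type u} [Field K] (F : K⟦X⟧[X]) (k i : ℕ) : WithTop ℤ :=
  ENat.map (fun n : ℕ => (n : ℤ) - (val F k F : ℤ))
    (⨅ (B : Exponent k) (_ : B.2 (Fin.last k) = i ∧ psiCoeff F k B ≠ 0), (weight F k B : ℕ∞))

/-- The lower convex hull of the points `(i, w'_i)`, `0 ≤ i ≤ N_k`. -/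
def psiPolygon {K : Type u} [Field K] (F : K⟦X⟧[X]) (k : ℕ) : Set (ℝ × ℝ) :=
  lowerHull {p | ∃ i ≤ degN F k, ∃ w : ℤ, psiHeight F k i = (w : WithTop ℤ) ∧
    p = ((i : ℝ), (w : ℝ))}

open Classical in
/-- `∑_{(i, w'_i) ∈ E} (∑_{B ∈ 𝓑(i, w'_i + v_k(F))} f'_B Λ ^ (B - B_0)) x ^ w'_i y ^ i`,
where `𝓑(i, w)` is the set of exponents `B` with `b_k = i` and `⟨B, V⟩ = w`. (Exponents which
violate the bounds of the expansion have `f'_B = 0`.) -/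
def psiBoundaryPoly {K : Type u} [Field K] (F : K⟦X⟧[X]) (k : ℕ) (E : Set (ℝ × ℝ)) :
    (resField F k)⟦X⟧[X] :=
  ∑ i ∈ Finset.range (degN F k + 1), Polynomial.monomial i
    (PowerSeries.mk fun w =>
      if psiHeight F k i = ((w : ℤ) : WithTop ℤ) ∧ ((i : ℝ), (w : ℝ)) ∈ E then
        ∑ᶠ B ∈ {B : Exponent k | B.2 (Fin.last k) = i ∧ weight F k B = w + val F k F},
          algebraMap K (resField F k) (psiCoeff F k B) *
            (lamPow F k B / lamPow F k (baseExponent F k))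
      else 0)

end NewtonPuiseux

end

/-! Write `Q = p(y) x ^ w + ...` (`Ini Q w p`) for the initial form of a pull-back. Everything rests
on the behaviour of `π_k^*` on polynomials of degree at most `d_k = e_k [K_k : K]`, recorded in
`Inv` and proved by induction on `k`. A nonzero `Q` of degree `< d_k` pulls back to a power of `x`
times a polynomial that is nonzero at the origin. A monic `χ` of degree `d_k` that vanishes at
`π_k(x, 0)` pulls back to `x ^ v y` times such a polynomial. Moreover `π_k^* F = x ^ v H_k U` with
`U(0, 0) ≠ 0`.

For the induction step, a polynomial is expanded in powers of a root `χ` of the current stage. Under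
the next substitution each term `A_i χ ^ i` has initial form a constant times `(y + z ^ s) ^ i`.
Among the terms of least order the exponents of `z` satisfy `q κ_i = c + i`, so at `y = 0` their sum
is a power of `z` times `R(z)`, where `R` is nonzero over the previous field. In degree below `q ℓ
d_k` one has `deg R < deg P`, hence `R(z) ≠ 0`. In degree `q ℓ d_k` the sum can vanish only if `R`
is a multiple of `P`, and then the coefficient of `y` is nonzero, because `q` and `P'(z)` are
(`sum_ne_zero_of_exponents`, `sum_mul_ne_zero_of_exponents`).

The core is `Inv.comparison`. Let `F = ∑ A_i χ ^ i`, where `χ` is close to a root (`Good`), and let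
`q j + m i = m N` be a line through `(N, 0)` below the points of `H_k`. The substitution `x ↦ x ^
q`, `y ↦ x ^ m y` makes the initial form of `A_i χ ^ i` a multiple of `y ^ i`, so distinct digits
cannot cancel. On the other side stands the part of `H_k` on the line, times `U(0, 0)`. Hence the
leading terms of the digits are the coefficients of `H_k` on the line.

Since `H_k` has no term in `y ^ (N - 1)`, the digit `A_(N-1)` lies strictly above the line.
Replacing `χ` by `χ + A_(N-1) / N` therefore keeps it close, while it lowers the degree of `F - χ ^
N`; iteration ends at the approximate root `ψ_k` (`Inv.exists_approxRoot_of_good`). So `ψ_k` and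
`φ_k` share their leading data at stage `k`, and their whole initial form at later stages
(`Admissible.sameIni`). This is why `V` and `Λ`, defined by the `φ_i`, give the weights of an
expansion in the `ψ_i`.

Each digit is expanded further in `x, ψ_0, ..., ψ_(k-1)`. No term has order below that of the digit
(`Admissible.le_weight_of_ini`), so `w'_i` is the order of the digit, suitably shifted, and the
inner sum of the theorem is its leading coefficient (`Admissible.psi_comparison`). If `H_k` is
degenerated, one line carries its whole polygon and the boundary polynomials agree. At rank `g` only
the line of the lowest edge passes through `(N, 0)`, whence the weaker conclusion. The algorithm
stops because the vanishing coefficient of `y ^ (N - 1)` forces `q ℓ > 1`, while `d_k` divides `d`.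
-/

open scoped Polynomial PowerSeries

noncomputable section

namespace NewtonPuiseux

/-! ### Initial forms with respect to `x` -/

section Ini

variable {L : Type u} [Field L]

/-- `Q = p(y) x ^ w + (terms of higher degree in x)`. -/
def Ini (Q : L⟦X⟧[X]) (w : ℕ) (p : L[X]) : Prop :=
  ∃ A : L⟦X⟧[X], Q = Polynomial.C (PowerSeries.X ^ w) * A ∧
    A.map PowerSeries.constantCoeff = p

theorem Ini.zero (w : ℕ) : Ini (0 : L⟦X⟧[X]) w 0 := ⟨0, by simp, by simp⟩

theorem Ini.one : Ini (1 : L⟦X⟧[X]) 0 1 := ⟨1, by simp, by simp⟩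

theorem Ini.add {Q Q' : L⟦X⟧[X]} {w : ℕ} {p p' : L[X]} (h : Ini Q w p) (h' : Ini Q' w p') :
    Ini (Q + Q') w (p + p') := by
  obtain ⟨A, rfl, rfl⟩ := h
  obtain ⟨A', rfl, rfl⟩ := h'
  exact ⟨A + A', by ring, by simp⟩

theorem Ini.sum {ι : Type*} (s : Finset ι) {Q : ι → L⟦X⟧[X]} {w : ℕ} {p : ι → L[X]}
    (h : ∀ i ∈ s, Ini (Q i) w (p i)) : Ini (∑ i ∈ s, Q i) w (∑ i ∈ s, p i) := by
  classical
  induction s using Finset.induction_on with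
  | empty => simpa using Ini.zero w
  | insert a s ha ih =>
    rw [Finset.sum_insert ha, Finset.sum_insert ha]
    exact (h a (by simp)).add (ih fun i hi => h i (by simp [hi]))

theorem Ini.mul {Q Q' : L⟦X⟧[X]} {w w' : ℕ} {p p' : L[X]} (h : Ini Q w p) (h' : Ini Q' w' p') :
    Ini (Q * Q') (w + w') (p * p') := by
  obtain ⟨A, rfl, rfl⟩ := h
  obtain ⟨A', rfl, rfl⟩ := h'
  exact ⟨A * A', by rw [pow_add, Polynomial.C_mul]; ring, by simp⟩

theorem Ini.pow {Q : L⟦X⟧[X]} {w : ℕ} {p : L[X]} (h : Ini Q w p) (n : ℕ) :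
    Ini (Q ^ n) (n * w) (p ^ n) := by
  obtain ⟨A, rfl, rfl⟩ := h
  exact ⟨A ^ n, by rw [mul_pow, ← Polynomial.C_pow, ← pow_mul, mul_comm n w], by simp⟩

theorem Ini.prod {ι : Type*} (s : Finset ι) {Q : ι → L⟦X⟧[X]} {w : ι → ℕ} {p : ι → L[X]}
    (h : ∀ i ∈ s, Ini (Q i) (w i) (p i)) : Ini (∏ i ∈ s, Q i) (∑ i ∈ s, w i) (∏ i ∈ s, p i) := by
  classical
  induction s using Finset.induction_on with
  | empty => simpa using Ini.one
  | insert a s ha ih =>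
    rw [Finset.prod_insert ha, Finset.prod_insert ha, Finset.sum_insert ha]
    exact (h a (by simp)).mul (ih fun i hi => h i (by simp [hi]))

/-- The polynomial of an `Ini` may be zero, so that `w` alone is only a lower bound for the order.
Terms of higher order thus enter a sum with initial form `0`. -/
theorem Ini.of_lt {Q : L⟦X⟧[X]} {w w' : ℕ} {p : L[X]} (h : Ini Q w p) (hw : w' < w) :
    Ini Q w' 0 := by
  obtain ⟨A, rfl, rfl⟩ := h
  obtain ⟨c, rfl⟩ := Nat.exists_eq_add_of_lt hw
  refine ⟨Polynomial.C (PowerSeries.X ^ (c + 1)) * A, ?_, by simp⟩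
  rw [add_assoc, pow_add, Polynomial.C_mul, mul_assoc]

theorem Ini.cast {Q : L⟦X⟧[X]} {w w' : ℕ} {p p' : L[X]} (h : Ini Q w p) (hw : w = w')
    (hp : p = p') : Ini Q w' p' := by
  subst hw hp; exact h

theorem C_X_pow_ne_zero (w : ℕ) : Polynomial.C ((PowerSeries.X : L⟦X⟧) ^ w) ≠ 0 :=
  Polynomial.C_ne_zero.2 (pow_ne_zero _ PowerSeries.X_ne_zero)

theorem Ini.unique {Q : L⟦X⟧[X]} {w : ℕ} {p p' : L[X]} (h : Ini Q w p) (h' : Ini Q w p') :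
    p = p' := by
  obtain ⟨A, rfl, rfl⟩ := h
  obtain ⟨A', h', rfl⟩ := h'
  rw [mul_left_cancel₀ (C_X_pow_ne_zero w) h']

theorem Ini.le_of_ne_zero {Q : L⟦X⟧[X]} {w w' : ℕ} {p p' : L[X]} (h : Ini Q w p) (hp : p ≠ 0)
    (h' : Ini Q w' p') : w' ≤ w := by
  by_contra! hlt
  exact hp (h.unique (h'.of_lt hlt))

theorem Ini.unique_order {Q : L⟦X⟧[X]} {w w' : ℕ} {p p' : L[X]} (h : Ini Q w p) (hp : p ≠ 0)
    (h' : Ini Q w' p') (hp' : p' ≠ 0) : w = w' :=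
  le_antisymm (h'.le_of_ne_zero hp' h) (h.le_of_ne_zero hp h')

theorem Ini.ne_zero {Q : L⟦X⟧[X]} {w : ℕ} {p : L[X]} (h : Ini Q w p) (hp : p ≠ 0) : Q ≠ 0 := by
  rintro rfl
  exact hp (h.unique (Ini.zero w))

/-- The sum of a family of initial forms, taken at the least order. -/
theorem Ini.sum_min {ι : Type*} (s : Finset ι) {Q : ι → L⟦X⟧[X]} {w : ι → ℕ} {p : ι → L[X]}
    {M : ℕ} (h : ∀ i ∈ s, Ini (Q i) (w i) (p i)) (hM : ∀ i ∈ s, M ≤ w i) :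
    Ini (∑ i ∈ s, Q i) M (∑ i ∈ s with w i = M, p i) := by
  classical
  rw [Finset.sum_filter]
  refine Ini.sum s fun i hi => ?_
  split_ifs with hw
  · exact (h i hi).cast hw rfl
  · exact (h i hi).of_lt (lt_of_le_of_ne (hM i hi) (Ne.symm hw))

theorem Ini.C_of_order_le {a : L⟦X⟧} {n : ℕ} (h : (n : ℕ∞) ≤ a.order) :
    Ini (Polynomial.C a) n (Polynomial.C (PowerSeries.coeff n a)) := by
  obtain ⟨b, rfl⟩ := PowerSeries.X_pow_dvd_iff.2
    fun m hm => PowerSeries.coeff_of_lt_order m (lt_of_lt_of_le (by exact_mod_cast hm) h)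
  refine ⟨Polynomial.C b, by simp, ?_⟩
  have := PowerSeries.coeff_X_pow_mul b n 0
  simp only [zero_add] at this
  simp [this]

theorem Ini.exists_map_coeff {Q : L⟦X⟧[X]} {w : ℕ} {p : L[X]} (h : Ini Q w p) (i : ℕ) :
    (∀ j < w, PowerSeries.coeff j (Q.coeff i) = 0) ∧
      PowerSeries.coeff w (Q.coeff i) = p.coeff i := by
  obtain ⟨A, rfl, rfl⟩ := h
  constructor
  · intro j hj
    rw [Polynomial.coeff_C_mul, PowerSeries.coeff_X_pow_mul', if_neg (by omega)]
  · rw [Polynomial.coeff_C_mul, PowerSeries.coeff_X_pow_mul', if_pos le_rfl]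
    simp

theorem Ini.xVal_eq {Q : L⟦X⟧[X]} {w : ℕ} {p : L[X]} (h : Ini Q w p) (hp : p ≠ 0) :
    xVal Q = w := by
  apply le_antisymm
  · obtain ⟨i, hi⟩ : ∃ i, p.coeff i ≠ 0 := by
      by_contra! hc
      exact hp (Polynomial.ext (by simpa using hc))
    refine (iInf_le _ i).trans (PowerSeries.order_le w ?_)
    rw [(h.exists_map_coeff i).2]
    exact hi
  · refine le_iInf fun i => PowerSeries.le_order _ _ fun j hj => ?_
    exact (h.exists_map_coeff i).1 j (by exact_mod_cast hj)

theorem Ini.lead_eq {Q : L⟦X⟧[X]} {w : ℕ} {p : L[X]} (h : Ini Q w p) (hp : p ≠ 0) :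
    lead Q = p.trailingCoeff := by
  unfold lead
  rw [h.xVal_eq hp]
  congr 1
  ext i
  rw [Polynomial.sum_def, Polynomial.finsetSum_coeff]
  simp only [Polynomial.coeff_monomial, ENat.toNat_natCast]
  rw [Finset.sum_ite_eq' Q.support i, ← (h.exists_map_coeff i).2]
  split_ifs with hi
  · rfl
  · rw [Polynomial.notMem_support_iff.1 hi, map_zero]

theorem trailingCoeff_of_coeff_zero_ne_zero {p : L[X]} (hp : p.coeff 0 ≠ 0) :
    p.trailingCoeff = p.coeff 0 := by
  rw [Polynomial.trailingCoeff, Polynomial.natTrailingDegree_eq_zero.2 (Or.inr hp)]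

theorem ne_zero_of_coeff_zero_ne_zero {p : L[X]} (hp : p.coeff 0 ≠ 0) : p ≠ 0 := by
  rintro rfl; simp at hp

theorem map_constantCoeff_coeff (A : L⟦X⟧[X]) (i : ℕ) :
    (A.map PowerSeries.constantCoeff).coeff i = PowerSeries.constantCoeff (A.coeff i) :=
  Polynomial.coeff_map _ _

end Ini

/-! ### Pull-backs and their effect on initial forms -/

section Pull

variable {K L : Type u} [Field K] [Field L] [Algebra K L]

/-- The definition by substitution is unfolded only here; the later facts about `scaleHom` come from
this formula. -/
theorem coeff_scaleHom (μ : L) (e : ℕ) (he : 0 < e) (a : K⟦X⟧) (n : ℕ) :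
    PowerSeries.coeff n (scaleHom K μ e he a) =
      if e ∣ n then μ ^ (n / e) * algebraMap K L (PowerSeries.coeff (n / e) a) else 0 := by
  have hs : PowerSeries.HasSubst (PowerSeries.monomial e μ) :=
    PowerSeries.HasSubst.monomial' he.ne' μ
  have h1 : scaleHom K μ e he a = a.subst (PowerSeries.monomial e μ) := by
    rw [scaleHom, ← PowerSeries.coe_substAlgHom hs]; rfl
  rw [h1, PowerSeries.coeff_subst' hs, finsum_eq_single _ (n / e)]
  · rw [PowerSeries.monomial_pow, PowerSeries.coeff_monomial]
    by_cases hd : e ∣ n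
    · rw [if_pos (Nat.div_mul_cancel hd).symm,
        if_pos hd, Algebra.smul_def, mul_comm]
    · rw [if_neg hd, if_neg, smul_zero]
      intro h
      exact hd ⟨n / e, by rw [mul_comm]; exact h⟩
  · intro d hd
    rw [PowerSeries.monomial_pow, PowerSeries.coeff_monomial, if_neg, smul_zero]
    rintro rfl
    exact hd (by simp [he])

theorem scaleHom_C (μ : L) (e : ℕ) (he : 0 < e) (c : K) :
    scaleHom K μ e he (PowerSeries.C c) = PowerSeries.C (algebraMap K L c) := by
  ext n
  rw [coeff_scaleHom, PowerSeries.coeff_C, PowerSeries.coeff_C]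
  rcases Nat.eq_zero_or_pos n with rfl | hn
  · simp
  · rw [if_neg hn.ne']
    split_ifs with h h'
    · exact absurd h' (Nat.div_pos (Nat.le_of_dvd hn h) he).ne'
    · simp
    · rfl

theorem scaleHom_X (μ : L) (e : ℕ) (he : 0 < e) :
    scaleHom K μ e he PowerSeries.X = PowerSeries.C μ * PowerSeries.X ^ e := by
  ext n
  rw [coeff_scaleHom, PowerSeries.coeff_C_mul, PowerSeries.coeff_X_pow, PowerSeries.coeff_X]
  by_cases h : n = e
  · subst h; simp [Nat.div_self he]
  · rw [if_neg h, mul_zero]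
    split_ifs with h1 h2
    · exact absurd (by rw [← Nat.div_mul_cancel h1, h2, one_mul]) h
    · simp
    · rfl

theorem constantCoeff_scaleHom (μ : L) (e : ℕ) (he : 0 < e) (a : K⟦X⟧) :
    PowerSeries.constantCoeff (scaleHom K μ e he a) =
      algebraMap K L (PowerSeries.constantCoeff a) := by
  rw [← PowerSeries.coeff_zero_eq_constantCoeff_apply, coeff_scaleHom]
  simp

theorem scaleHom_one_one (a : K⟦X⟧) : scaleHom K (1 : K) 1 one_pos a = a := by
  ext n
  rw [coeff_scaleHom]
  simp

/-- The pull-back as a ring homomorphism. -/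
def pullHom (K : Type u) [Field K] [Algebra K L] (μ : L) (e : ℕ) (he : 0 < e) (T : L⟦X⟧[X]) :
    K⟦X⟧[X] →+* L⟦X⟧[X] :=
  Polynomial.eval₂RingHom (Polynomial.C.comp (scaleHom K μ e he)) T

@[simp] theorem pullHom_C (μ : L) (e : ℕ) (he : 0 < e) (T : L⟦X⟧[X]) (a : K⟦X⟧) :
    pullHom K μ e he T (Polynomial.C a) = Polynomial.C (scaleHom K μ e he a) := by
  simp [pullHom]

@[simp] theorem pullHom_X (μ : L) (e : ℕ) (he : 0 < e) (T : L⟦X⟧[X]) :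
    pullHom K μ e he T Polynomial.X = T := by
  simp [pullHom]

/-- This is what gives `π_(k+1)^* = σ^* ∘ π_k^*`, and lets properties of a stage be carried to the
next one. -/
theorem pullHom_comp {L' : Type u} [Field L'] [Algebra L L'] [Algebra K L'] [IsScalarTower K L L']
    (μ : L) (e : ℕ) (he : 0 < e) (T : L⟦X⟧[X]) (ζ : L') (q : ℕ) (hq : 0 < q) (T' : L'⟦X⟧[X])
    (Q : K⟦X⟧[X]) :
    pullHom L ζ q hq T' (pullHom K μ e he T Q) =
      pullHom K (algebraMap L L' μ * ζ ^ e) (e * q) (Nat.mul_pos he hq)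
        (pullHom L ζ q hq T' T) Q := by
  have hs : (scaleHom L ζ q hq).comp (scaleHom K μ e he) =
      scaleHom K (algebraMap L L' μ * ζ ^ e) (e * q) (Nat.mul_pos he hq) := by
    ext a n
    simp only [RingHom.comp_apply, coeff_scaleHom]
    by_cases h : e * q ∣ n
    · obtain ⟨k, rfl⟩ := h
      have h1 : q ∣ e * q * k := ⟨e * k, by ring⟩
      have h2 : e * q * k / q = e * k := by
        rw [show e * q * k = e * k * q by ring, Nat.mul_div_cancel _ hq]
      have h3 : e * q * k / (e * q) = k := Nat.mul_div_cancel_left _ (Nat.mul_pos he hq)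
      rw [if_pos h1, h2, if_pos ⟨k, rfl⟩, if_pos ⟨k, rfl⟩, h3, Nat.mul_div_cancel_left _ he,
        map_mul, map_pow, ← IsScalarTower.algebraMap_apply, mul_pow, ← pow_mul]
      ring
    · rw [if_neg h]
      split_ifs with h1 h2
      · exfalso
        obtain ⟨k, rfl⟩ := h1
        rw [Nat.mul_div_cancel_left _ hq] at h2
        obtain ⟨j, rfl⟩ := h2
        exact h ⟨j, by ring⟩
      · simp
      · rfl
  have : (pullHom L ζ q hq T').comp (pullHom K μ e he T) =
      pullHom K (algebraMap L L' μ * ζ ^ e) (e * q) (Nat.mul_pos he hq)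
        (pullHom L ζ q hq T' T) := by
    refine Polynomial.ringHom_ext (fun a => ?_) ?_
    · rw [RingHom.comp_apply, pullHom_C, pullHom_C, pullHom_C, ← hs]; rfl
    · rw [RingHom.comp_apply, pullHom_X, pullHom_X]
  exact congrArg (fun f => f Q) this

/-- A substitution `y ↦ T` with `T(0, y) = 0` maps `A` to `A(0, 0)` modulo `x`. -/
theorem map_constantCoeff_pullHom (ζ : L) (q : ℕ) (hq : 0 < q) {T : L⟦X⟧[X]}
    (hT : T.map PowerSeries.constantCoeff = 0) (A : K⟦X⟧[X]) :
    (pullHom K ζ q hq T A).map PowerSeries.constantCoeff =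
      Polynomial.C (algebraMap K L (PowerSeries.constantCoeff (A.coeff 0))) := by
  induction A using Polynomial.induction_on' with
  | add p q hp hq => simp [Polynomial.map_add, hp, hq]
  | monomial n a =>
    rw [← Polynomial.C_mul_X_pow_eq_monomial, map_mul, map_pow, pullHom_C, pullHom_X,
      Polynomial.map_mul, Polynomial.map_pow, hT, Polynomial.map_C, constantCoeff_scaleHom]
    rcases n with _ | n
    · simp
    · simp

theorem map_constantCoeff_C_X_pow_mul {m : ℕ} (hm : 0 < m) (T : L⟦X⟧[X]) :
    (Polynomial.C (PowerSeries.X ^ m) * T).map PowerSeries.constantCoeff = 0 := by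
  simp [hm.ne']

/-- As `T` vanishes at `x = 0`, only the constant term of the initial form survives. If it is zero,
the conclusion is a mere bound on the order. -/
theorem Ini.pullHom {Q : K⟦X⟧[X]} {w : ℕ} {p : K[X]} (h : Ini Q w p) (ζ : L) (q : ℕ) (hq : 0 < q)
    {T : L⟦X⟧[X]} (hT : T.map PowerSeries.constantCoeff = 0) :
    Ini (pullHom K ζ q hq T Q) (q * w) (Polynomial.C (ζ ^ w * algebraMap K L (p.coeff 0))) := by
  obtain ⟨A, rfl, rfl⟩ := h
  refine ⟨Polynomial.C (PowerSeries.C (ζ ^ w)) * NewtonPuiseux.pullHom K ζ q hq T A, ?_, ?_⟩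
  · rw [map_mul, pullHom_C, map_pow, scaleHom_X, mul_pow, ← pow_mul, Polynomial.C_mul, ← map_pow PowerSeries.C]
    ring
  · rw [Polynomial.map_mul, map_constantCoeff_pullHom ζ q hq hT, Polynomial.map_C,
      map_constantCoeff_coeff, ← Polynomial.C_mul]
    simp

end Pull

/-! ### One substitution step: elements close to a root -/

section Step

variable {L L' : Type u} [Field L] [Field L'] [Algebra L L']

/-- `Q = x ^ v (θ(x) + y u(x, y))` with `u(0, 0) = u₀ ≠ 0`, where the order of `θ` is
greater than `m / q`. -/
def Good (q m : ℕ) (Q : L⟦X⟧[X]) (v : ℕ) (u₀ : L) : Prop :=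
  u₀ ≠ 0 ∧ ∃ (θ : L⟦X⟧) (u : L⟦X⟧[X]),
    Q = Polynomial.C (PowerSeries.X ^ v) * (Polynomial.C θ + Polynomial.X * u) ∧
    PowerSeries.constantCoeff (u.coeff 0) = u₀ ∧
    ∀ j, q * j ≤ m → PowerSeries.coeff j θ = 0

theorem Ini.C_of_coeff_eq_zero {a : L⟦X⟧} {n : ℕ}
    (h : ∀ j ≤ n, PowerSeries.coeff j a = 0) : Ini (Polynomial.C a) n 0 := by
  refine (Ini.C_of_order_le (PowerSeries.le_order _ _ fun j hj => ?_)).cast rfl ?_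
  · exact h j (by exact_mod_cast hj.le)
  · rw [h n le_rfl, Polynomial.C_0]

theorem Ini.X_pow_mul (m : ℕ) (T : L⟦X⟧[X]) :
    Ini (Polynomial.C (PowerSeries.X ^ m) * T) m (T.map PowerSeries.constantCoeff) :=
  ⟨T, rfl, rfl⟩

/-- The condition on `θ` at `j = 0` makes `θ` vanish at `x = 0`, so the initial form is divisible by
`y` exactly once. This identifies `v` with the valuation and `u₀` with the trailing coefficient. -/
theorem Good.ini {q m : ℕ} {Q : L⟦X⟧[X]} {v : ℕ} {u₀ : L} (h : Good q m Q v u₀) :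
    ∃ p : L[X], Ini Q v (Polynomial.X * p) ∧ p.coeff 0 = u₀ := by
  obtain ⟨-, θ, u, rfl, hu, hθ⟩ := h
  refine ⟨u.map PowerSeries.constantCoeff, (Ini.X_pow_mul v _).cast rfl ?_, by simp [hu]⟩
  have : PowerSeries.constantCoeff θ = 0 := by simpa using hθ 0 (by simp)
  simp [this]

/-- As the order of `θ` exceeds `m / q`, the series `θ(ζ x ^ q)` has order greater than `m`. The
summand `y u`, with `y = x ^ m T`, dominates. -/
theorem Good.pullHom {q m : ℕ} {Q : L⟦X⟧[X]} {v : ℕ} {u₀ : L} (h : Good q m Q v u₀) (ζ : L')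
    (hq : 0 < q) (hm : 0 < m) (T : L'⟦X⟧[X]) :
    Ini (pullHom L ζ q hq (Polynomial.C (PowerSeries.X ^ m) * T) Q) (q * v + m)
      (Polynomial.C (ζ ^ v * algebraMap L L' u₀) * T.map PowerSeries.constantCoeff) := by
  obtain ⟨-, θ, u, rfl, hu, hθ⟩ := h
  have hT := map_constantCoeff_C_X_pow_mul hm T
  have h1 : Ini (Polynomial.C ((PowerSeries.X : L⟦X⟧) ^ v)) v 1 := ⟨1, by simp, by simp⟩
  have h1' := h1.pullHom ζ q hq hT
  have h2 : Ini (NewtonPuiseux.pullHom L ζ q hq (Polynomial.C (PowerSeries.X ^ m) * T)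
      (Polynomial.C θ)) m 0 := by
    rw [pullHom_C]
    refine Ini.C_of_coeff_eq_zero fun j hj => ?_
    rw [coeff_scaleHom]
    split_ifs with hd
    · rw [hθ _ (by rwa [Nat.mul_div_cancel' hd]), map_zero, mul_zero]
    · rfl
  have h3 : Ini u 0 (u.map PowerSeries.constantCoeff) := ⟨u, by simp, rfl⟩
  have h3' := h3.pullHom ζ q hq hT
  have h4 := (Ini.X_pow_mul m T).mul h3'
  rw [map_mul, map_add, map_mul, pullHom_X]
  refine (h1'.mul (h2.add (h4.cast (by simp) rfl))).cast rfl ?_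
  simp only [Polynomial.coeff_one_zero, map_one, mul_one, pow_zero, one_mul, zero_add,
    map_constantCoeff_coeff, hu, Polynomial.C_mul]
  ring

theorem Good.pullHom_mul_pow {q m : ℕ} {Q : L⟦X⟧[X]} {v : ℕ} {u₀ : L} (h : Good q m Q v u₀)
    (ζ : L') (hq : 0 < q) (hm : 0 < m) (T : L'⟦X⟧[X]) {A : L⟦X⟧[X]} {w : ℕ} {p : L[X]}
    (hA : Ini A w p) (i : ℕ) :
    Ini (NewtonPuiseux.pullHom L ζ q hq (Polynomial.C (PowerSeries.X ^ m) * T) (A * Q ^ i))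
      (q * w + i * (q * v + m))
      (Polynomial.C (ζ ^ (w + v * i) * algebraMap L L' (p.coeff 0 * u₀ ^ i)) *
        T.map PowerSeries.constantCoeff ^ i) := by
  rw [RingHom.map_mul, RingHom.map_pow (NewtonPuiseux.pullHom _ _ _ _ _)]
  refine ((hA.pullHom ζ q hq (map_constantCoeff_C_X_pow_mul hm T)).mul
    ((h.pullHom ζ hq hm T).pow i)).cast rfl ?_
  rw [mul_pow, ← Polynomial.C_pow, ← mul_assoc, ← Polynomial.C_mul]
  congr 2
  rw [map_mul, map_pow, mul_pow, pow_add, pow_mul]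
  ring

theorem exists_eq_X_mul_of_coeff_zero {Q : L⟦X⟧[X]} {w : ℕ} {p : L[X]} (h : Ini Q w p)
    (hQ : Q.coeff 0 = 0) : ∃ u : L⟦X⟧[X],
      Q = Polynomial.C (PowerSeries.X ^ w) * (Polynomial.X * u) ∧
      PowerSeries.constantCoeff (u.coeff 0) = p.coeff 1 := by
  obtain ⟨A, rfl, rfl⟩ := h
  have hA : A.coeff 0 = 0 := by
    rw [Polynomial.coeff_C_mul] at hQ
    exact (mul_eq_zero.1 hQ).resolve_left (pow_ne_zero _ PowerSeries.X_ne_zero)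
  obtain ⟨u, rfl⟩ := Polynomial.X_dvd_iff.2 hA
  exact ⟨u, rfl, by rw [map_constantCoeff_coeff, Polynomial.coeff_X_mul]⟩

/-! ### Sums of powers of `z` that do not vanish -/

section Nonvanishing

variable {P : L[X]} {z : L'} {q : ℕ} (s : Finset ℕ) (b : ℕ → L) (κ : ℕ → ℕ)

/-- The exponent `κ i` is affine in `i` with slope `1 / q`. Factoring out the power of `z` at the
least index `i₀` leaves `R = ∑ b_i Z ^ ((i - i₀) / q)`, whose constant term is `b i₀`. The second
identity comes from `i = q (κ i - κ i₀) + i₀`: weighting the terms by `i` applies `q Z d/dZ + i₀` to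
`R`. -/
theorem exists_factor_of_exponents (hq : 0 < q) (hs : s.Nonempty) (hb : ∀ i ∈ s, b i ≠ 0)
    {c D : ℕ} (hκ : ∀ i ∈ s, q * κ i = c + i) (hD : ∀ i ∈ s, i ≤ q * D + s.min' hs) :
    ∃ R : L[X], R ≠ 0 ∧ R.natDegree ≤ D ∧ ∀ z : L',
      (∑ i ∈ s, algebraMap L L' (b i) * z ^ κ i =
        z ^ κ (s.min' hs) * Polynomial.aeval z R) ∧
      (∑ i ∈ s, (i : L') * (algebraMap L L' (b i) * z ^ κ i) =
        z ^ κ (s.min' hs) * (((s.min' hs : ℕ) : L') * Polynomial.aeval z R +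
          q * (z * Polynomial.aeval z (Polynomial.derivative R)))) := by
  set i₀ := s.min' hs with hi₀
  have hmem : i₀ ∈ s := s.min'_mem hs
  have hle : ∀ i ∈ s, i₀ ≤ i := fun i hi => s.min'_le i hi
  have hκle : ∀ i ∈ s, κ i₀ ≤ κ i := fun i hi => by
    have h1 := hκ i hi; have h2 := hκ _ hmem; have h3 := hle i hi
    exact Nat.le_of_mul_le_mul_left (by omega) hq
  have hδ : ∀ i ∈ s, q * (κ i - κ i₀) + i₀ = i := fun i hi => by
    have h1 := hκ i hi; have h2 := hκ _ hmem; have h3 := hle i hi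
    rw [Nat.mul_sub]; omega
  refine ⟨∑ i ∈ s, Polynomial.monomial (κ i - κ i₀) (b i), ?_, ?_, fun z => ⟨?_, ?_⟩⟩
  · intro h0
    have h1 := congrArg (fun p => Polynomial.coeff p 0) h0
    simp only [Polynomial.finsetSum_coeff, Polynomial.coeff_monomial, Polynomial.coeff_zero] at h1
    rw [Finset.sum_eq_single i₀] at h1
    · simp only [tsub_self, if_true] at h1
      exact hb _ hmem h1
    · intro i hi hne
      rw [if_neg]
      intro h
      have := hδ i hi
      rw [h] at this
      omega
    · exact fun h => absurd hmem h
  · refine Polynomial.natDegree_sum_le_of_forall_le _ _ fun i hi => ?_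
    refine (Polynomial.natDegree_monomial_le _).trans ?_
    have h1 := hδ i hi; have h2 := hD i hi
    exact Nat.le_of_mul_le_mul_left (by omega) hq
  · rw [map_sum, Finset.mul_sum]
    refine Finset.sum_congr rfl fun i hi => ?_
    rw [Polynomial.aeval_monomial, mul_left_comm, ← pow_add, Nat.add_sub_cancel' (hκle i hi)]
  · rw [map_sum, Polynomial.derivative_sum, map_sum, Finset.mul_sum, Finset.mul_sum,
      Finset.mul_sum, ← Finset.sum_add_distrib, Finset.mul_sum]
    refine Finset.sum_congr rfl fun i hi => ?_
    have h1 : (i : L') = q * ((κ i - κ i₀ : ℕ) : L') + i₀ := by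
      rw [← Nat.cast_mul, ← Nat.cast_add, hδ i hi]
    have h2 : z ^ κ i = z ^ κ i₀ * z ^ (κ i - κ i₀) := by
      rw [← pow_add, Nat.add_sub_cancel' (hκle i hi)]
    rw [Polynomial.derivative_monomial, Polynomial.aeval_monomial, Polynomial.aeval_monomial,
      h1, h2, map_mul, map_natCast]
    rcases Nat.eq_zero_or_pos (κ i - κ i₀) with h0 | hpos
    · rw [h0]; simp; ring
    · obtain ⟨d, hd⟩ := Nat.exists_eq_succ_of_ne_zero hpos.ne'
      rw [hd]
      simp only [Nat.succ_eq_add_one, Nat.add_sub_cancel, pow_succ]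
      ring

theorem sum_ne_zero_of_exponents (hP : ∀ R : L[X], Polynomial.aeval z R = 0 → P ∣ R) (hz : z ≠ 0)
    (hq : 0 < q) (hs : s.Nonempty) (hb : ∀ i ∈ s, b i ≠ 0) (hℓ : 0 < P.natDegree)
    {c : ℕ} (hκ : ∀ i ∈ s, q * κ i = c + i) (hD : ∀ i ∈ s, i < q * P.natDegree) :
    ∑ i ∈ s, algebraMap L L' (b i) * z ^ κ i ≠ 0 := by
  -- The difference `i - i₀` is a multiple of `q` that is less than `q ℓ`, hence at most `q (ℓ -
  -- 1)`.
  have hmod : ∀ i ∈ s, i ≤ q * (P.natDegree - 1) + s.min' hs := by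
    intro i hi
    have h1 := hκ i hi; have h2 := hκ _ (s.min'_mem hs); have h3 := hD i hi
    have h4 := s.min'_le i hi
    have h5 : q * (κ i - κ (s.min' hs)) + s.min' hs = i := by rw [Nat.mul_sub]; omega
    have h6 : κ i - κ (s.min' hs) < P.natDegree :=
      Nat.lt_of_mul_lt_mul_left (a := q) (by omega)
    have h7 : q * (κ i - κ (s.min' hs)) ≤ q * (P.natDegree - 1) :=
      Nat.mul_le_mul_left _ (by omega)
    omega
  obtain ⟨R, hR, hdeg, h⟩ := exists_factor_of_exponents (L' := L') s b κ hq hs hb hκ hmod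
  rw [(h z).1]
  refine mul_ne_zero (pow_ne_zero _ hz) fun h0 => ?_
  have := Polynomial.natDegree_le_of_dvd (hP R h0) hR
  omega

/-- Now `deg R ≤ deg P`, so `R(z) = 0` forces `R = a P` with `a` a nonzero constant. The weighted
sum reduces to a power of `z` times `q z a P'(z)`. -/
theorem sum_mul_ne_zero_of_exponents (hP : ∀ R : L[X], Polynomial.aeval z R = 0 → P ∣ R)
    (hP' : Polynomial.aeval z (Polynomial.derivative P) ≠ 0) (hz : z ≠ 0) (hqL : (q : L') ≠ 0)
    (hq : 0 < q) (hs : s.Nonempty) (hb : ∀ i ∈ s, b i ≠ 0)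
    {c : ℕ} (hκ : ∀ i ∈ s, q * κ i = c + i) (hD : ∀ i ∈ s, i ≤ q * P.natDegree)
    (h0 : ∑ i ∈ s, algebraMap L L' (b i) * z ^ κ i = 0) :
    ∑ i ∈ s, (i : L') * (algebraMap L L' (b i) * z ^ κ i) ≠ 0 := by
  obtain ⟨R, hR, hdeg, h⟩ := exists_factor_of_exponents (L' := L') s b κ hq hs hb hκ
    fun i hi => (hD i hi).trans (Nat.le_add_right _ _)
  rw [(h z).1] at h0
  have hRz := (mul_eq_zero.1 h0).resolve_left (pow_ne_zero _ hz)
  rw [(h z).2, hRz, mul_zero, zero_add]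
  obtain ⟨U, rfl⟩ := hP R hRz
  have hP0 := left_ne_zero_of_mul hR
  have hU0 := right_ne_zero_of_mul hR
  rw [Polynomial.natDegree_mul hP0 hU0] at hdeg
  obtain ⟨a, rfl⟩ := Polynomial.natDegree_eq_zero.1 (show U.natDegree = 0 by omega)
  refine mul_ne_zero (pow_ne_zero _ hz) (mul_ne_zero hqL (mul_ne_zero hz ?_))
  rw [Polynomial.derivative_mul, Polynomial.derivative_C, mul_zero, add_zero, map_mul,
    Polynomial.aeval_C]
  refine mul_ne_zero hP' ?_
  rw [Ne, map_eq_zero]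
  rintro rfl
  simp at hU0

end Nonvanishing

/-- The coefficients of `1` and `y` in a sum of multiples of powers of `y + z ^ s`. -/
theorem coeff_zero_sum_mul_pow (s : Finset ℕ) (c : ℕ → L') (a : L') :
    (∑ i ∈ s, Polynomial.C (c i) * (Polynomial.X + Polynomial.C a) ^ i).coeff 0 =
      ∑ i ∈ s, c i * a ^ i := by
  simp [Polynomial.coeff_zero_eq_eval_zero, Polynomial.eval_finsetSum]

theorem coeff_one_sum_mul_pow (s : Finset ℕ) (c : ℕ → L') (a : L') :
    a * (∑ i ∈ s, Polynomial.C (c i) * (Polynomial.X + Polynomial.C a) ^ i).coeff 1 =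
      ∑ i ∈ s, i * (c i * a ^ i) := by
  rw [Polynomial.finsetSum_coeff, Finset.mul_sum]
  refine Finset.sum_congr rfl fun i _ => ?_
  rw [Polynomial.coeff_C_mul, Polynomial.coeff_X_add_C_pow]
  rcases i with _ | i
  · simp
  · simp [pow_succ]; ring

end Step

/-! ### Expansions in powers of a monic polynomial -/

section Digits

variable {R : Type*} [CommRing R] [Nontrivial R] {χ : R[X]} {d : ℕ}

theorem exists_digits (hχ : χ.Monic) (hd : χ.natDegree = d) (n : ℕ) :
    ∀ Q : R[X], Q.degree < ((n * d : ℕ) : WithBot ℕ) → ∃ A : ℕ → R[X],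
      (∀ i, (A i).degree < (d : WithBot ℕ)) ∧ Q = ∑ i ∈ Finset.range n, A i * χ ^ i := by
  have hdeg : χ.degree = (d : WithBot ℕ) := by
    rw [Polynomial.degree_eq_natDegree hχ.ne_zero, hd]
  induction n with
  | zero =>
    intro Q hQ
    have : Q = 0 := by simpa using hQ
    exact ⟨0, fun i => by simp [bot_lt_iff_ne_bot], by simp [this]⟩
  | succ n ih =>
    intro Q hQ
    obtain ⟨A, hA, hsum⟩ := ih (Q /ₘ χ) (by
      rcases eq_or_ne (Q /ₘ χ) 0 with h0 | h0
      · rw [h0, Polynomial.degree_zero]; exact WithBot.bot_lt_coe _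
      · have h1 : Q.natDegree < (n + 1) * d := by
          refine (Polynomial.natDegree_lt_iff_degree_lt ?_).2 hQ
          rintro rfl; simp at h0
        have h2 := Polynomial.natDegree_divByMonic Q hχ
        have h3 : d ≤ Q.natDegree := by
          by_contra! hlt
          refine h0 ((Polynomial.divByMonic_eq_zero_iff hχ).2 ?_)
          rw [hdeg]
          exact Polynomial.degree_le_natDegree.trans_lt (by exact_mod_cast hlt)
        refine (Polynomial.natDegree_lt_iff_degree_lt h0).1 ?_
        rw [h2, hd]
        have h4 : (n + 1) * d = n * d + d := by ring
        omega)
    refine ⟨fun i => if i = 0 then Q %ₘ χ else A (i - 1), fun i => ?_, ?_⟩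
    · dsimp only
      split_ifs
      · rw [← hdeg]; exact Polynomial.degree_modByMonic_lt Q hχ
      · exact hA _
    · rw [Finset.sum_range_succ']
      simp only [Nat.add_eq_zero_iff, one_ne_zero, and_false, if_false, if_true, pow_zero, mul_one,
        Nat.add_sub_cancel]
      conv_lhs => rw [← Polynomial.modByMonic_add_div Q χ, hsum]
      rw [Finset.mul_sum, add_comm]
      congr 1
      refine Finset.sum_congr rfl fun i _ => ?_
      rw [pow_succ]; ring

theorem degree_mul_pow_lt (hχ : χ.Monic) (hd : χ.natDegree = d) (n : ℕ) {a : R[X]}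
    (ha : a.degree < (d : WithBot ℕ)) : (a * χ ^ n).degree < (((n + 1) * d : ℕ) : WithBot ℕ) := by
  rw [(hχ.pow n).degree_mul, (Polynomial.degree_eq_natDegree (hχ.pow n).ne_zero),
    hχ.natDegree_pow, hd, show (n + 1) * d = d + n * d by ring]
  rcases eq_or_ne a 0 with rfl | h0
  · rw [Polynomial.degree_zero, WithBot.bot_add]; exact WithBot.bot_lt_coe _
  · rw [Polynomial.degree_eq_natDegree h0] at ha ⊢
    have : a.natDegree < d := by exact_mod_cast ha
    exact_mod_cast (by omega : a.natDegree + n * d < d + n * d)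

theorem degree_digits_lt (hχ : χ.Monic) (hd : χ.natDegree = d) (n : ℕ) {A : ℕ → R[X]}
    (hA : ∀ i, (A i).degree < (d : WithBot ℕ)) :
    (∑ i ∈ Finset.range n, A i * χ ^ i).degree < ((n * d : ℕ) : WithBot ℕ) := by
  refine (Polynomial.degree_sum_le _ _).trans_lt ?_
  refine (Finset.sup_lt_iff (WithBot.bot_lt_coe _)).2 fun i hi => ?_
  refine (degree_mul_pow_lt hχ hd i (hA i)).trans_le ?_
  have : (i + 1) * d ≤ n * d := Nat.mul_le_mul_right _ (by simpa using hi)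
  exact_mod_cast this

/-- The leading terms of the `A i * χ ^ i` lie in disjoint ranges of degrees. For `j = 0` this is
the uniqueness of the digits. -/
theorem digits_eq_zero (hχ : χ.Monic) (hd : χ.natDegree = d) {A : ℕ → R[X]}
    (hA : ∀ i, (A i).degree < (d : WithBot ℕ)) (j : ℕ) (n : ℕ)
    (h : (∑ i ∈ Finset.range n, A i * χ ^ i).degree < ((j * d : ℕ) : WithBot ℕ)) :
    ∀ i, j ≤ i → i < n → A i = 0 := by
  induction n with
  | zero => intro i _ hi; omega
  | succ n ih =>
    intro i hji hin
    have hn : A n = 0 := by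
      by_contra h0
      have h1 := degree_digits_lt hχ hd n hA
      have h2 : ((n * d : ℕ) : WithBot ℕ) ≤ (A n * χ ^ n).degree := by
        rw [(hχ.pow n).degree_mul, (Polynomial.degree_eq_natDegree (hχ.pow n).ne_zero),
          hχ.natDegree_pow, hd, Polynomial.degree_eq_natDegree h0]
        exact_mod_cast Nat.le_add_left _ _
      rw [Finset.sum_range_succ, Polynomial.degree_add_eq_right_of_degree_lt (h1.trans_le h2)] at h
      have h3 := h2.trans_lt h
      have h4 : n * d < j * d := by exact_mod_cast h3
      have : n < j := Nat.lt_of_mul_lt_mul_right h4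
      omega
    rw [Finset.sum_range_succ, hn, zero_mul, add_zero] at h
    rcases Nat.lt_succ_iff_lt_or_eq.1 hin with h1 | rfl
    · exact ih h i hji h1
    · exact hn

end Digits

/-! ### Initial form of an expansion after one substitution -/

section Expansion

variable {K L L' : Type u} [Field K] [Field L] [Field L'] [Algebra L L']

/-- The initial form, after the substitution `x ↦ z ^ t x ^ q`, `y ↦ x ^ m (y + z ^ s + ⋯)`, of a
`χ`-adic expansion whose digits pull back to monomials up to units. -/
theorem exists_ini_expansion {d : ℕ} (Φ : K⟦X⟧[X] →+* L⟦X⟧[X])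
    (hΦ : ∀ Q : K⟦X⟧[X], Q ≠ 0 → Q.degree < (d : WithBot ℕ) →
      ∃ w p, Ini (Φ Q) w p ∧ p.coeff 0 ≠ 0)
    {q m s t : ℕ} (hq : 0 < q) (hm : 0 < m) (hst : q * s = t * m + 1) {χ : K⟦X⟧[X]} {v : ℕ} {u₀ : L}
    (hχ : Good q m (Φ χ) v u₀) {z : L'} {T : L'⟦X⟧[X]}
    (hT : T.map PowerSeries.constantCoeff = Polynomial.X + Polynomial.C (z ^ s))
    {A : ℕ → K⟦X⟧[X]} (hA : ∀ i, (A i).degree < (d : WithBot ℕ)) {n : ℕ}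
    (hne : ∑ i ∈ Finset.range n, A i * χ ^ i ≠ 0) :
    ∃ (M c : ℕ) (I : Finset ℕ) (b : ℕ → L) (κ : ℕ → ℕ) (p : L'[X]),
      I.Nonempty ∧ (∀ i ∈ I, i < n) ∧ (∀ i ∈ I, b i ≠ 0) ∧ (∀ i ∈ I, q * κ i = c + i) ∧
      Ini (pullHom L (z ^ t) q hq (Polynomial.C (PowerSeries.X ^ m) * T)
        (Φ (∑ i ∈ Finset.range n, A i * χ ^ i))) M p ∧
      p.coeff 0 = ∑ i ∈ I, algebraMap L L' (b i) * z ^ κ i ∧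
      z ^ s * p.coeff 1 = ∑ i ∈ I, (i : L') * (algebraMap L L' (b i) * z ^ κ i) ∧
      ∀ i < n, A i ≠ 0 → ∃ w p, Ini (Φ (A i)) w p ∧ p.coeff 0 ≠ 0 ∧
        M ≤ q * w + i * (q * v + m) := by
  classical
  -- Zero digits get dummy values, so that order and initial form can be chosen for all `i`.
  have hex : ∀ i, ∃ w p, Ini (Φ (A i)) w p ∧ (A i ≠ 0 → p.coeff 0 ≠ 0) := by
    intro i
    by_cases h0 : A i = 0
    · exact ⟨0, 0, by rw [h0, map_zero]; exact Ini.zero 0, fun h => absurd h0 h⟩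
    · obtain ⟨w, p, h, h'⟩ := hΦ _ h0 (hA i)
      exact ⟨w, p, h, fun _ => h'⟩
  choose w p hini hp using hex
  set J := (Finset.range n).filter fun i => A i ≠ 0 with hJ
  have hsumJ : ∑ i ∈ Finset.range n, A i * χ ^ i = ∑ i ∈ J, A i * χ ^ i := by
    rw [hJ, Finset.sum_filter]
    refine Finset.sum_congr rfl fun i _ => ?_
    split_ifs with h
    · rfl
    · rw [not_not.1 h, zero_mul]
  have hJne : J.Nonempty := by
    rw [Finset.nonempty_iff_ne_empty]
    intro h0
    rw [hsumJ, h0, Finset.sum_empty] at hne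
    exact hne rfl
  obtain ⟨i₁, hi₁, hmin⟩ := J.exists_min_image (fun i => q * w i + i * (q * v + m)) hJne
  set M := q * w i₁ + i₁ * (q * v + m) with hM
  have hterm : ∀ i ∈ J, Ini (pullHom L (z ^ t) q hq (Polynomial.C (PowerSeries.X ^ m) * T)
      (Φ (A i) * Φ χ ^ i)) (q * w i + i * (q * v + m)) _ := fun i _ =>
    hχ.pullHom_mul_pow (z ^ t) hq hm T (hini i) i
  have hsum := Ini.sum_min J hterm hmin
  set I := J.filter fun i => q * w i + i * (q * v + m) = M with hI
  have hIJ : ∀ i ∈ I, i < n ∧ A i ≠ 0 ∧ q * w i + i * (q * v + m) = M := fun i hi => by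
    simpa [hI, hJ, and_assoc] using hi
  simp only [hT] at hsum
  -- At `y = 0` the `i`-th term carries `z ^ (t (w i + v i))` from the powers of `x` and `z ^ (s i)`
  -- from `(y + z ^ s) ^ i`. With `q s = t m + 1`, the sum `κ i` of these exponents satisfies `q κ i
  -- = t M + i` on the terms of order `M`; hence the constant `t * M`.
  refine ⟨M, t * M, I, fun i => (p i).coeff 0 * u₀ ^ i, fun i => t * (w i + v * i) + s * i,
    ∑ i ∈ I, Polynomial.C ((z ^ t) ^ (w i + v * i) *
      algebraMap L L' ((p i).coeff 0 * u₀ ^ i)) * (Polynomial.X + Polynomial.C (z ^ s)) ^ i,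
    ⟨i₁, by simp [hI, hi₁, hM]⟩, fun i hi => (hIJ i hi).1,
    fun i hi => mul_ne_zero (hp i (hIJ i hi).2.1) (pow_ne_zero _ hχ.1), fun i hi => ?_,
    ?_, ?_, ?_⟩
  · rw [← (hIJ i hi).2.2]
    have : q * (t * (w i + v * i) + s * i) = t * (q * (w i + v * i)) + (q * s) * i := by ring
    rw [this, hst]
    ring
  · rw [hsumJ, map_sum, map_sum]
    simp only [map_mul (Φ), map_pow Φ]
    exact hsum
  · rw [coeff_zero_sum_mul_pow]
    refine Finset.sum_congr rfl fun i _ => ?_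
    dsimp only
    ring
  · refine ⟨?_, fun i hi h0 => ⟨w i, p i, hini i, hp i h0, hmin i (by simp [hJ, hi, h0])⟩⟩
    rw [coeff_one_sum_mul_pow]
    refine Finset.sum_congr rfl fun i _ => ?_
    dsimp only
    ring

end Expansion

/-! ### Weierstrass preparation for polynomials -/

section Weierstrass

variable {L : Type u} [Field L]

instance isAdicComplete_maximalIdeal :
    IsAdicComplete (IsLocalRing.maximalIdeal L⟦X⟧) L⟦X⟧ := by
  rw [PowerSeries.maximalIdeal_eq_span_X]
  infer_instance

theorem residue_eq_zero_iff_constantCoeff (a : L⟦X⟧) :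
    IsLocalRing.residue L⟦X⟧ a = 0 ↔ PowerSeries.constantCoeff a = 0 := by
  rw [IsLocalRing.residue_eq_zero_iff, PowerSeries.maximalIdeal_eq_span_X,
    Ideal.mem_span_singleton, PowerSeries.X_dvd_iff]

theorem IsWeierstrass.isDistinguishedAt {G : L⟦X⟧[X]} (h : IsWeierstrass G) :
    G.IsDistinguishedAt (IsLocalRing.maximalIdeal L⟦X⟧) where
  mem := fun {n} hn => by
    rw [PowerSeries.maximalIdeal_eq_span_X, Ideal.mem_span_singleton, PowerSeries.X_dvd_iff]
    exact h.2 n hn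
  monic := h.1

/-- Weierstrass preparation for a polynomial whose reduction modulo `x` has order `N`. -/
theorem exists_isWeierstrass_factor {M : L⟦X⟧[X]} {N : ℕ} {r : L[X]}
    (hM : M.map PowerSeries.constantCoeff = Polynomial.X ^ N * r) (hr : r.coeff 0 ≠ 0) :
    ∃ G : L⟦X⟧[X], IsWeierstrass G ∧ G.natDegree = N ∧ ∃ V : L⟦X⟧⟦X⟧, IsUnit V ∧
      (M : L⟦X⟧⟦X⟧) = (G : L⟦X⟧⟦X⟧) * V := by
  have hcoeff : ∀ i, PowerSeries.constantCoeff (M.coeff i) = (Polynomial.X ^ N * r).coeff i := by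
    intro i; rw [← hM, map_constantCoeff_coeff]
  have hord : ((M : L⟦X⟧⟦X⟧).map (IsLocalRing.residue L⟦X⟧)).order = N := by
    rw [PowerSeries.order_eq_nat]
    constructor
    · rw [PowerSeries.coeff_map, Polynomial.coeff_coe, Ne, residue_eq_zero_iff_constantCoeff,
        hcoeff, Polynomial.coeff_X_pow_mul', if_pos le_rfl, Nat.sub_self]
      exact hr
    · intro i hi
      rw [PowerSeries.coeff_map, Polynomial.coeff_coe, residue_eq_zero_iff_constantCoeff,
        hcoeff, Polynomial.coeff_X_pow_mul', if_neg (by omega)]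
  have hne : (M : L⟦X⟧⟦X⟧).map (IsLocalRing.residue L⟦X⟧) ≠ 0 := by
    intro h0; rw [h0] at hord; simp at hord
  obtain ⟨G, V, hG⟩ := PowerSeries.exists_isWeierstrassFactorization hne
  refine ⟨G, ⟨hG.isDistinguishedAt.monic, fun i hi => ?_⟩, ?_, V, hG.isUnit, hG.eq_mul⟩
  · have := hG.isDistinguishedAt.mem hi
    rwa [← residue_eq_zero_iff_constantCoeff, IsLocalRing.residue_eq_zero_iff]
  · rw [hG.natDegree_eq_toNat_order_map, hord]; rfl

/-- The cofactor of a Weierstrass polynomial in a polynomial is a polynomial. -/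
theorem exists_polynomial_cofactor {M G : L⟦X⟧[X]} (hG : IsWeierstrass G) {V : L⟦X⟧⟦X⟧}
    (hV : IsUnit V) (h : (M : L⟦X⟧⟦X⟧) = (G : L⟦X⟧⟦X⟧) * V) :
    ∃ S : L⟦X⟧[X], M = G * S ∧ PowerSeries.constantCoeff (S.coeff 0) ≠ 0 := by
  have hdiv := hG.isDistinguishedAt.isWeierstrassDivisorAt'
  have hdeg : (M %ₘ G).degree <
      (((G : L⟦X⟧⟦X⟧).map (Ideal.Quotient.mk (IsLocalRing.maximalIdeal L⟦X⟧))).order.toNat :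
        WithBot ℕ) := by
    refine (Polynomial.degree_modByMonic_lt M hG.1).trans_le ?_
    have : G.natDegree = _ := congr(ENat.toNat $(hG.isDistinguishedAt.coe_natDegree_eq_order_map
      (G : L⟦X⟧⟦X⟧) 1 (by
        rw [map_one, ← Ideal.ne_top_iff_one]; exact Ideal.IsPrime.ne_top') (by simp)))
    rw [Polynomial.degree_eq_natDegree hG.1.ne_zero, this]
  -- Both sides divide `M` by `G` with remainder in `L⟦x⟧⟦y⟧`. Uniqueness of Weierstrass division
  -- makes `V` the polynomial quotient.
  have heq : (G : L⟦X⟧⟦X⟧) * V + ((0 : L⟦X⟧[X]) : L⟦X⟧⟦X⟧) =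
      (G : L⟦X⟧⟦X⟧) * ((M /ₘ G : L⟦X⟧[X]) : L⟦X⟧⟦X⟧) + ((M %ₘ G : L⟦X⟧[X]) : L⟦X⟧⟦X⟧) := by
    rw [Polynomial.coe_zero, add_zero, ← h, ← Polynomial.coe_mul, ← Polynomial.coe_add, add_comm,
      Polynomial.modByMonic_add_div M G]
  obtain ⟨hV', hR⟩ := hdiv.eq_of_mul_add_eq_mul_add
    (by rw [Polynomial.degree_zero]; exact WithBot.bot_lt_coe _) hdeg heq
  refine ⟨M /ₘ G, ?_, ?_⟩
  · conv_lhs => rw [← Polynomial.modByMonic_add_div M G, ← hR, zero_add]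
  · have h1 : IsUnit (PowerSeries.constantCoeff V) := PowerSeries.isUnit_iff_constantCoeff.1 hV
    rw [hV', ← PowerSeries.coeff_zero_eq_constantCoeff_apply, Polynomial.coeff_coe] at h1
    exact (PowerSeries.isUnit_iff_constantCoeff.1 h1).ne_zero

theorem exists_isWeierstrassPart {M : L⟦X⟧[X]} {n N : ℕ} {r : L[X]}
    (hM : Ini M n (Polynomial.X ^ N * r)) (hr : r.coeff 0 ≠ 0) : ∃ G, IsWeierstrassPart M n N G := by
  obtain ⟨M', rfl, hM'⟩ := hM
  obtain ⟨G, hG, hN, V, hV, h⟩ := exists_isWeierstrass_factor hM' hr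
  refine ⟨G, hG, hN, V, hV, ?_⟩
  rw [Polynomial.coe_mul, Polynomial.coe_C, h, mul_assoc]

theorem IsWeierstrassPart.exists_polynomial {M : L⟦X⟧[X]} {n N : ℕ} {p : L[X]}
    (hM : Ini M n p) {G : L⟦X⟧[X]} (h : IsWeierstrassPart M n N G) :
    ∃ S : L⟦X⟧[X], M = Polynomial.C (PowerSeries.X ^ n) * G * S ∧
      PowerSeries.constantCoeff (S.coeff 0) ≠ 0 := by
  obtain ⟨M', rfl, -⟩ := hM
  obtain ⟨hG, -, V, hV, h⟩ := h
  rw [Polynomial.coe_mul, Polynomial.coe_C, mul_assoc] at h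
  have h' := mul_left_cancel₀ (by
    rw [Ne, map_eq_zero_iff _ PowerSeries.C_injective]
    exact pow_ne_zero _ PowerSeries.X_ne_zero) h
  obtain ⟨S, rfl, hS⟩ := exists_polynomial_cofactor hG hV h'
  exact ⟨S, by ring, hS⟩

end Weierstrass

/-! ### The Tschirnhaus shift -/

section Tschirnhaus

variable {L : Type u} [Field L]

theorem IsWeierstrass.constantCoeff_tschirnhausShift {G : L⟦X⟧[X]} (hG : IsWeierstrass G)
    (hN : 0 < G.natDegree) : PowerSeries.constantCoeff (tschirnhausShift G) = 0 := by
  simp [tschirnhausShift, hG.2 (G.natDegree - 1) (by omega)]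

theorem natDegree_comp_X_add_C (G : L⟦X⟧[X]) (c : L⟦X⟧) :
    (G.comp (Polynomial.X + Polynomial.C c)).natDegree = G.natDegree := by
  rw [Polynomial.natDegree_comp, Polynomial.natDegree_X_add_C, mul_one]

theorem IsWeierstrass.comp_X_add_C {G : L⟦X⟧[X]} (hG : IsWeierstrass G) {c : L⟦X⟧}
    (hc : PowerSeries.constantCoeff c = 0) :
    IsWeierstrass (G.comp (Polynomial.X + Polynomial.C c)) := by
  refine ⟨hG.1.comp_X_add_C c, fun i hi => ?_⟩
  rw [natDegree_comp_X_add_C] at hi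
  have h1 : (G.comp (Polynomial.X + Polynomial.C c)).map PowerSeries.constantCoeff =
      Polynomial.X ^ G.natDegree := by
    rw [Polynomial.map_comp]
    have h2 : G.map PowerSeries.constantCoeff = Polynomial.X ^ G.natDegree := by
      ext j
      rw [map_constantCoeff_coeff, Polynomial.coeff_X_pow]
      rcases lt_trichotomy j G.natDegree with h | h | h
      · rw [hG.2 j h, if_neg h.ne]
      · rw [if_pos h, h, hG.1.coeff_natDegree, map_one]
      · rw [if_neg h.ne', Polynomial.coeff_eq_zero_of_natDegree_lt h, map_zero]
    simp [h2, hc]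
  rw [← map_constantCoeff_coeff, h1, Polynomial.coeff_X_pow, if_neg hi.ne]

theorem coeff_comp_tschirnhausShift {G : L⟦X⟧[X]} (hG : G.Monic) (hN : (G.natDegree : L) ≠ 0) :
    (G.comp (Polynomial.X + Polynomial.C (tschirnhausShift G))).coeff (G.natDegree - 1) = 0 := by
  have hpos : 0 < G.natDegree := Nat.pos_of_ne_zero fun h => hN (by rw [h]; simp)
  have h1 : (Polynomial.X + Polynomial.C (tschirnhausShift G)).natDegree = 1 :=
    Polynomial.natDegree_X_add_C _
  obtain ⟨n, hn⟩ : ∃ n, G.natDegree = n + 1 := ⟨_, (Nat.sub_add_cancel hpos).symm⟩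
  have hsum : ∀ c : L⟦X⟧, (G.comp (Polynomial.X + Polynomial.C c)).coeff n =
      G.coeff n + (n + 1) * c := by
    intro c
    rw [Polynomial.comp, Polynomial.eval₂_eq_sum_range, hn, Finset.sum_range_succ,
      Finset.sum_range_succ, Polynomial.coeff_add, Polynomial.coeff_add, Polynomial.finsetSum_coeff,
      Finset.sum_eq_zero, zero_add]
    · rw [Polynomial.coeff_C_mul, Polynomial.coeff_C_mul, Polynomial.coeff_X_add_C_pow,
        Polynomial.coeff_X_add_C_pow, ← hn, hG.coeff_natDegree, hn]
      simp
      ring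
    · intro i hi
      rw [Polynomial.coeff_C_mul, Polynomial.coeff_X_add_C_pow,
        Nat.choose_eq_zero_of_lt (by simpa using hi)]
      simp
  have hC : ((n : L⟦X⟧) + 1) = PowerSeries.C ((G.natDegree : L)) := by rw [hn]; simp
  rw [hn, Nat.add_sub_cancel, hsum, tschirnhausShift, hC, mul_neg, ← mul_assoc,
    ← map_mul, mul_inv_cancel₀ hN, map_one, one_mul, hn, Nat.add_sub_cancel, add_neg_cancel]

end Tschirnhaus

/-! ### Lower hulls and straight Newton polygons -/

section Hull

theorem le_of_mem_convexHull {S : Set (ℝ × ℝ)} {a b c : ℝ}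
    (h : ∀ p ∈ S, c ≤ a * p.1 + b * p.2) : ∀ p ∈ convexHull ℝ S, c ≤ a * p.1 + b * p.2 := by
  have hconv : Convex ℝ {p : ℝ × ℝ | c ≤ a * p.1 + b * p.2} := by
    refine convex_halfSpace_ge (f := fun p : ℝ × ℝ => a * p.1 + b * p.2) ⟨?_, ?_⟩ c
    · intro p p'; simp; ring
    · intro r p; simp; ring
  exact fun p hp => convexHull_min h hconv hp

/-- A point of the hull on which a linear functional that increases with the second coordinate is
minimal lies in the lower hull. -/
theorem mem_lowerHull_of_support {S : Set (ℝ × ℝ)} {a b : ℝ} (hb : 0 < b) {p : ℝ × ℝ}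
    (hp : p ∈ convexHull ℝ S) (h : ∀ p' ∈ S, a * p.1 + b * p.2 ≤ a * p'.1 + b * p'.2) :
    p ∈ lowerHull S := by
  refine ⟨hp, fun y hy => ?_⟩
  have := le_of_mem_convexHull h _ hy
  simp only at this
  exact le_of_mul_le_mul_left (by linarith) hb

end Hull

section Restrict

variable {L : Type u} [Field L]

/-- The points of the plane whose lower hull is the Newton polygon. -/
def points (H : L⟦X⟧[X]) : Set (ℝ × ℝ) :=
  {p | ∃ i j : ℕ, (H.coeff i).order = (j : ℕ∞) ∧ p = ((i : ℝ), (j : ℝ))}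

open Classical in
theorem coeff_restrictTo (E : Set (ℝ × ℝ)) (H : L⟦X⟧[X]) (i j : ℕ) :
    PowerSeries.coeff j ((restrictTo E H).coeff i) =
      if ((i : ℝ), (j : ℝ)) ∈ E then PowerSeries.coeff j (H.coeff i) else 0 := by
  rw [restrictTo, Polynomial.finsetSum_coeff]
  simp only [Polynomial.coeff_monomial]
  rw [Finset.sum_ite_eq']
  split_ifs with h1 h2 h2
  · rw [PowerSeries.coeff_mk, if_pos h2]
  · rw [PowerSeries.coeff_mk, if_neg h2]
  · rw [map_zero, Polynomial.coeff_eq_zero_of_natDegree_lt (by simpa using h1), map_zero]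
  · rw [map_zero]

theorem order_eq_nat_iff_coeff {a : L⟦X⟧} {j : ℕ} :
    a.order = (j : ℕ∞) ↔ PowerSeries.coeff j a ≠ 0 ∧ ∀ i < j, PowerSeries.coeff i a = 0 :=
  PowerSeries.order_eq_nat

theorem exists_order_of_coeff_ne_zero {a : L⟦X⟧} {j : ℕ} (h : PowerSeries.coeff j a ≠ 0) :
    ∃ i ≤ j, a.order = (i : ℕ∞) := by
  have h1 := PowerSeries.order_le j h
  obtain ⟨i, hi⟩ := ENat.ne_top_iff_exists.1 (ne_top_of_le_ne_top (ENat.natCast_ne_top j) h1)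
  exact ⟨i, by rw [← hi] at h1; exact_mod_cast h1, hi.symm⟩

variable {H : L⟦X⟧[X]}

theorem IsWeierstrass.order_coeff_natDegree (hH : IsWeierstrass H) :
    (H.coeff H.natDegree).order = ((0 : ℕ) : ℕ∞) := by
  rw [hH.1.coeff_natDegree]; simp

theorem IsWeierstrass.top_mem_points (hH : IsWeierstrass H) :
    ((H.natDegree : ℝ), (0 : ℝ)) ∈ points H :=
  ⟨H.natDegree, 0, hH.order_coeff_natDegree, by simp⟩

theorem IsWeierstrass.top_mem_newtonPolygon (hH : IsWeierstrass H) :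
    ((H.natDegree : ℝ), (0 : ℝ)) ∈ newtonPolygon H := by
  refine mem_lowerHull_of_support (a := 0) one_pos (subset_convexHull ℝ _ hH.top_mem_points) ?_
  rintro _ ⟨i, j, -, rfl⟩
  simp

theorem IsWeierstrass.exists_coeff_ne_zero (hH : IsWeierstrass H)
    (hne : H ≠ Polynomial.X ^ H.natDegree) : ∃ i < H.natDegree, H.coeff i ≠ 0 := by
  by_contra! hc
  refine hne (Polynomial.ext fun i => ?_)
  rw [Polynomial.coeff_X_pow]
  rcases lt_trichotomy i H.natDegree with h | h | h
  · rw [if_neg h.ne, hc i h]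
  · rw [if_pos h, h, hH.1.coeff_natDegree]
  · rw [if_neg h.ne', Polynomial.coeff_eq_zero_of_natDegree_lt h]

end Restrict

namespace EdgeData

variable {L : Type u} [Field L] {H : L⟦X⟧[X]}

/-- A point where `q j + m i` is least lies on the polygon. As the polygon is straight and contains
`(N, 0)`, the least value is `m N`. -/
theorem mul_natDegree_le_of_order (D : EdgeData H) (hH : IsWeierstrass H) {i j : ℕ}
    (h : (H.coeff i).order = (j : ℕ∞)) : D.m * H.natDegree ≤ D.q * j + D.m * i := by
  classical
  have hex : ∃ n, ∃ i j : ℕ, (H.coeff i).order = (j : ℕ∞) ∧ D.q * j + D.m * i = n :=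
    ⟨_, i, j, h, rfl⟩
  obtain ⟨i₀, j₀, h₀, hn⟩ := Nat.find_spec hex
  have hmin : ∀ i j : ℕ, (H.coeff i).order = (j : ℕ∞) →
      D.q * j₀ + D.m * i₀ ≤ D.q * j + D.m * i := by
    intro i j hij
    rw [hn]
    exact Nat.find_min' hex ⟨i, j, hij, rfl⟩
  have hmem : ((i₀ : ℝ), (j₀ : ℝ)) ∈ newtonPolygon H := by
    refine mem_lowerHull_of_support (a := D.m) (b := D.q) (by exact_mod_cast D.q_pos)
      (subset_convexHull ℝ _ ⟨i₀, j₀, h₀, rfl⟩) ?_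
    rintro _ ⟨i, j, hij, rfl⟩
    have := hmin i j hij
    simp only
    exact_mod_cast (by omega : D.m * i₀ + D.q * j₀ ≤ D.m * i + D.q * j)
  have hs := D.straight _ hmem _ hH.top_mem_newtonPolygon
  simp only at hs
  have hle := hmin i j h
  have : (D.m * H.natDegree : ℝ) = D.q * j₀ + D.m * i₀ := by linarith
  have : D.m * H.natDegree = D.q * j₀ + D.m * i₀ := by exact_mod_cast this
  omega

theorem mul_natDegree_le_of_coeff (D : EdgeData H) (hH : IsWeierstrass H) {i j : ℕ}
    (h : PowerSeries.coeff j (H.coeff i) ≠ 0) : D.m * H.natDegree ≤ D.q * j + D.m * i := by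
  obtain ⟨j', hj', hord⟩ := exists_order_of_coeff_ne_zero h
  have := D.mul_natDegree_le_of_order hH hord
  have := Nat.mul_le_mul_left D.q hj'
  omega

/-- The polygon lies on the line through `(N, 0)`. Conversely a nonzero coefficient on that line is
the lowest of its column, since nothing lies below the line, and its point belongs to the polygon.
-/
theorem coeff_boundaryPoly (D : EdgeData H) (hH : IsWeierstrass H) (i j : ℕ) :
    PowerSeries.coeff j ((boundaryPoly H).coeff i) =
      if D.q * j + D.m * i = D.m * H.natDegree then PowerSeries.coeff j (H.coeff i) else 0 := by
  rw [boundaryPoly, coeff_restrictTo]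
  by_cases hmem : ((i : ℝ), (j : ℝ)) ∈ newtonPolygon H
  · have hs := D.straight _ hmem _ hH.top_mem_newtonPolygon
    simp only at hs
    have : (D.q * j + D.m * i : ℝ) = D.m * H.natDegree := by linarith
    rw [if_pos hmem, if_pos (by exact_mod_cast this)]
  · rw [if_neg hmem]
    split_ifs with hline
    · by_contra hne
      obtain ⟨j', hj', hord⟩ := exists_order_of_coeff_ne_zero (Ne.symm hne)
      have h1 := D.mul_natDegree_le_of_order hH hord
      have h2 : D.q * j ≤ D.q * j' := by omega
      obtain rfl := le_antisymm hj' (Nat.le_of_mul_le_mul_left h2 D.q_pos)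
      refine hmem (mem_lowerHull_of_support (a := D.m) (b := D.q) (by exact_mod_cast D.q_pos)
        (subset_convexHull ℝ _ ⟨i, j', hord, rfl⟩) ?_)
      rintro _ ⟨i'', j'', h'', rfl⟩
      have := D.mul_natDegree_le_of_order hH h''
      simp only
      exact_mod_cast (by omega : D.m * i + D.q * j' ≤ D.m * i'' + D.q * j'')
    · rfl

theorem exists_coeff_on_line (D : EdgeData H) (hH : IsWeierstrass H) (hne : H ≠ Polynomial.X ^ H.natDegree) :
    ∃ i < H.natDegree, ∃ j, 0 < j ∧ PowerSeries.coeff j (H.coeff i) ≠ 0 ∧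
      D.q * j + D.m * i = D.m * H.natDegree := by
  classical
  have hex : ∃ i, H.coeff i ≠ 0 := (hH.exists_coeff_ne_zero hne).imp fun i h => h.2
  have h0 := Nat.find_spec hex
  have hlt : Nat.find hex < H.natDegree := by
    obtain ⟨i, hi, hi'⟩ := hH.exists_coeff_ne_zero hne
    exact (Nat.find_min' hex hi').trans_lt hi
  set i₀ := Nat.find hex
  obtain ⟨j₀, hj₀⟩ : ∃ j₀ : ℕ, (H.coeff i₀).order = j₀ := by
    obtain ⟨j, hj⟩ := ENat.ne_top_iff_exists.1 (mt PowerSeries.order_eq_top.1 h0)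
    exact ⟨j, hj.symm⟩
  have hmem : ((i₀ : ℝ), (j₀ : ℝ)) ∈ newtonPolygon H := by
    -- The functional `j₀ i + j` is least at the leftmost point `(i₀, j₀)`: a point further to the
    -- right has `j₀ i ≥ j₀ i₀ + j₀`.
    refine mem_lowerHull_of_support (a := j₀) (b := 1) one_pos
      (subset_convexHull ℝ _ ⟨i₀, j₀, hj₀, rfl⟩) ?_
    rintro _ ⟨i, j, hij, rfl⟩
    simp only
    have h1 : i₀ ≤ i := Nat.find_min' hex fun h => by rw [h, PowerSeries.order_zero] at hij; simp at hij
    rcases h1.eq_or_lt with h1 | h1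
    · rw [← h1, hj₀] at hij
      have : j₀ = j := by exact_mod_cast hij
      rw [← h1, this]
    · have : j₀ * (i₀ + 1) ≤ j₀ * i := Nat.mul_le_mul_left _ h1
      exact_mod_cast (by nlinarith : j₀ * i₀ + 1 * j₀ ≤ j₀ * i + 1 * j)
  have hs := D.straight _ hmem _ hH.top_mem_newtonPolygon
  simp only at hs
  have hline : (D.q * j₀ + D.m * i₀ : ℝ) = D.m * H.natDegree := by linarith
  have hc := (order_eq_nat_iff_coeff.1 hj₀).1
  refine ⟨i₀, hlt, j₀, Nat.pos_of_ne_zero ?_, hc, by exact_mod_cast hline⟩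
  rintro rfl
  exact hc (by rw [PowerSeries.coeff_zero_eq_constantCoeff_apply, hH.2 _ hlt])

theorem m_pos (D : EdgeData H) (hH : IsWeierstrass H) (hne : H ≠ Polynomial.X ^ H.natDegree) : 0 < D.m := by
  obtain ⟨i, -, j, hj, -, h⟩ := D.exists_coeff_on_line hH hne
  refine Nat.pos_of_ne_zero fun h0 => ?_
  rw [h0, zero_mul, zero_mul, add_zero] at h
  exact (Nat.mul_pos D.q_pos hj).ne' h

end EdgeData

/-! ### Quasi-homogeneous polynomials and the degree of an edge -/

section QuasiHom

variable {L : Type u} [Field L] (q m : ℕ) (P : L[X])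

theorem coeff_quasiHom (hq : 0 < q) (n : ℕ) : (quasiHom q m P).coeff (q * n) =
    PowerSeries.monomial (m * (P.natDegree - n)) (P.coeff n) := by
  rw [quasiHom, Polynomial.sum_def, Polynomial.finsetSum_coeff]
  simp only [Polynomial.coeff_monomial]
  rw [Finset.sum_eq_single n]
  · rw [if_pos rfl]
  · intro j _ hj
    rw [if_neg]
    exact fun h => hj (Nat.eq_of_mul_eq_mul_left hq h)
  · intro h
    rw [if_pos rfl, Polynomial.notMem_support_iff.1 h, map_zero]

theorem natDegree_quasiHom_le : (quasiHom q m P).natDegree ≤ q * P.natDegree := by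
  rw [quasiHom, Polynomial.sum_def]
  refine Polynomial.natDegree_sum_le_of_forall_le _ _ fun j hj => ?_
  exact (Polynomial.natDegree_monomial_le _).trans
    (Nat.mul_le_mul_left _ (Polynomial.le_natDegree_of_mem_supp j hj))

variable {P}

theorem quasiHom_monic (hq : 0 < q) (hP : P.Monic) : (quasiHom q m P).Monic := by
  refine Polynomial.monic_of_natDegree_le_of_coeff_eq_one _ (natDegree_quasiHom_le q m P) ?_
  rw [coeff_quasiHom q m P hq, Nat.sub_self, mul_zero, hP.coeff_natDegree]
  exact PowerSeries.monomial_zero_eq_C_apply _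

theorem natDegree_quasiHom (hq : 0 < q) (hP : P.Monic) :
    (quasiHom q m P).natDegree = q * P.natDegree := by
  refine le_antisymm (natDegree_quasiHom_le q m P) (Polynomial.le_natDegree_of_ne_zero ?_)
  rw [coeff_quasiHom q m P hq, Nat.sub_self, mul_zero, hP.coeff_natDegree,
    PowerSeries.monomial_zero_eq_C_apply]
  simp

end QuasiHom

namespace EdgeData

variable {L : Type u} [Field L] {H : L⟦X⟧[X]}

theorem natDegree_boundaryPoly (D : EdgeData H) (hH : IsWeierstrass H) :
    (boundaryPoly H).natDegree = H.natDegree := by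
  refine Polynomial.natDegree_eq_of_le_of_coeff_ne_zero ?_ ?_
  · refine Polynomial.natDegree_le_iff_coeff_eq_zero.2 fun i hi => ?_
    ext j
    rw [D.coeff_boundaryPoly hH, Polynomial.coeff_eq_zero_of_natDegree_lt hi]
    simp
  · intro h0
    have := D.coeff_boundaryPoly hH H.natDegree 0
    rw [h0, if_pos (by ring), hH.1.coeff_natDegree] at this
    simp at this

theorem natDegree_eq (D : EdgeData H) (hH : IsWeierstrass H) :
    D.q * D.P.natDegree * D.N = H.natDegree := by
  obtain ⟨c, hc, h⟩ := D.boundary_eq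
  rw [← D.natDegree_boundaryPoly hH, h, Polynomial.natDegree_C_mul_of_mul_ne_zero,
    (quasiHom_monic _ _ D.q_pos D.monic).natDegree_pow, natDegree_quasiHom _ _ D.q_pos D.monic,
    mul_comm]
  rw [((quasiHom_monic _ _ D.q_pos D.monic).pow _).leadingCoeff, mul_one]
  simpa using hc

/-- For `P = Z` the boundary polynomial would be a multiple of `y ^ N`, but the line carries a term
with `i < N`. -/
theorem P_ne_X (D : EdgeData H) (hH : IsWeierstrass H) (hne : H ≠ Polynomial.X ^ H.natDegree) :
    D.P ≠ Polynomial.X := by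
  intro hP
  obtain ⟨i, hi, j, -, hij, hline⟩ := D.exists_coeff_on_line hH hne
  have hN := D.natDegree_eq hH
  obtain ⟨c, hc, h⟩ := D.boundary_eq
  have hquasi : quasiHom D.q D.m D.P = Polynomial.X ^ D.q := by
    rw [hP, quasiHom, Polynomial.sum_X_index (by simp)]
    simp [PowerSeries.monomial_zero_eq_C_apply, Polynomial.X_pow_eq_monomial]
  rw [hP, Polynomial.natDegree_X, mul_one] at hN
  have h1 := D.coeff_boundaryPoly hH i j
  rw [if_pos hline, h, hquasi, ← pow_mul, hN, Polynomial.coeff_C_mul, Polynomial.coeff_X_pow,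
    if_neg hi.ne, mul_zero, map_zero] at h1
  exact hij h1.symm

theorem P_coeff_zero_ne_zero (D : EdgeData H) (hH : IsWeierstrass H) (hne : H ≠ Polynomial.X ^ H.natDegree) :
    D.P.coeff 0 ≠ 0 := by
  intro h0
  exact D.P_ne_X hH hne (Polynomial.eq_of_monic_of_associated D.monic Polynomial.monic_X
    (associated_of_dvd_dvd (Polynomial.irreducible_X.dvd_symm D.irreducible
      (Polynomial.X_dvd_iff.2 h0)) (Polynomial.X_dvd_iff.2 h0)))

/-- After the Tschirnhaus transformation, the boundary polynomial is not the power of a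
polynomial `y - a x ^ m`. -/
theorem one_lt_q_mul_natDegree (D : EdgeData H) (hH : IsWeierstrass H) (hne : H ≠ Polynomial.X ^ H.natDegree)
    (hN : (H.natDegree : L) ≠ 0) (ht : H.coeff (H.natDegree - 1) = 0) :
    1 < D.q * D.P.natDegree := by
  have hpos : 0 < D.q * D.P.natDegree := Nat.mul_pos D.q_pos D.irreducible.natDegree_pos
  by_contra! hle
  have h1 : D.q * D.P.natDegree = 1 := by omega
  have hℓ := Nat.eq_one_of_mul_eq_one_left h1
  have hNat := D.natDegree_eq hH
  rw [h1, one_mul] at hNat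
  have hNpos : 0 < H.natDegree := Nat.pos_of_ne_zero fun h => hN (by rw [h]; simp)
  obtain ⟨c, hc, h⟩ := D.boundary_eq
  have hmon := quasiHom_monic D.q D.m D.q_pos D.monic
  have hdeg := natDegree_quasiHom D.q D.m D.q_pos D.monic
  have h2 : quasiHom D.q D.m D.P =
      Polynomial.X + Polynomial.C (PowerSeries.monomial D.m (D.P.coeff 0)) := by
    conv_lhs => rw [hmon.eq_X_add_C (by rw [hdeg, h1])]
    have := coeff_quasiHom D.q D.m D.P D.q_pos 0
    rw [mul_zero, hℓ, Nat.sub_zero, mul_one] at this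
    rw [this]
  -- If `q ℓ = 1`, the boundary polynomial is `c (y + a x ^ m) ^ N` with `a = P(0)`. Its coefficient
  -- at `x ^ m y ^ (N - 1)` is `c N a ≠ 0`, whereas that of `H` is zero.
  have h3 := D.coeff_boundaryPoly hH (H.natDegree - 1) D.m
  rw [ht, map_zero, ite_self, h, h2, Polynomial.coeff_C_mul, Polynomial.coeff_X_add_C_pow, hNat,
    show H.natDegree - (H.natDegree - 1) = 1 by omega, pow_one,
    ← Nat.choose_symm_of_eq_add (show H.natDegree = 1 + (H.natDegree - 1) by omega),
    Nat.choose_one_right, ← map_natCast (PowerSeries.C (R := L)), PowerSeries.coeff_C_mul,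
    PowerSeries.coeff_mul_C, PowerSeries.coeff_monomial_same] at h3
  exact mul_ne_zero hc (mul_ne_zero (D.P_coeff_zero_ne_zero hH hne) hN) h3

end EdgeData

/-! ### Power series integral over `K⟦μ x ^ e⟧` -/

section IntegralEquation

variable {K L : Type u} [Field K] [Field L] [Algebra K L]

/-- The products `β_b x ^ r`, with `β` a basis of `L` over `K` and `r < e`, generate `L⟦x⟧` over the
image of `K⟦x⟧`. Exponents are split modulo `e`, and the factor `μ ^ j` created by the substitution
is divided out. -/
theorem exists_scaleHom_coordinates [FiniteDimensional K L] {μ : L} (hμ : μ ≠ 0) {e : ℕ}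
    (he : 0 < e) (a : L⟦X⟧) : ∃ c : Fin e × Fin (Module.finrank K L) → K⟦X⟧,
      a = ∑ i, scaleHom K μ e he (c i) *
        (PowerSeries.C (Module.finBasis K L i.2) * PowerSeries.X ^ (i.1 : ℕ)) := by
  set β := Module.finBasis K L
  refine ⟨fun i => PowerSeries.mk fun j =>
    β.repr ((μ ^ j)⁻¹ * PowerSeries.coeff (e * j + i.1) a) i.2, ?_⟩
  ext n
  have hr : n % e < e := Nat.mod_lt _ he
  have hdiv : e * (n / e) + n % e = n := Nat.div_add_mod n e
  rw [map_sum, Fintype.sum_prod_type, Finset.sum_eq_single ⟨n % e, hr⟩]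
  · have hterm : ∀ b : Fin (Module.finrank K L), PowerSeries.coeff n
        (scaleHom K μ e he (PowerSeries.mk fun j =>
          β.repr ((μ ^ j)⁻¹ * PowerSeries.coeff (e * j + n % e) a) b) *
          (PowerSeries.C (β b) * PowerSeries.X ^ (n % e))) =
        μ ^ (n / e) * (β.repr ((μ ^ (n / e))⁻¹ * PowerSeries.coeff n a) b • β b) := by
      intro b
      rw [← mul_assoc, PowerSeries.coeff_mul_X_pow', if_pos (Nat.mod_le n e),
        PowerSeries.coeff_mul_C, coeff_scaleHom, if_pos (Nat.dvd_sub_mod n),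
        show (n - n % e) / e = n / e by rw [← Nat.div_eq_sub_mod_div], PowerSeries.coeff_mk, hdiv,
        Algebra.smul_def, mul_assoc]
    simp only [hterm]
    rw [← Finset.mul_sum, β.sum_repr, ← mul_assoc, mul_inv_cancel₀ (pow_ne_zero _ hμ), one_mul]
  · intro r _ hne
    refine Finset.sum_eq_zero fun b _ => ?_
    rw [← mul_assoc, PowerSeries.coeff_mul_X_pow']
    split_ifs with hle
    · rw [PowerSeries.coeff_mul_C, coeff_scaleHom, if_neg, zero_mul]
      intro hd
      refine hne (Fin.ext ?_)
      obtain ⟨k, hk⟩ := hd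
      simp only at hk hle ⊢
      rw [show n = r + e * k by omega, Nat.add_mul_mod_self_left, Nat.mod_eq_of_lt r.2]
    · rfl
  · intro h; exact absurd (Finset.mem_univ _) h

/-- Every series satisfies a monic equation of degree `e [L : K]` over the image of
`a(x) ↦ a(μ x ^ e)`. -/
theorem exists_monic_eval₂_eq_zero [FiniteDimensional K L] {μ : L} (hμ : μ ≠ 0) {e : ℕ}
    (he : 0 < e) (a : L⟦X⟧) : ∃ χ : K⟦X⟧[X], χ.Monic ∧
      χ.natDegree = e * Module.finrank K L ∧ χ.eval₂ (scaleHom K μ e he) a = 0 := by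
  classical
  -- Multiplication by `a` on the generators `g` has a matrix over the image of `K⟦x⟧`, with `g` as
  -- an eigenvector for `a`. Its characteristic polynomial is the equation sought.
  set g : Fin e × Fin (Module.finrank K L) → L⟦X⟧ := fun i =>
    PowerSeries.C (Module.finBasis K L i.2) * PowerSeries.X ^ (i.1 : ℕ) with hg
  choose M hM using fun i => exists_scaleHom_coordinates (K := K) hμ he (a * g i)
  refine ⟨Matrix.charpoly (Matrix.of M), Matrix.charpoly_monic _, ?_, ?_⟩
  · rw [Matrix.charpoly_natDegree_eq_dim]; simp
  · have h1 : (Matrix.charpoly (Matrix.of M)).eval₂ (scaleHom K μ e he) a =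
        (Matrix.scalar _ a - (Matrix.of M).map (scaleHom K μ e he)).det := by
      rw [Matrix.charpoly, ← Polynomial.coe_eval₂RingHom, RingHom.map_det]
      congr 1
      ext1 i j
      by_cases hij : i = j
      · subst hij; simp [Matrix.charmatrix_apply_eq]
      · simp [Matrix.charmatrix_apply_ne _ _ _ hij, Matrix.diagonal_apply_ne _ hij]
    rw [h1, ← Matrix.exists_mulVec_eq_zero_iff]
    refine ⟨g, ?_, ?_⟩
    · intro h0
      have : 0 < Module.finrank K L := Module.finrank_pos
      have h2 := congrFun h0 (⟨0, he⟩, ⟨0, this⟩)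
      simp [hg] at h2
      exact (Module.finBasis K L).ne_zero _ h2
    · funext i
      rw [Matrix.sub_mulVec, Pi.sub_apply, Pi.zero_apply, sub_eq_zero, Matrix.scalar_apply,
        Matrix.mulVec_diagonal, hM i]
      rfl

end IntegralEquation

/-! ### Initial forms along an edge after the substitution -/

section Pull

variable {K L : Type u} [Field K] [Field L] [Algebra K L]

/-- The initial form after `x ↦ ζ x ^ q`, `y ↦ x ^ m T` of a polynomial whose points all satisfy
`q j + m i ≥ W`. -/
theorem Ini.pullHom_of_line {H : K⟦X⟧[X]} {q m W : ℕ} (hq : 0 < q)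
    (h : ∀ i j, PowerSeries.coeff j (H.coeff i) ≠ 0 → W ≤ q * j + m * i) (ζ : L) (T : L⟦X⟧[X]) :
    Ini (NewtonPuiseux.pullHom K ζ q hq (Polynomial.C (PowerSeries.X ^ m) * T) H) W
      (∑ i ∈ Finset.range (H.natDegree + 1), Polynomial.C (if m * i ≤ W then
        PowerSeries.coeff (W - m * i) (scaleHom K ζ q hq (H.coeff i)) else 0) *
          (T.map PowerSeries.constantCoeff) ^ i) := by
  have hsum : NewtonPuiseux.pullHom K ζ q hq (Polynomial.C (PowerSeries.X ^ m) * T) H =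
      ∑ i ∈ Finset.range (H.natDegree + 1), Polynomial.C (scaleHom K ζ q hq (H.coeff i)) *
        (Polynomial.C (PowerSeries.X ^ m) * T) ^ i := by
    conv_lhs => rw [H.as_sum_range_C_mul_X_pow]
    rw [map_sum]
    refine Finset.sum_congr rfl fun i _ => ?_
    rw [map_mul, RingHom.map_pow (NewtonPuiseux.pullHom _ _ _ _ _), pullHom_C, pullHom_X]
  rw [hsum]
  refine Ini.sum _ fun i _ => ?_
  have hT := (Ini.X_pow_mul m T).pow i
  split_ifs with hi
  · have hord : ((W - m * i : ℕ) : ℕ∞) ≤ (scaleHom K ζ q hq (H.coeff i)).order := by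
      refine PowerSeries.le_order _ _ fun n hn => ?_
      rw [coeff_scaleHom]
      split_ifs with hd
      · by_contra hne
        have h1 : PowerSeries.coeff (n / q) (H.coeff i) ≠ 0 := by
          intro h0; rw [h0] at hne; simp at hne
        have h2 := h _ _ h1
        rw [Nat.mul_div_cancel' hd] at h2
        have h3 : n < W - m * i := by exact_mod_cast hn
        omega
      · rfl
    refine ((Ini.C_of_order_le hord).mul hT).cast ?_ rfl
    rw [mul_comm i m]; omega
  · have h0 : Ini (Polynomial.C (scaleHom K ζ q hq (H.coeff i))) 0 _ :=
      Ini.C_of_order_le (by simp)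
    refine ((h0.mul hT).of_lt (by rw [zero_add, mul_comm i m]; omega)).cast rfl ?_
    rw [Polynomial.C_0, zero_mul]

theorem Ini.pullHom_of_above_line {H : K⟦X⟧[X]} {q m W : ℕ} (hq : 0 < q)
    (h : ∀ i j, PowerSeries.coeff j (H.coeff i) ≠ 0 → W < q * j + m * i) (ζ : L) (T : L⟦X⟧[X]) :
    Ini (NewtonPuiseux.pullHom K ζ q hq (Polynomial.C (PowerSeries.X ^ m) * T) H) W 0 := by
  refine (Ini.pullHom_of_line hq (fun i j hij => (h i j hij).le) ζ T).cast rfl ?_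
  refine Finset.sum_eq_zero fun i _ => ?_
  split_ifs with hi
  · rw [coeff_scaleHom]
    split_ifs with hd
    · have : PowerSeries.coeff ((W - m * i) / q) (H.coeff i) = 0 := by
        by_contra hne
        have := h _ _ hne
        rw [Nat.mul_div_cancel' hd] at this
        omega
      simp [this]
    · simp
  · simp

theorem scaleHom_monomial (ζ : L) (q : ℕ) (hq : 0 < q) (k : ℕ) (a : K) :
    scaleHom K ζ q hq (PowerSeries.monomial k a) =
      PowerSeries.X ^ (q * k) * PowerSeries.C (ζ ^ k * algebraMap K L a) := by
  rw [PowerSeries.monomial_eq_C_mul_X_pow, map_mul, scaleHom_C, map_pow, scaleHom_X, mul_pow,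
    ← pow_mul, map_mul, map_pow]
  ring

/-- The initial form of a quasi-homogeneous polynomial after the substitution. -/
theorem Ini.pullHom_quasiHom (q m : ℕ) (hq : 0 < q) (P : K[X]) (ζ : L) (T : L⟦X⟧[X]) :
    Ini (NewtonPuiseux.pullHom K ζ q hq (Polynomial.C (PowerSeries.X ^ m) * T) (quasiHom q m P))
      (q * m * P.natDegree)
      (∑ j ∈ P.support, Polynomial.C (ζ ^ (m * (P.natDegree - j)) * algebraMap K L (P.coeff j)) *
        (T.map PowerSeries.constantCoeff) ^ (q * j)) := by
  rw [quasiHom, Polynomial.sum_def, map_sum]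
  refine Ini.sum _ fun j hj => ?_
  rw [← Polynomial.C_mul_X_pow_eq_monomial, map_mul,
    RingHom.map_pow (NewtonPuiseux.pullHom _ _ _ _ _), pullHom_C, pullHom_X, scaleHom_monomial, Polynomial.C_mul]
  have h1 : Ini (Polynomial.C (PowerSeries.X ^ (q * (m * (P.natDegree - j)))) *
      Polynomial.C (PowerSeries.C (ζ ^ (m * (P.natDegree - j)) * algebraMap K L (P.coeff j))))
      (q * (m * (P.natDegree - j))) _ := Ini.X_pow_mul _ _
  refine (h1.mul ((Ini.X_pow_mul m T).pow (q * j))).cast ?_ (by simp)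
  have : j ≤ P.natDegree := Polynomial.le_natDegree_of_mem_supp j hj
  obtain ⟨c, hc⟩ := Nat.exists_eq_add_of_le this
  rw [hc, Nat.add_sub_cancel_left]; ring

end Pull

section EdgePull

variable {L L' : Type u} [Field L] [Field L'] [Algebra L L'] {H : L⟦X⟧[X]}

/-- After the substitution, the initial form of `H` has a zero of order `N` at `y = 0`. -/
theorem EdgeData.exists_ini_pullHom (D : EdgeData H) (hH : IsWeierstrass H) {z : L'}
    (hPz : Polynomial.aeval z D.P = 0)
    (hP' : Polynomial.aeval z (Polynomial.derivative D.P) ≠ 0) (hz : z ≠ 0)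
    (hqL : (D.q : L') ≠ 0) {T : L'⟦X⟧[X]}
    (hT : T.map PowerSeries.constantCoeff = Polynomial.X + Polynomial.C (z ^ D.s)) :
    ∃ r : L'[X], r.coeff 0 ≠ 0 ∧
      Ini (pullHom L (z ^ D.t) D.q D.q_pos (Polynomial.C (PowerSeries.X ^ D.m) * T) H)
        (D.q * D.m * D.P.natDegree * D.N) (Polynomial.X ^ D.N * r) := by
  have hW : D.q * D.m * D.P.natDegree * D.N = D.m * H.natDegree := by
    rw [← D.natDegree_eq hH]; ring
  obtain ⟨c, hc, hB⟩ := D.boundary_eq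
  have hrest : Ini (pullHom L (z ^ D.t) D.q D.q_pos (Polynomial.C (PowerSeries.X ^ D.m) * T)
      (H - boundaryPoly H)) (D.m * H.natDegree) 0 := by
    refine Ini.pullHom_of_above_line D.q_pos (fun i j hij => ?_) _ _
    rw [Polynomial.coeff_sub, map_sub, D.coeff_boundaryPoly hH] at hij
    split_ifs at hij with hline
    · simp at hij
    · rw [sub_zero] at hij
      exact lt_of_le_of_ne (D.mul_natDegree_le_of_coeff hH hij) (Ne.symm hline)
  set p₀ := ∑ j ∈ D.P.support, Polynomial.C ((z ^ D.t) ^ (D.m * (D.P.natDegree - j)) *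
    algebraMap L L' (D.P.coeff j)) * (Polynomial.X + Polynomial.C (z ^ D.s)) ^ (D.q * j) with hp₀
  have hquasi := Ini.pullHom_quasiHom D.q D.m D.q_pos D.P (z ^ D.t) T
  rw [hT, ← hp₀] at hquasi
  -- By `q s = t m + 1` the factor `z ^ (t m ℓ)` is common to all terms at `y = 0`, so `p₀(0)` is
  -- that power of `z` times `P(z) = 0`.
  have hpow : ∀ j ∈ D.P.support, (z ^ D.t) ^ (D.m * (D.P.natDegree - j)) * (z ^ D.s) ^ (D.q * j) =
      z ^ (D.t * D.m * D.P.natDegree) * z ^ j := by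
    intro j hj
    rw [← pow_mul, ← pow_mul, ← pow_add, ← pow_add]
    congr 1
    obtain ⟨k, hk⟩ := Nat.exists_eq_add_of_le (Polynomial.le_natDegree_of_mem_supp j hj)
    rw [hk, Nat.add_sub_cancel_left, show D.s * (D.q * j) = (D.q * D.s) * j by ring, D.bezout]
    ring
  have h0 : p₀.coeff 0 = 0 := by
    have : p₀.coeff 0 = z ^ (D.t * D.m * D.P.natDegree) * Polynomial.aeval z D.P := by
      rw [Polynomial.aeval_def, Polynomial.eval₂_eq_sum, Polynomial.sum_def, Finset.mul_sum, hp₀,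
        Polynomial.finsetSum_coeff]
      refine Finset.sum_congr rfl fun j hj => ?_
      rw [Polynomial.coeff_C_mul, Polynomial.coeff_X_add_C_pow, Nat.sub_zero, Nat.choose_zero_right,
        Nat.cast_one, mul_one, mul_right_comm, hpow j hj]
      ring
    rw [this, hPz, mul_zero]
  -- In the same way the coefficient of `y` is `q z P'(z)` up to a power of `z`. Hence `p₀` has a
  -- simple zero at `y = 0`, and its `N`-th power one of order exactly `N`.
  have h1 : p₀.coeff 1 ≠ 0 := by
    have : z ^ D.s * p₀.coeff 1 = z ^ (D.t * D.m * D.P.natDegree) *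
        ((D.q : L') * (z * Polynomial.aeval z (Polynomial.derivative D.P))) := by
      rw [Polynomial.derivative_apply, Polynomial.sum_def, map_sum, hp₀,
        Polynomial.finsetSum_coeff, Finset.mul_sum, Finset.mul_sum, Finset.mul_sum, Finset.mul_sum]
      refine Finset.sum_congr rfl fun j hj => ?_
      rw [Polynomial.coeff_C_mul, Polynomial.coeff_X_add_C_pow, Nat.choose_one_right]
      rcases Nat.eq_zero_or_pos j with rfl | hj'
      · simp
      · have h2 : (z ^ D.s) ^ (D.q * j) = (z ^ D.s) ^ (D.q * j - 1) * z ^ D.s := by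
          rw [← pow_succ, Nat.sub_add_cancel (Nat.mul_pos D.q_pos hj')]
        have h3 : z ^ j = z ^ (j - 1) * z := by rw [← pow_succ, Nat.sub_add_cancel hj']
        have h4 := hpow j hj
        rw [h2, h3] at h4
        simp only [map_mul, Polynomial.aeval_C, map_pow, Polynomial.aeval_X, map_natCast,
          Nat.cast_mul]
        linear_combination (algebraMap L L' (D.P.coeff j) * D.q * j) * h4
    intro h
    rw [h, mul_zero] at this
    exact mul_ne_zero (pow_ne_zero _ hz) (mul_ne_zero hqL (mul_ne_zero hz hP')) this.symm
  obtain ⟨r₀, hr₀⟩ := Polynomial.X_dvd_iff.2 h0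
  have hr₀' : r₀.coeff 0 ≠ 0 := by rwa [hr₀, Polynomial.coeff_X_mul] at h1
  refine ⟨Polynomial.C (algebraMap L L' c) * r₀ ^ D.N, ?_, ?_⟩
  · rw [Polynomial.coeff_C_mul, Polynomial.coeff_zero_eq_eval_zero, Polynomial.eval_pow,
      ← Polynomial.coeff_zero_eq_eval_zero]
    exact mul_ne_zero (by simpa using hc) (pow_ne_zero _ hr₀')
  · have hC : Ini (pullHom L (z ^ D.t) D.q D.q_pos (Polynomial.C (PowerSeries.X ^ D.m) * T)
        (Polynomial.C (PowerSeries.C c))) 0 (Polynomial.C (algebraMap L L' c)) := by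
      rw [pullHom_C, scaleHom_C]
      exact ⟨Polynomial.C (PowerSeries.C (algebraMap L L' c)), by simp, by simp⟩
    have hmain := hC.mul (hquasi.pow D.N)
    rw [← map_pow, ← map_mul, ← hB] at hmain
    have hsum := (hrest.cast hW.symm rfl).add (hmain.cast (by ring) rfl)
    rw [← map_add, sub_add_cancel] at hsum
    refine hsum.cast rfl ?_
    rw [hr₀, mul_pow]; ring

end EdgePull

/-! ### The invariants of a stage and their propagation -/

section Invariant

variable {K : Type u} [Field K]

/-- The pull-back `π^*` of a stage, as a ring homomorphism. -/
def Stage.pb (S : Stage K) : K⟦X⟧[X] →+* S.L⟦X⟧[X] := pullHom K S.μ S.e S.e_pos S.Y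

/-- The degree `e [L : K]` of the minimal polynomials of a stage. -/
def Stage.deg (S : Stage K) : ℕ := S.e * Module.finrank K S.L

/-- The properties of the stages of the algorithm that are preserved at each step. -/
structure Inv (F : K⟦X⟧[X]) (S : Stage K) : Prop where
  finite : FiniteDimensional K S.L
  mu_ne_zero : S.μ ≠ 0
  deg_mul : S.deg * S.H.natDegree = F.natDegree
  natDegree_pos : 0 < S.H.natDegree
  weierstrass : IsWeierstrass S.H
  tschirnhaus : S.H.coeff (S.H.natDegree - 1) = 0
  pb_F : ∃ (v : ℕ) (U : S.L⟦X⟧[X]), S.pb F = Polynomial.C (PowerSeries.X ^ v) * S.H * U ∧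
    PowerSeries.constantCoeff (U.coeff 0) ≠ 0
  ini : ∀ Q : K⟦X⟧[X], Q ≠ 0 → Q.degree < (S.deg : WithBot ℕ) →
    ∃ w p, Ini (S.pb Q) w p ∧ p.coeff 0 ≠ 0
  root : ∀ χ : K⟦X⟧[X], χ.Monic → χ.natDegree = S.deg → (S.pb χ).coeff 0 = 0 →
    ∃ (v : ℕ) (u : S.L⟦X⟧[X]), S.pb χ = Polynomial.C (PowerSeries.X ^ v) * (Polynomial.X * u) ∧
      PowerSeries.constantCoeff (u.coeff 0) ≠ 0

theorem Inv.deg_pos {F : K⟦X⟧[X]} {S : Stage K} (I : Inv F S) : 0 < S.deg := by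
  have := I.finite
  exact Nat.mul_pos S.e_pos Module.finrank_pos

theorem Stage.coeff_zero_pb (S : Stage K) (χ : K⟦X⟧[X]) : (S.pb χ).coeff 0 =
    χ.eval₂ (scaleHom K S.μ S.e S.e_pos) (S.Y.coeff 0) := by
  have : (Polynomial.evalRingHom (0 : S.L⟦X⟧)).comp S.pb =
      Polynomial.eval₂RingHom (scaleHom K S.μ S.e S.e_pos) (S.Y.coeff 0) := by
    refine Polynomial.ringHom_ext (fun a => ?_) ?_
    · simp [Stage.pb]
    · simp [Stage.pb, Polynomial.coeff_zero_eq_eval_zero]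
  rw [Polynomial.coeff_zero_eq_eval_zero]
  exact congrArg (fun f => f χ) this

/-- A monic polynomial of the right degree that vanishes at `π(x, 0)`. -/
theorem Inv.exists_root {F : K⟦X⟧[X]} {S : Stage K} (I : Inv F S) :
    ∃ χ : K⟦X⟧[X], χ.Monic ∧ χ.natDegree = S.deg ∧ (S.pb χ).coeff 0 = 0 := by
  have := I.finite
  obtain ⟨χ, h1, h2, h3⟩ := exists_monic_eval₂_eq_zero (K := K) I.mu_ne_zero S.e_pos (S.Y.coeff 0)
  exact ⟨χ, h1, h2, by rw [S.coeff_zero_pb, h3]⟩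

/-- For an exact root `θ = 0`, so the closeness condition holds for every slope at once. -/
theorem Inv.good_of_root {F : K⟦X⟧[X]} {S : Stage K} (I : Inv F S) {χ : K⟦X⟧[X]} (hχ : χ.Monic)
    (hdeg : χ.natDegree = S.deg) (h0 : (S.pb χ).coeff 0 = 0) :
    ∃ v u₀, ∀ q m, Good q m (S.pb χ) v u₀ := by
  obtain ⟨v, u, h, hu⟩ := I.root χ hχ hdeg h0
  exact ⟨v, _, fun q m => ⟨hu, 0, u, by rw [h, Polynomial.C_0, zero_add], rfl, by simp⟩⟩

theorem Inv.of_data {F : K⟦X⟧[X]} {L : Type u} [Field L] [Algebra K L] (H : L⟦X⟧[X]) (μ : L) (e : ℕ)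
    (he : 0 < e) (Y : L⟦X⟧[X]) (hfin : FiniteDimensional K L) (hμ : μ ≠ 0)
    (hdeg : e * Module.finrank K L * H.natDegree = F.natDegree) (hpos : 0 < H.natDegree)
    (hH : IsWeierstrass H) (ht : H.coeff (H.natDegree - 1) = 0)
    (hF : ∃ (v : ℕ) (U : L⟦X⟧[X]), pullHom K μ e he Y F = Polynomial.C (PowerSeries.X ^ v) * H * U ∧
      PowerSeries.constantCoeff (U.coeff 0) ≠ 0)
    (hini : ∀ Q : K⟦X⟧[X], Q ≠ 0 → Q.degree < ((e * Module.finrank K L : ℕ) : WithBot ℕ) →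
      ∃ w p, Ini (pullHom K μ e he Y Q) w p ∧ p.coeff 0 ≠ 0)
    (hroot : ∀ χ : K⟦X⟧[X], χ.Monic → χ.natDegree = e * Module.finrank K L →
      (pullHom K μ e he Y χ).coeff 0 = 0 → ∃ (v : ℕ) (u : L⟦X⟧[X]),
        pullHom K μ e he Y χ = Polynomial.C (PowerSeries.X ^ v) * (Polynomial.X * u) ∧
        PowerSeries.constantCoeff (u.coeff 0) ≠ 0) :
    Inv F (Stage.mk L H μ e he Y) :=
  ⟨hfin, hμ, hdeg, hpos, hH, ht, hF, hini, hroot⟩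

/-- The map `π_0` only translates `y`, and `deg = 1`. A polynomial of degree `< 1` is a series in
`x`, and a monic linear one that vanishes at `π_0(x, 0)` pulls back to `y`. -/
theorem Inv.initial {F : K⟦X⟧[X]} (hF : IsWeierstrass F) (hd : 0 < F.natDegree)
    (hN : (F.natDegree : K) ≠ 0) : Inv F (initialStage F) := by
  set c := tschirnhausShift F with hc
  have hpb : ∀ Q : K⟦X⟧[X], pullHom K (1 : K) 1 one_pos (Polynomial.X + Polynomial.C c) Q =
      Q.comp (Polynomial.X + Polynomial.C c) := by
    intro Q
    change Q.eval₂ (Polynomial.C.comp (scaleHom K (1 : K) 1 one_pos)) _ = _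
    rw [Polynomial.comp]
    congr 1
    ext a : 1
    rw [RingHom.comp_apply, scaleHom_one_one]
  have hnat : (F.comp (Polynomial.X + Polynomial.C c)).natDegree = F.natDegree :=
    natDegree_comp_X_add_C F c
  have hdeg : 1 * Module.finrank K K = 1 := by rw [Module.finrank_self]
  refine Inv.of_data (F.comp (Polynomial.X + Polynomial.C c)) (1 : K) 1 one_pos
    (Polynomial.X + Polynomial.C c) inferInstance one_ne_zero ?_ ?_ ?_ ?_ ?_ ?_ ?_
  · rw [hdeg, one_mul, hnat]
  · rw [hnat]; exact hd
  · exact hF.comp_X_add_C (hF.constantCoeff_tschirnhausShift hd)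
  · rw [hnat]
    exact coeff_comp_tschirnhausShift hF.1 hN
  · exact ⟨0, 1, by rw [hpb, pow_zero, map_one, one_mul, mul_one], by simp⟩
  · intro Q hQ hlt
    rw [hdeg] at hlt
    obtain ⟨a, rfl⟩ : ∃ a, Q = Polynomial.C a :=
      ⟨_, Polynomial.eq_C_of_degree_le_zero (Polynomial.natDegree_eq_zero_iff_degree_le_zero.1
        (Nat.lt_one_iff.1 ((Polynomial.natDegree_lt_iff_degree_lt hQ).2 hlt)))⟩
    have ha : a ≠ 0 := by rintro rfl; simp at hQ
    rw [hpb, Polynomial.C_comp]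
    obtain ⟨n, hn⟩ := ENat.ne_top_iff_exists.1 (mt PowerSeries.order_eq_top.1 ha)
    refine ⟨n, _, Ini.C_of_order_le hn.le, ?_⟩
    rw [Polynomial.coeff_C_zero]
    exact (order_eq_nat_iff_coeff.1 hn.symm).1
  · intro χ hχ hχd h0
    rw [hdeg] at hχd
    rw [hpb] at h0 ⊢
    have h1 := hχ.eq_X_add_C hχd
    refine ⟨0, 1, ?_, by simp⟩
    have h2 : χ.comp (Polynomial.X + Polynomial.C c) =
        Polynomial.X + Polynomial.C (c + χ.coeff 0) := by
      conv_lhs => rw [h1]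
      simp [add_assoc]
    rw [h2, Polynomial.coeff_add, Polynomial.coeff_X_zero, zero_add, Polynomial.coeff_C_zero] at h0
    rw [h2, h0]; simp

theorem eval_zero_comp_map {L : Type u} [Field L] (V : L⟦X⟧[X]) {c : L⟦X⟧}
    (hc : PowerSeries.constantCoeff c = 0) :
    PowerSeries.constantCoeff ((V.comp (Polynomial.X + Polynomial.C c)).coeff 0) =
      PowerSeries.constantCoeff (V.coeff 0) := by
  rw [← map_constantCoeff_coeff, Polynomial.map_comp, ← map_constantCoeff_coeff]
  simp [hc]

section Root

variable {L : Type u} [Field L] {P : L[X]} [Fact (Irreducible P)]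

theorem dvd_of_aeval_root (R : L[X]) (h : Polynomial.aeval (AdjoinRoot.root P) R = 0) : P ∣ R := by
  rwa [AdjoinRoot.aeval_eq, AdjoinRoot.mk_eq_zero] at h

theorem root_ne_zero (hP : Irreducible P) (h0 : P.coeff 0 ≠ 0) : AdjoinRoot.root P ≠ 0 := by
  intro h
  have h1 : P ∣ Polynomial.X := dvd_of_aeval_root _ (by rw [Polynomial.aeval_X, h])
  exact h0 (Polynomial.X_dvd_iff.1 (hP.dvd_symm Polynomial.irreducible_X h1))

/-- The coefficient of `P'` in degree `ℓ - 1` is `ℓ ≠ 0`. So `P'` is nonzero of smaller degree than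
`P` and cannot be divisible by it. -/
theorem aeval_derivative_ne_zero (hP : P.Monic) (hpos : 0 < P.natDegree)
    (hℓ : (P.natDegree : L) ≠ 0) :
    Polynomial.aeval (AdjoinRoot.root P) (Polynomial.derivative P) ≠ 0 := by
  intro h
  have h1 := dvd_of_aeval_root _ h
  have h2 : Polynomial.derivative P ≠ 0 := by
    intro h0
    have := Polynomial.coeff_derivative P (P.natDegree - 1)
    rw [h0, Nat.sub_add_cancel hpos, hP.coeff_natDegree, one_mul, Polynomial.coeff_zero] at this
    refine hℓ ?_
    rw [this, ← Nat.cast_succ, Nat.succ_eq_add_one, Nat.sub_add_cancel hpos]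
  have h3 := Polynomial.natDegree_le_of_dvd h1 h2
  have h4 := Polynomial.natDegree_derivative_lt hpos.ne'
  omega

end Root

theorem pullHom_comp_X_add_C {L L' : Type u} [Field L] [Field L'] [Algebra L L'] (ζ : L') (q : ℕ)
    (hq : 0 < q) (T : L'⟦X⟧[X]) (c : L'⟦X⟧) (Q : L⟦X⟧[X]) :
    pullHom L ζ q hq (T.comp (Polynomial.X + Polynomial.C c)) Q =
      (pullHom L ζ q hq T Q).comp (Polynomial.X + Polynomial.C c) := by
  have : pullHom L ζ q hq (T.comp (Polynomial.X + Polynomial.C c)) =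
      (Polynomial.compRingHom (Polynomial.X + Polynomial.C c)).comp (pullHom L ζ q hq T) := by
    refine Polynomial.ringHom_ext (fun a => ?_) ?_
    · simp
    · simp
  rw [this]; rfl

/-- The polynomial `x ^ m (y + z ^ s + c)` by which `y` is replaced in the passage to the next
stage, without the factor `x ^ m`. -/
def EdgeData.shift {L : Type u} [Field L] {H : L⟦X⟧[X]} (D : EdgeData H) [Fact (Irreducible D.P)] :
    (AdjoinRoot D.P)⟦X⟧[X] :=
  Polynomial.X + Polynomial.C
    (PowerSeries.C (AdjoinRoot.root D.P ^ D.s) + tschirnhausShift (weierstrassPart D))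

/-- The substitution by which one passes to the next stage. -/
def EdgeData.sigma {L : Type u} [Field L] {H : L⟦X⟧[X]} (D : EdgeData H) [Fact (Irreducible D.P)] :
    L⟦X⟧[X] →+* (AdjoinRoot D.P)⟦X⟧[X] :=
  pullHom L (AdjoinRoot.root D.P ^ D.t) D.q D.q_pos (Polynomial.C (PowerSeries.X ^ D.m) * D.shift)

/-- The next stage, with explicit fields. -/
theorem nextStage_eq (S : Stage K) (D : EdgeData S.H) [Fact (Irreducible D.P)] :
    nextStage S D = Stage.mk (AdjoinRoot D.P)
      ((weierstrassPart D).comp (Polynomial.X + Polynomial.C (tschirnhausShift (weierstrassPart D))))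
      (algebraMap S.L (AdjoinRoot D.P) S.μ * (AdjoinRoot.root D.P ^ D.t) ^ S.e) (S.e * D.q)
      (Nat.mul_pos S.e_pos D.q_pos) (D.sigma S.Y) := rfl

theorem pullHom_sigma (S : Stage K) (D : EdgeData S.H) [Fact (Irreducible D.P)] (Q : K⟦X⟧[X]) :
    pullHom K (algebraMap S.L (AdjoinRoot D.P) S.μ * (AdjoinRoot.root D.P ^ D.t) ^ S.e) (S.e * D.q)
      (Nat.mul_pos S.e_pos D.q_pos) (D.sigma S.Y) Q = D.sigma (S.pb Q) :=
  (pullHom_comp _ _ _ _ _ _ _ _ Q).symm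

variable {F : K⟦X⟧[X]} {S : Stage K}

/-- The integers that must be invertible, `q`, `ℓ` and the degrees `N`, all divide `N_k` and hence
`d`. -/
theorem Inv.degree_conditions (I : Inv F S)
    (hchar : ∀ n : ℕ, 0 < n → n ≤ F.natDegree → (n : K) ≠ 0) {n : ℕ} (hn : n ∣ S.H.natDegree)
    (L' : Type u) [Field L'] [Algebra K L'] : (n : L') ≠ 0 := by
  have hF : n ∣ F.natDegree := I.deg_mul ▸ hn.mul_left _
  have hFpos : 0 < F.natDegree := I.deg_mul ▸ Nat.mul_pos I.deg_pos I.natDegree_pos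
  have h := hchar n (Nat.pos_of_dvd_of_pos hF hFpos) (Nat.le_of_dvd hFpos hF)
  rw [← map_natCast (algebraMap K L'), Ne, map_eq_zero]
  exact h

section Next

variable (D : EdgeData S.H) [Fact (Irreducible D.P)]

theorem root_ne_zero' (I : Inv F S) (hne : S.H ≠ Polynomial.X ^ S.H.natDegree) :
    AdjoinRoot.root D.P ≠ 0 :=
  root_ne_zero D.irreducible (D.P_coeff_zero_ne_zero I.weierstrass hne)

theorem q_cast_ne_zero (I : Inv F S)
    (hchar : ∀ n : ℕ, 0 < n → n ≤ F.natDegree → (n : K) ≠ 0) :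
    (D.q : AdjoinRoot D.P) ≠ 0 :=
  I.degree_conditions hchar
    ⟨D.P.natDegree * D.N, by rw [← D.natDegree_eq I.weierstrass, mul_assoc]⟩ _

theorem aeval_root_derivative_ne_zero (I : Inv F S)
    (hchar : ∀ n : ℕ, 0 < n → n ≤ F.natDegree → (n : K) ≠ 0) :
    Polynomial.aeval (AdjoinRoot.root D.P) (Polynomial.derivative D.P) ≠ 0 :=
  aeval_derivative_ne_zero D.monic D.irreducible.natDegree_pos (I.degree_conditions hchar
    ⟨D.q * D.N, by rw [← D.natDegree_eq I.weierstrass]; ring⟩ _)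

/-- The initial form of `H` after the substitution is `y ^ N` times a polynomial that is nonzero at
`0`, so Weierstrass preparation applies and the choice in `weierstrassPart` is meaningful. The unit
is itself a polynomial, which keeps the algorithm inside polynomials in `y`. -/
theorem weierstrassPart_spec (I : Inv F S)
    (hchar : ∀ n : ℕ, 0 < n → n ≤ F.natDegree → (n : K) ≠ 0)
    (hne : S.H ≠ Polynomial.X ^ S.H.natDegree) :
    IsWeierstrass (weierstrassPart D) ∧ (weierstrassPart D).natDegree = D.N ∧
      ∃ V : (AdjoinRoot D.P)⟦X⟧[X], pullHom S.L (AdjoinRoot.root D.P ^ D.t) D.q D.q_pos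
        (Polynomial.C (PowerSeries.X ^ D.m) * (Polynomial.X + Polynomial.C
          (PowerSeries.C (AdjoinRoot.root D.P ^ D.s)))) S.H =
        Polynomial.C (PowerSeries.X ^ (D.q * D.m * D.P.natDegree * D.N)) * weierstrassPart D * V ∧
        PowerSeries.constantCoeff (V.coeff 0) ≠ 0 := by
  obtain ⟨r, hr, hini⟩ := D.exists_ini_pullHom I.weierstrass
    (z := AdjoinRoot.root D.P) (by rw [AdjoinRoot.aeval_eq, AdjoinRoot.mk_self])
    (aeval_root_derivative_ne_zero D I hchar) (root_ne_zero' D I hne) (q_cast_ne_zero D I hchar)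
    (T := Polynomial.X + Polynomial.C (PowerSeries.C (AdjoinRoot.root D.P ^ D.s)))
    (by simp)
  have hspec : IsWeierstrassPart _ _ D.N (weierstrassPart D) :=
    Classical.epsilon_spec (exists_isWeierstrassPart hini hr)
  exact ⟨hspec.1, hspec.2.1, hspec.exists_polynomial hini⟩

theorem map_shift (I : Inv F S)
    (hchar : ∀ n : ℕ, 0 < n → n ≤ F.natDegree → (n : K) ≠ 0)
    (hne : S.H ≠ Polynomial.X ^ S.H.natDegree) :
    D.shift.map PowerSeries.constantCoeff =
      Polynomial.X + Polynomial.C (AdjoinRoot.root D.P ^ D.s) := by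
  obtain ⟨hG, hN, -⟩ := weierstrassPart_spec D I hchar hne
  have hpos : 0 < (weierstrassPart D).natDegree := by
    rw [hN]
    refine Nat.pos_of_ne_zero fun h0 => ?_
    have := D.natDegree_eq I.weierstrass
    rw [h0, mul_zero] at this
    exact I.natDegree_pos.ne this
  simp [EdgeData.shift, hG.constantCoeff_tschirnhausShift hpos]

theorem EdgeData.N_pos (I : Inv F S) (D : EdgeData S.H) : 0 < D.N := Nat.pos_of_ne_zero fun h0 => by
  have hNat := D.natDegree_eq I.weierstrass
  rw [h0, mul_zero] at hNat
  exact I.natDegree_pos.ne hNat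

/-- The order of the coefficients in the pull-back of a polynomial of small degree to the
next stage, for any element of the right degree that is close to a root. -/
theorem sigma_ini (I : Inv F S) (hne : S.H ≠ Polynomial.X ^ S.H.natDegree)
    (hT : D.shift.map PowerSeries.constantCoeff =
      Polynomial.X + Polynomial.C (AdjoinRoot.root D.P ^ D.s))
    {χ : K⟦X⟧[X]} {v : ℕ} {u₀ : S.L} (hgood : Good D.q D.m (S.pb χ) v u₀) {A : ℕ → K⟦X⟧[X]}
    (hA : ∀ i, (A i).degree < (S.deg : WithBot ℕ))
    (hQ : ∑ i ∈ Finset.range (D.q * D.P.natDegree), A i * χ ^ i ≠ 0) :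
    ∃ M p, Ini (D.sigma (S.pb (∑ i ∈ Finset.range (D.q * D.P.natDegree), A i * χ ^ i))) M p ∧
      p.coeff 0 ≠ 0 ∧ ∀ i < D.q * D.P.natDegree, A i ≠ 0 → ∃ w p, Ini (S.pb (A i)) w p ∧
        p.coeff 0 ≠ 0 ∧ M ≤ D.q * w + i * (D.q * v + D.m) := by
  obtain ⟨M, k, J, b, κ, p, hJ, hJn, hb, hκ, hini, hp0, -, hle⟩ :=
    exists_ini_expansion S.pb I.ini D.q_pos (D.m_pos I.weierstrass hne) D.bezout hgood hT hA hQ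
  refine ⟨M, p, hini, ?_, hle⟩
  rw [hp0]
  exact sum_ne_zero_of_exponents J b κ dvd_of_aeval_root (root_ne_zero' D I hne) D.q_pos hJ hb
    D.irreducible.natDegree_pos hκ hJn

/-- The polynomial vanishes at `y = 0`, hence so does its initial form `p`. Then `p.coeff 1` cannot
vanish as well, and it is the value of `u` at the origin. -/
theorem sigma_root (I : Inv F S) (hchar : ∀ n : ℕ, 0 < n → n ≤ F.natDegree → (n : K) ≠ 0)
    (hne : S.H ≠ Polynomial.X ^ S.H.natDegree)
    (hT : D.shift.map PowerSeries.constantCoeff =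
      Polynomial.X + Polynomial.C (AdjoinRoot.root D.P ^ D.s))
    {χ : K⟦X⟧[X]} {v : ℕ} {u₀ : S.L} (hgood : Good D.q D.m (S.pb χ) v u₀) {A : ℕ → K⟦X⟧[X]}
    (hA : ∀ i, (A i).degree < (S.deg : WithBot ℕ))
    (hQ : ∑ i ∈ Finset.range (D.q * D.P.natDegree + 1), A i * χ ^ i ≠ 0)
    (hQ0 : (D.sigma (S.pb (∑ i ∈ Finset.range (D.q * D.P.natDegree + 1), A i * χ ^ i))).coeff 0
      = 0) :
    ∃ (v : ℕ) (u : (AdjoinRoot D.P)⟦X⟧[X]),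
      D.sigma (S.pb (∑ i ∈ Finset.range (D.q * D.P.natDegree + 1), A i * χ ^ i)) =
        Polynomial.C (PowerSeries.X ^ v) * (Polynomial.X * u) ∧
      PowerSeries.constantCoeff (u.coeff 0) ≠ 0 := by
  rw [EdgeData.sigma] at hQ0 ⊢
  obtain ⟨M, k, J, b, κ, p, hJ, hJn, hb, hκ, hini, hp0, hp1, -⟩ :=
    exists_ini_expansion S.pb I.ini D.q_pos (D.m_pos I.weierstrass hne) D.bezout hgood hT hA hQ
  have h0 : p.coeff 0 = 0 := by
    rw [← (hini.exists_map_coeff 0).2, hQ0, map_zero]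
  obtain ⟨u, hu, hu0⟩ := exists_eq_X_mul_of_coeff_zero hini hQ0
  refine ⟨M, u, hu, ?_⟩
  rw [hu0]
  intro h1
  rw [h1, mul_zero] at hp1
  rw [hp0] at h0
  have hP' := aeval_root_derivative_ne_zero D I hchar
  have hz := root_ne_zero' D I hne
  have hqL := q_cast_ne_zero D I hchar
  have hJ' : ∀ i ∈ J, i ≤ D.q * D.P.natDegree := fun i hi => Nat.lt_succ_iff.1 (hJn i hi)
  have hdvd : ∀ R : S.L[X], Polynomial.aeval (AdjoinRoot.root D.P) R = 0 → D.P ∣ R :=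
    dvd_of_aeval_root
  have := sum_mul_ne_zero_of_exponents (L' := AdjoinRoot D.P) J b κ hdvd hP' hz hqL D.q_pos hJ hb
    hκ hJ' h0
  exact this hp1.symm

theorem sigma_F (I : Inv F S) (hchar : ∀ n : ℕ, 0 < n → n ≤ F.natDegree → (n : K) ≠ 0)
    (hne : S.H ≠ Polynomial.X ^ S.H.natDegree) :
    ∃ (v : ℕ) (U : (AdjoinRoot D.P)⟦X⟧[X]), D.sigma (S.pb F) = Polynomial.C (PowerSeries.X ^ v) *
      (weierstrassPart D).comp
        (Polynomial.X + Polynomial.C (tschirnhausShift (weierstrassPart D))) * U ∧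
      PowerSeries.constantCoeff (U.coeff 0) ≠ 0 := by
  have hz := root_ne_zero' D I hne
  obtain ⟨hG, hGN, V, hV, hV0⟩ := weierstrassPart_spec D I hchar hne
  have hm := D.m_pos I.weierstrass hne
  set c := tschirnhausShift (weierstrassPart D) with hc
  have hc0 : PowerSeries.constantCoeff c = 0 :=
    hG.constantCoeff_tschirnhausShift (by rw [hGN]; exact D.N_pos I)
  obtain ⟨v, U, hU, hU0⟩ := I.pb_F
  -- The full substitution is the one that defines `G`, followed by the translation `y ↦ y + c` that
  -- turns `G` into the next `H`.
  have hshift : Polynomial.C (PowerSeries.X ^ D.m) * D.shift =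
      (Polynomial.C (PowerSeries.X ^ D.m) * (Polynomial.X + Polynomial.C
        (PowerSeries.C (AdjoinRoot.root D.P ^ D.s)))).comp (Polynomial.X + Polynomial.C c) := by
    rw [EdgeData.shift]
    simp only [Polynomial.mul_comp, Polynomial.C_comp, Polynomial.add_comp, Polynomial.X_comp,
      Polynomial.C_add]
    ring
  refine ⟨D.q * v + D.q * D.m * D.P.natDegree * D.N,
    Polynomial.C (PowerSeries.C ((AdjoinRoot.root D.P ^ D.t) ^ v)) *
      V.comp (Polynomial.X + Polynomial.C c) * D.sigma U, ?_, ?_⟩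
  · rw [hU, map_mul, map_mul]
    have h1 : D.sigma S.H = Polynomial.C (PowerSeries.X ^ (D.q * D.m * D.P.natDegree * D.N)) *
        (weierstrassPart D).comp (Polynomial.X + Polynomial.C c) *
          V.comp (Polynomial.X + Polynomial.C c) := by
      rw [EdgeData.sigma, hshift, pullHom_comp_X_add_C, hV]
      simp only [Polynomial.mul_comp, Polynomial.C_comp]
    have h2 : D.sigma (Polynomial.C (PowerSeries.X ^ v)) =
        Polynomial.C (PowerSeries.C ((AdjoinRoot.root D.P ^ D.t) ^ v)) *
          Polynomial.C (PowerSeries.X ^ (D.q * v)) := by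
      rw [EdgeData.sigma, pullHom_C, map_pow, scaleHom_X, mul_pow, ← pow_mul, Polynomial.C_mul,
        ← map_pow PowerSeries.C]
    rw [h1, h2, pow_add, Polynomial.C_mul]
    ring
  · have h3 : PowerSeries.constantCoeff ((D.sigma U).coeff 0) =
        algebraMap S.L (AdjoinRoot D.P) (PowerSeries.constantCoeff (U.coeff 0)) := by
      rw [← map_constantCoeff_coeff, EdgeData.sigma,
        map_constantCoeff_pullHom _ _ _ (map_constantCoeff_C_X_pow_mul hm _),
        Polynomial.coeff_C_zero]
    rw [Polynomial.mul_coeff_zero, Polynomial.mul_coeff_zero, Polynomial.coeff_C_zero, map_mul,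
      map_mul, eval_zero_comp_map V hc0, h3]
    refine mul_ne_zero (mul_ne_zero ?_ hV0) (by simpa using hU0)
    simpa using fun h => absurd h hz

theorem finrank_adjoinRoot (I : Inv F S) :
    Module.finrank K (AdjoinRoot D.P) = Module.finrank K S.L * D.P.natDegree := by
  have := I.finite
  have hP0 : D.P ≠ 0 := D.monic.ne_zero
  rw [← Module.finrank_mul_finrank K S.L (AdjoinRoot D.P), (AdjoinRoot.powerBasis hP0).finrank,
    AdjoinRoot.powerBasis_dim]

theorem deg_next (I : Inv F S) : S.e * D.q * Module.finrank K (AdjoinRoot D.P) =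
    D.q * D.P.natDegree * S.deg := by
  rw [finrank_adjoinRoot D I, Stage.deg]; ring

/-- The degree of a stage is multiplied by `q ℓ`. So `q ℓ` digits in powers of a root `χ` of the
current stage represent the polynomials of smaller degree, and one further digit those of the new
degree. -/
theorem Inv.nextStage (I : Inv F S)
    (hchar : ∀ n : ℕ, 0 < n → n ≤ F.natDegree → (n : K) ≠ 0) (D : EdgeData S.H)
    (hne : S.H ≠ Polynomial.X ^ S.H.natDegree) : Inv F (nextStage S D) := by
  have : Fact (Irreducible D.P) := ⟨D.irreducible⟩
  have := I.finite
  have hz := root_ne_zero' D I hne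
  obtain ⟨hG, hGN, -⟩ := weierstrassPart_spec D I hchar hne
  have hT := map_shift D I hchar hne
  have hNat := D.natDegree_eq I.weierstrass
  have hNpos := D.N_pos I
  have hfin' : FiniteDimensional S.L (AdjoinRoot D.P) :=
    (AdjoinRoot.powerBasis D.monic.ne_zero).finite
  have hc0 : PowerSeries.constantCoeff (tschirnhausShift (weierstrassPart D)) = 0 :=
    hG.constantCoeff_tschirnhausShift (by rw [hGN]; exact hNpos)
  obtain ⟨χ, hχ, hχd, hχ0⟩ := I.exists_root
  obtain ⟨v, u₀, hgood⟩ := I.good_of_root hχ hχd hχ0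
  rw [nextStage_eq]
  refine Inv.of_data _ _ _ _ _ (Module.Finite.trans S.L _) ?_ ?_ ?_ ?_ ?_ ?_ ?_ ?_
  · exact mul_ne_zero (by simpa using I.mu_ne_zero) (pow_ne_zero _ (pow_ne_zero _ hz))
  · rw [natDegree_comp_X_add_C, hGN, deg_next D I, ← I.deg_mul, ← hNat]; ring
  · rw [natDegree_comp_X_add_C, hGN]; exact hNpos
  · exact hG.comp_X_add_C hc0
  · rw [natDegree_comp_X_add_C]
    refine coeff_comp_tschirnhausShift hG.1 (I.degree_conditions hchar ?_ _)
    rw [hGN, ← hNat]; exact dvd_mul_left _ _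
  · rw [pullHom_sigma]
    exact sigma_F D I hchar hne
  · intro Q hQ hlt
    rw [deg_next D I] at hlt
    obtain ⟨A, hA, rfl⟩ := exists_digits hχ hχd (D.q * D.P.natDegree) Q hlt
    obtain ⟨M, p, hini, hp, -⟩ := sigma_ini D I hne hT (hgood _ _) hA hQ
    exact ⟨M, p, by rw [pullHom_sigma]; exact hini, hp⟩
  · intro Q hQ hQd hQ0
    rw [deg_next D I] at hQd
    have hlt : Q.degree < (((D.q * D.P.natDegree + 1) * S.deg : ℕ) : WithBot ℕ) := by
      rw [Polynomial.degree_eq_natDegree hQ.ne_zero, hQd, Nat.cast_lt]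
      exact Nat.mul_lt_mul_of_pos_right (Nat.lt_succ_self _) I.deg_pos
    obtain ⟨A, hA, rfl⟩ := exists_digits hχ hχd (D.q * D.P.natDegree + 1) Q hlt
    rw [pullHom_sigma] at hQ0 ⊢
    exact sigma_root D I hchar hne hT (hgood _ _) hA hQ.ne_zero hQ0

end Next

end Invariant

/-! ### Digits of `F` against coefficients of `H` on a supporting line -/

section Comparison

variable {K : Type u} [Field K] {F : K⟦X⟧[X]} {S : Stage K}

theorem Inv.exists_digits_F (I : Inv F S) (hF : F.Monic) {χ : K⟦X⟧[X]} (hχ : χ.Monic)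
    (hdeg : χ.natDegree = S.deg) : ∃ A : ℕ → K⟦X⟧[X],
      (∀ i, (A i).degree < (S.deg : WithBot ℕ)) ∧ A S.H.natDegree = 1 ∧
      F = ∑ i ∈ Finset.range (S.H.natDegree + 1), A i * χ ^ i := by
  have hlt : (F - χ ^ S.H.natDegree).degree < ((S.H.natDegree * S.deg : ℕ) : WithBot ℕ) := by
    have hd : F.degree = (χ ^ S.H.natDegree).degree := by
      rw [Polynomial.degree_eq_natDegree hF.ne_zero,
        Polynomial.degree_eq_natDegree (hχ.pow _).ne_zero, hχ.natDegree_pow, hdeg, ← I.deg_mul,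
        mul_comm]
    refine (Polynomial.degree_sub_lt_left hd hF.ne_zero ?_).trans_le ?_
    · rw [hF.leadingCoeff, (hχ.pow _).leadingCoeff]
    · rw [Polynomial.degree_eq_natDegree hF.ne_zero, ← I.deg_mul, mul_comm]
  obtain ⟨A, hA, h⟩ := exists_digits hχ hdeg _ _ hlt
  refine ⟨Function.update A S.H.natDegree 1, fun i => ?_, Function.update_self _ _ _, ?_⟩
  · by_cases hi : i = S.H.natDegree
    · subst hi
      rw [Function.update_self, Polynomial.degree_one]
      exact_mod_cast I.deg_pos
    · rw [Function.update_of_ne hi]; exact hA i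
  · rw [Finset.sum_range_succ, Function.update_self, one_mul, ← sub_eq_iff_eq_add, h]
    refine Finset.sum_congr rfl fun i hi => ?_
    rw [Function.update_of_ne (Finset.mem_range.1 hi).ne]

/-- The comparison of the digits of `F` with the coefficients of `H` along a supporting line of
the Newton polygon of `H`. -/
theorem Inv.comparison (I : Inv F S) {q m : ℕ} (hq : 0 < q) (hm : 0 < m)
    (hline : ∀ i j, PowerSeries.coeff j (S.H.coeff i) ≠ 0 → m * S.H.natDegree ≤ q * j + m * i)
    {χ : K⟦X⟧[X]} {v : ℕ} {u₀ : S.L} (hgood : Good q m (S.pb χ) v u₀) {A : ℕ → K⟦X⟧[X]}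
    (hA : ∀ i, (A i).degree < (S.deg : WithBot ℕ)) (hA1 : A S.H.natDegree = 1)
    (hF : F = ∑ i ∈ Finset.range (S.H.natDegree + 1), A i * χ ^ i) :
    (∃ p : S.L[X], p.coeff 0 ≠ 0 ∧
      Ini (S.pb F) (S.H.natDegree * v) (Polynomial.X ^ S.H.natDegree * p)) ∧
    (∀ i ≤ S.H.natDegree, A i ≠ 0 → ∀ w p, Ini (S.pb (A i)) w p → p.coeff 0 ≠ 0 →
      q * (S.H.natDegree * v) + m * S.H.natDegree ≤ q * w + i * (q * v + m)) ∧
    (∀ i ≤ S.H.natDegree, ∀ j w p, q * j + m * i = m * S.H.natDegree →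
      w + i * v = S.H.natDegree * v + j → Ini (S.pb (A i)) w p →
      p.coeff 0 * u₀ ^ i = u₀ ^ S.H.natDegree * PowerSeries.coeff j (S.H.coeff i)) := by
  classical
  set N := S.H.natDegree with hN
  obtain ⟨vF, U, hU, hU0⟩ := I.pb_F
  set U₀ := PowerSeries.constantCoeff (U.coeff 0) with hU₀
  -- The substitution `x ↦ x ^ q`, `y ↦ x ^ m y` gives `x ^ j y ^ i` the order `q j + m i`. It does
  -- not shift `y`, so the `i`-th digit contributes a multiple of `y ^ i`.
  set ρ := pullHom S.L (1 : S.L) q hq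
    (Polynomial.C (PowerSeries.X ^ m) * (Polynomial.X : S.L⟦X⟧[X])) with hρ
  have hHini : Ini S.H 0 (Polynomial.X ^ N) := by
    refine ⟨S.H, by simp, Polynomial.ext fun i => ?_⟩
    rw [map_constantCoeff_coeff, Polynomial.coeff_X_pow]
    rcases lt_trichotomy i N with h | h | h
    · rw [I.weierstrass.2 i h, if_neg h.ne]
    · rw [if_pos h, h, hN, I.weierstrass.1.coeff_natDegree, map_one]
    · rw [if_neg h.ne', Polynomial.coeff_eq_zero_of_natDegree_lt h, map_zero]
  have hUini : Ini U 0 (U.map PowerSeries.constantCoeff) := ⟨U, by simp, rfl⟩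
  have hXini : Ini (Polynomial.C ((PowerSeries.X : S.L⟦X⟧) ^ vF)) vF 1 := ⟨1, by simp, by simp⟩
  have hFini : Ini (S.pb F) vF (Polynomial.X ^ N * U.map PowerSeries.constantCoeff) := by
    rw [hU]
    exact ((hXini.mul hHini).mul hUini).cast (by simp) (by simp)
  have hT := map_constantCoeff_C_X_pow_mul hm (Polynomial.X : S.L⟦X⟧[X])
  set h : S.L[X] := ∑ i ∈ Finset.range (N + 1), Polynomial.C (if m * i ≤ m * N then
    PowerSeries.coeff (m * N - m * i) (scaleHom S.L (1 : S.L) q hq (S.H.coeff i)) else 0) *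
      Polynomial.X ^ i with hh
  have hρF : Ini (ρ (S.pb F)) (q * vF + m * N) (h * Polynomial.C U₀) := by
    have h1 := hXini.pullHom (1 : S.L) q hq hT
    have h2 := Ini.pullHom_of_line hq hline (1 : S.L) (Polynomial.X : S.L⟦X⟧[X])
    have h3 := hUini.pullHom (1 : S.L) q hq hT
    rw [hU, map_mul, map_mul]
    refine ((h1.mul h2).mul h3).cast (by simp) ?_
    simp [hh, hU₀]
    exact Or.inl rfl
  have hcoeff : ∀ i ≤ N, ∀ j, q * j + m * i = m * N →
      h.coeff i = PowerSeries.coeff j (S.H.coeff i) := by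
    intro i hi j hj
    rw [hh, Polynomial.finsetSum_coeff, Finset.sum_eq_single i]
    · rw [Polynomial.coeff_C_mul_X_pow, if_pos rfl, if_pos (by omega), coeff_scaleHom,
        show m * N - m * i = q * j by omega, if_pos (dvd_mul_right q j),
        Nat.mul_div_cancel_left _ hq]
      simp
    · intro b _ hb
      rw [Polynomial.coeff_C_mul_X_pow, if_neg (Ne.symm hb)]
    · intro hi'
      exact absurd (Finset.mem_range.2 (Nat.lt_succ_of_le hi)) hi'
  have hhN : h.coeff N = 1 := by
    rw [hcoeff N le_rfl 0 (by ring), hN, I.weierstrass.1.coeff_natDegree]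
    simp
  have hterm : ∀ i w p, Ini (S.pb (A i)) w p → Ini (ρ (S.pb (A i) * S.pb χ ^ i))
      (q * w + i * (q * v + m)) (Polynomial.C (p.coeff 0 * u₀ ^ i) * Polynomial.X ^ i) := by
    intro i w p hi
    refine (hgood.pullHom_mul_pow (1 : S.L) hq hm Polynomial.X hi i).cast rfl ?_
    simp
  have hρsum : ρ (S.pb F) = ∑ i ∈ Finset.range (N + 1), ρ (S.pb (A i) * S.pb χ ^ i) := by
    conv_lhs => rw [hF]
    rw [map_sum, map_sum]
    simp only [map_mul, map_pow]
  have hex : ∀ i, ∃ w p, Ini (S.pb (A i)) w p ∧ (A i ≠ 0 → p.coeff 0 ≠ 0) := by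
    intro i
    by_cases h0 : A i = 0
    · exact ⟨0, 0, by rw [h0, map_zero]; exact Ini.zero 0, fun h => absurd h0 h⟩
    · obtain ⟨w, p, h, h'⟩ := I.ini _ h0 (hA i)
      exact ⟨w, p, h, fun _ => h'⟩
  choose W p hini hp using hex
  set J := (Finset.range (N + 1)).filter fun i => A i ≠ 0 with hJ
  have hsumJ : ρ (S.pb F) = ∑ i ∈ J, ρ (S.pb (A i) * S.pb χ ^ i) := by
    rw [hρsum, hJ, Finset.sum_filter]
    refine Finset.sum_congr rfl fun i _ => ?_
    split_ifs with h
    · rfl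
    · rw [not_not.1 h, map_zero, zero_mul, map_zero]
  -- Terms of order below that of `F` would have to cancel, which distinct powers of `y` cannot do.
  have hle : ∀ i ∈ J, q * vF + m * N ≤ q * W i + i * (q * v + m) := by
    by_contra! hcon
    obtain ⟨i, hi, hlt⟩ := hcon
    obtain ⟨i₁, hi₁, hmin⟩ := J.exists_min_image (fun i => q * W i + i * (q * v + m)) ⟨i, hi⟩
    have hsum := Ini.sum_min J (fun i _ => hterm i _ _ (hini i)) hmin
    rw [← hsumJ] at hsum
    have h0 := hsum.unique (hρF.of_lt ((hmin i hi).trans_lt hlt))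
    have h1 := congrArg (fun r => Polynomial.coeff r i₁) h0
    simp only [Polynomial.finsetSum_coeff, Polynomial.coeff_C_mul_X_pow,
      Polynomial.coeff_zero] at h1
    rw [Finset.sum_eq_single i₁, if_pos rfl] at h1
    · exact mul_ne_zero (hp i₁ (Finset.mem_filter.1 hi₁).2) (pow_ne_zero _ hgood.1) h1
    · intro b _ hb
      rw [if_neg (Ne.symm hb)]
    · intro hn
      exact absurd (by simp [hi₁]) hn
  -- At the common order each term contributes `b y ^ i`, where `b = 0` if the term has higher order
  -- or the digit vanishes.
  have hb : ∀ i, ∃ b, i ∈ Finset.range (N + 1) →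
      Ini (ρ (S.pb (A i) * S.pb χ ^ i)) (q * vF + m * N) (Polynomial.C b * Polynomial.X ^ i) := by
    intro i
    by_cases hi : i ∈ J
    · rcases (hle i hi).eq_or_lt with h1 | h1
      · exact ⟨_, fun _ => (hterm i _ _ (hini i)).cast h1.symm rfl⟩
      · exact ⟨0, fun _ => ((hterm i _ _ (hini i)).of_lt h1).cast rfl (by simp)⟩
    · refine ⟨0, fun hi' => ?_⟩
      have : A i = 0 := by
        by_contra h0
        exact hi (Finset.mem_filter.2 ⟨hi', h0⟩)
      rw [this, map_zero, zero_mul, map_zero]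
      exact (Ini.zero _).cast rfl (by simp)
  choose b hb using hb
  have hbsum : ∀ i ≤ N, b i = h.coeff i * U₀ := by
    intro i hi
    have h1 := Ini.sum _ hb
    rw [← hρsum] at h1
    have h2 := congrArg (fun r => Polynomial.coeff r i) (h1.unique hρF)
    simp only [Polynomial.finsetSum_coeff, Polynomial.coeff_C_mul_X_pow,
      Polynomial.coeff_mul_C] at h2
    rw [← h2, Finset.sum_ite_eq, if_pos (Finset.mem_range.2 (Nat.lt_succ_of_le hi))]
  have hcancel : ∀ (i : ℕ) (a c : S.L), Polynomial.C a * Polynomial.X ^ i =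
      Polynomial.C c * Polynomial.X ^ i → a = c := by
    intro i a c hac
    have := congrArg (fun r => Polynomial.coeff r i) hac
    simpa using this
  -- The top digit `1` fixes the normalisation: comparing order and coefficient at `y ^ N` gives `vF
  -- = N v` and `U₀ = u₀ ^ N`.
  have hone : Ini (S.pb (A N)) 0 1 := by rw [hA1, map_one]; exact Ini.one
  have hN1 := hterm N 0 1 hone
  have hN2 := hb N (by simp)
  have hbN : b N ≠ 0 := by rw [hbsum N le_rfl, hhN, one_mul]; exact hU0
  have horder : q * 0 + N * (q * v + m) = q * vF + m * N := by
    refine hN1.unique_order ?_ hN2 ?_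
    · rw [Ne, mul_eq_zero, not_or]
      exact ⟨Polynomial.C_ne_zero.2 (by
        rw [Polynomial.coeff_one_zero, one_mul]; exact pow_ne_zero _ hgood.1), pow_ne_zero _ Polynomial.X_ne_zero⟩
    · rw [Ne, mul_eq_zero, not_or]
      exact ⟨by simpa using hbN, pow_ne_zero _ Polynomial.X_ne_zero⟩
  have hvF : vF = N * v := by
    have : q * vF = q * (N * v) := by
      have : q * 0 + N * (q * v + m) = q * (N * v) + m * N := by ring
      omega
    exact Nat.eq_of_mul_eq_mul_left hq this
  have hU₀' : u₀ ^ N = U₀ := by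
    have h1 := hcancel N _ _ ((hN1.cast horder rfl).unique hN2)
    rw [hbsum N le_rfl, hhN] at h1
    simpa using h1
  subst hvF
  refine ⟨⟨_, ?_, hFini⟩, ?_, ?_⟩
  · rw [map_constantCoeff_coeff]; exact hU0
  · intro i hi hAi w r hr hr0
    have h1 := hle i (Finset.mem_filter.2 ⟨Finset.mem_range.2 (Nat.lt_succ_of_le hi), hAi⟩)
    rwa [(hini i).unique_order (ne_zero_of_coeff_zero_ne_zero (hp i hAi)) hr
      (ne_zero_of_coeff_zero_ne_zero hr0)] at h1
  · intro i hi j w r hj hw hr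
    have h1 := (hterm i w r hr).cast (w' := q * (N * v) + m * N) (by
      have : q * w + i * (q * v + m) = q * (w + i * v) + m * i := by ring
      rw [this, hw, ← hj]; ring) rfl
    have h2 := hcancel i _ _ (h1.unique (hb i (Finset.mem_range.2 (Nat.lt_succ_of_le hi))))
    rw [h2, hbsum i hi, hcoeff i hi j hj, hU₀', mul_comm]

/-- Write `R = x ^ w B`. The part `B(x, 0)` is absorbed into `θ`, whose order stays above `m / q`
because `w - v > m / q`. The rest changes `u` by a multiple of a positive power of `x`. -/
theorem Good.add_ini {L : Type u} [Field L] {q m : ℕ} {Q R : L⟦X⟧[X]} {v w : ℕ} {u₀ : L} {p : L[X]}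
    (h : Good q m Q v u₀) (hR : Ini R w p) (hw : q * v + m < q * w) : Good q m (Q + R) v u₀ := by
  obtain ⟨h0, θ, u, rfl, hu, hθ⟩ := h
  obtain ⟨B, rfl, -⟩ := hR
  have hvw : v < w := by
    by_contra! hle
    have := Nat.mul_le_mul_left q hle
    omega
  obtain ⟨e, rfl⟩ := Nat.exists_eq_add_of_le hvw.le
  have he : m < q * e := by rw [Nat.mul_add] at hw; omega
  have he0 : e ≠ 0 := by rintro rfl; omega
  refine ⟨h0, θ + PowerSeries.X ^ e * B.coeff 0, u + Polynomial.C (PowerSeries.X ^ e) * B.divX,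
    ?_, ?_, fun j hj => ?_⟩
  · conv_lhs => rw [← Polynomial.divX_mul_X_add B]
    rw [pow_add, Polynomial.C_mul, Polynomial.C_add, Polynomial.C_mul]
    ring
  · rw [Polynomial.coeff_add, Polynomial.coeff_C_mul, map_add, hu, map_mul, map_pow,
      PowerSeries.constantCoeff_X, zero_pow he0, zero_mul, add_zero]
  · have hje : j < e := Nat.lt_of_mul_lt_mul_left (hj.trans_lt he)
    rw [map_add, hθ j hj, PowerSeries.coeff_X_pow_mul', if_neg (by omega), add_zero]

/-- If `F` is square-free, then `H` is not a power of `y`, unless it is `y`. -/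
theorem Inv.ne_X_pow (I : Inv F S) (hF : F.Monic) (hsq : Squarefree F) (hN : S.H.natDegree ≠ 1) :
    S.H ≠ Polynomial.X ^ S.H.natDegree := by
  intro hH
  obtain ⟨χ, hχ, hχd, hχ0⟩ := I.exists_root
  obtain ⟨v, u₀, hgood⟩ := I.good_of_root hχ hχd hχ0
  obtain ⟨A, hA, hA1, hFA⟩ := I.exists_digits_F hF hχ hχd
  have hzero : ∀ i < S.H.natDegree, A i = 0 := by
    intro i hi
    by_contra h0
    obtain ⟨w, p, hp, hp0⟩ := I.ini _ h0 (hA i)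
    -- If `H = y ^ N`, every slope gives a supporting line. One steeper than the order of the digit
    -- contradicts the comparison, so all digits but the top one vanish and `F = χ ^ N`.
    have hcomp := (I.comparison (q := 1) (m := w + i * v + 1) one_pos (Nat.succ_pos _) ?_
      (hgood _ _) hA hA1 hFA).2.1 i hi.le h0 w p hp hp0
    · obtain ⟨k, hk⟩ := Nat.exists_eq_add_of_lt hi
      rw [hk] at hcomp
      set M := w + i * v + 1 with hM
      have h1 : M ≤ M * (k + 1) := Nat.le_mul_of_pos_right _ (Nat.succ_pos _)
      have h2 : M * (i + k + 1) = i * M + M * (k + 1) := by ring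
      have h3 : i * (1 * v + M) = i * v + i * M := by ring
      have h4 : 1 * ((i + k + 1) * v) = i * v + (k + 1) * v := by ring
      omega
    · intro i' j hij
      have : i' = S.H.natDegree := by
        by_contra hne
        rw [hH, Polynomial.coeff_X_pow, if_neg hne] at hij
        simp at hij
      rw [this]
      exact Nat.le_add_left _ _
  have hFχ : F = χ ^ S.H.natDegree := by
    rw [Finset.sum_range_succ, hA1, one_mul, Finset.sum_eq_zero, zero_add] at hFA
    · exact hFA
    · intro i hi
      rw [hzero i (Finset.mem_range.1 hi), zero_mul]
  have h2 : χ * χ ∣ F := by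
    rw [hFχ, ← pow_two]
    exact pow_dvd_pow _ (by have := I.natDegree_pos; omega)
  have h3 := hχ.eq_one_of_isUnit (hsq χ h2)
  rw [h3, Polynomial.natDegree_one] at hχd
  exact I.deg_pos.ne hχd

end Comparison

/-! ### From roots to approximate roots -/

section ApproximateRoot

variable {K : Type u} [Field K] {F : K⟦X⟧[X]} {S : Stage K}

/-- The remaining binomial terms contain `δ` at least twice; trading a factor `χ` for `δ` loses
degree since `k < d`. -/
theorem degree_add_pow_sub_lt {R : Type*} [CommRing R] [IsDomain R] {χ δ : R[X]} {d k : ℕ}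
    (hχ : χ.natDegree = d) (hδ : δ.natDegree ≤ k) (hkd : k < d) (n : ℕ) :
    ((χ + δ) ^ (n + 1) - χ ^ (n + 1) - (n + 1 : R[X]) * (δ * χ ^ n)).degree <
      ((n * d + k : ℕ) : WithBot ℕ) := by
  rw [add_pow, Finset.sum_range_succ, Finset.sum_range_succ]
  have h1 : ∑ i ∈ Finset.range n, χ ^ i * δ ^ (n + 1 - i) * ((n + 1).choose i : R[X]) +
      χ ^ n * δ ^ (n + 1 - n) * ((n + 1).choose n : R[X]) +
      χ ^ (n + 1) * δ ^ (n + 1 - (n + 1)) * ((n + 1).choose (n + 1) : R[X]) - χ ^ (n + 1) -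
      (n + 1 : R[X]) * (δ * χ ^ n) =
      ∑ i ∈ Finset.range n, χ ^ i * δ ^ (n + 1 - i) * ((n + 1).choose i : R[X]) := by
    rw [Nat.add_sub_cancel_left, Nat.sub_self, Nat.choose_self, Nat.choose_succ_self_right]
    push_cast
    ring
  rw [h1]
  refine (Polynomial.degree_sum_le _ _).trans_lt ?_
  refine (Finset.sup_lt_iff (WithBot.bot_lt_coe _)).2 fun i hi => ?_
  have hi' : i < n := Finset.mem_range.1 hi
  refine Polynomial.degree_le_natDegree.trans_lt ?_
  rw [Nat.cast_lt]
  calc _ ≤ (χ ^ i * δ ^ (n + 1 - i)).natDegree + ((n + 1).choose i : R[X]).natDegree :=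
        Polynomial.natDegree_mul_le
    _ ≤ (χ ^ i).natDegree + (δ ^ (n + 1 - i)).natDegree + 0 := by
        rw [Polynomial.natDegree_natCast]
        exact Nat.add_le_add_right Polynomial.natDegree_mul_le _
    _ ≤ i * d + (n + 1 - i) * k := by
        rw [Polynomial.natDegree_pow, Polynomial.natDegree_pow, hχ, add_zero]
        exact Nat.add_le_add_left (Nat.mul_le_mul_left _ hδ) _
    _ < n * d + k := by
        obtain ⟨c, rfl⟩ := Nat.exists_eq_add_of_lt hi'
        rw [show i + c + 1 + 1 - i = c + 2 by omega]
        nlinarith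

theorem Inv.natDegree_div (I : Inv F S) : F.natDegree / S.H.natDegree = S.deg := by
  rw [← I.deg_mul, Nat.mul_div_cancel _ I.natDegree_pos]

theorem Inv.natDegree_sub_div (I : Inv F S) :
    F.natDegree - F.natDegree / S.H.natDegree = (S.H.natDegree - 1) * S.deg := by
  rw [I.natDegree_div, ← I.deg_mul, Nat.sub_mul, one_mul, mul_comm]

/-- The Tschirnhaus process: an element close to a root can be changed into the approximate root,
which is just as close. -/
theorem Inv.exists_approxRoot_of_good (I : Inv F S) (hF : F.Monic)
    (hchar : ∀ n : ℕ, 0 < n → n ≤ F.natDegree → (n : K) ≠ 0) {q m : ℕ} (hq : 0 < q) (hm : 0 < m)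
    (hline : ∀ i j, PowerSeries.coeff j (S.H.coeff i) ≠ 0 → m * S.H.natDegree ≤ q * j + m * i)
    {v : ℕ} {u₀ : S.L} (k : ℕ) : ∀ χ : K⟦X⟧[X], k ≤ S.deg → χ.Monic → χ.natDegree = S.deg →
      Good q m (S.pb χ) v u₀ →
      (F - χ ^ S.H.natDegree).degree < (((S.H.natDegree - 1) * S.deg + k : ℕ) : WithBot ℕ) →
      ∃ ψ, IsApproxRoot F S.H.natDegree ψ ∧ Good q m (S.pb ψ) v u₀ := by
  obtain ⟨n, hn⟩ : ∃ n, S.H.natDegree = n + 1 := ⟨_, (Nat.sub_add_cancel I.natDegree_pos).symm⟩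
  induction k with
  | zero =>
    intro χ _ hχ hχd hgood hlt
    refine ⟨χ, ⟨hχ, by rw [hχd, I.natDegree_div], ?_⟩, hgood⟩
    rw [I.natDegree_sub_div]; exact hlt
  | succ k ih =>
    intro χ hk hχ hχd hgood hlt
    obtain ⟨A, hA, hA1, hFA⟩ := I.exists_digits_F hF hχ hχd
    obtain ⟨-, hc2, hc3⟩ := I.comparison hq hm hline hgood hA hA1 hFA
    rw [hn] at hA1 hFA hlt hc2 hc3
    rw [Nat.add_sub_cancel] at hlt
    have hsplit : F - χ ^ (n + 1) = ∑ i ∈ Finset.range n, A i * χ ^ i + A n * χ ^ n := by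
      conv_lhs => rw [hFA, Finset.sum_range_succ, Finset.sum_range_succ, hA1]
      ring
    have hrest := degree_digits_lt hχ hχd n hA
    -- The digit `A n = A_(N-1)` carries the top part of `F - χ ^ N`, so the bound on that
    -- difference bounds its degree.
    have hAn : (A n).natDegree ≤ k := by
      rcases eq_or_ne (A n) 0 with h0 | h0
      · rw [h0, Polynomial.natDegree_zero]; exact Nat.zero_le _
      · have h1 : (A n * χ ^ n).degree < ((n * S.deg + (k + 1) : ℕ) : WithBot ℕ) := by
          rw [show A n * χ ^ n = (F - χ ^ (n + 1)) - ∑ i ∈ Finset.range n, A i * χ ^ i by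
            rw [hsplit]; ring]
          refine (Polynomial.degree_sub_le _ _).trans_lt (max_lt hlt (hrest.trans_le ?_))
          exact_mod_cast Nat.le_add_right _ _
        rw [(hχ.pow n).degree_mul, Polynomial.degree_eq_natDegree h0,
          Polynomial.degree_eq_natDegree (hχ.pow n).ne_zero, hχ.natDegree_pow, hχd] at h1
        have h2 : (A n).natDegree + n * S.deg < n * S.deg + (k + 1) := by exact_mod_cast h1
        omega
    have hcast : ((n + 1 : ℕ) : K) ≠ 0 := by
      refine hchar _ (Nat.succ_pos _) ?_
      rw [← I.deg_mul, hn]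
      exact Nat.le_mul_of_pos_left _ I.deg_pos
    set a : K⟦X⟧ := PowerSeries.C ((n + 1 : ℕ) : K)⁻¹ with ha
    set δ := Polynomial.C a * A n with hδ
    have hδn : ((n : K⟦X⟧[X]) + 1) * δ = A n := by
      have : ((n : K⟦X⟧[X]) + 1) = Polynomial.C (PowerSeries.C ((n + 1 : ℕ) : K)) := by simp
      rw [hδ, ← mul_assoc, this, ← Polynomial.C_mul, ha, ← map_mul, mul_inv_cancel₀ hcast]
      simp
    have hδdeg : δ.natDegree ≤ k := (Polynomial.natDegree_C_mul_le _ _).trans hAn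
    have hδlt : δ.degree < χ.degree := by
      rw [Polynomial.degree_eq_natDegree hχ.ne_zero, hχd]
      refine Polynomial.degree_le_natDegree.trans_lt ?_
      exact_mod_cast (by omega : δ.natDegree < S.deg)
    have hχ' : (χ + δ).Monic := hχ.add_of_left hδlt
    have hgood' : Good q m (S.pb (χ + δ)) v u₀ := by
      rcases eq_or_ne (A n) 0 with h0 | h0
      · rw [hδ, h0, mul_zero, add_zero]; exact hgood
      · obtain ⟨w, p, hp, hp0⟩ := I.ini _ h0 (hA n)
        have hle := hc2 n (Nat.le_succ n) h0 w p hp hp0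
        have hlt' : q * v + m < q * w := by
          have h1 : q * v + m ≤ q * w := by
            have : q * ((n + 1) * v) + m * (n + 1) = n * (q * v + m) + (q * v + m) := by ring
            omega
          -- Equality would put the digit on the line. Its leading coefficient would then be, up to
          -- a nonzero factor, a coefficient of `y ^ (N - 1)` in `H`, and these all vanish.
          refine lt_of_le_of_ne h1 fun heq => ?_
          have hvw : v ≤ w := Nat.le_of_mul_le_mul_left (by omega : q * v ≤ q * w) hq
          obtain ⟨j, rfl⟩ := Nat.exists_eq_add_of_le hvw
          have hj : q * j = m := by rw [Nat.mul_add] at heq; omega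
          have h2 := hc3 n (Nat.le_succ n) j (v + j) p (by rw [hj]; ring) (by ring) hp
          have h3 := I.tschirnhaus
          rw [hn, Nat.add_sub_cancel] at h3
          rw [h3, map_zero, mul_zero] at h2
          exact mul_ne_zero hp0 (pow_ne_zero _ hgood.1) h2
        rw [map_add]
        have hδini : Ini (S.pb δ) w (Polynomial.C (algebraMap K S.L ((n + 1 : ℕ) : K)⁻¹) * p) := by
          rw [hδ, map_mul]
          have : Ini (S.pb (Polynomial.C a)) 0
              (Polynomial.C (algebraMap K S.L ((n + 1 : ℕ) : K)⁻¹)) := by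
            rw [Stage.pb, pullHom_C, ha, scaleHom_C]
            exact ⟨Polynomial.C (PowerSeries.C (algebraMap K S.L ((n + 1 : ℕ) : K)⁻¹)),
              by rw [pow_zero, Polynomial.C_1, one_mul],
              by rw [Polynomial.map_C, PowerSeries.constantCoeff_C]⟩
          exact (this.mul hp).cast (zero_add w) rfl
        exact hgood.add_ini hδini hlt'
    refine ih (χ + δ) (by omega) hχ' ?_ hgood' ?_
    · rw [Polynomial.natDegree_add_eq_left_of_degree_lt hδlt, hχd]
    · rw [hn, Nat.add_sub_cancel]
      have h1 := degree_add_pow_sub_lt hχd hδdeg (by omega : k < S.deg) n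
      -- As `N δ = A_(N-1)`, the linear term of the binomial expansion cancels that digit, and the
      -- degree bound drops by one.
      have h2 : F - (χ + δ) ^ (n + 1) = ∑ i ∈ Finset.range n, A i * χ ^ i -
          ((χ + δ) ^ (n + 1) - χ ^ (n + 1) - ((n : K⟦X⟧[X]) + 1) * (δ * χ ^ n)) := by
        rw [← mul_assoc, hδn, show F = F - χ ^ (n + 1) + χ ^ (n + 1) by ring, hsplit]
        ring
      rw [h2]
      refine (Polynomial.degree_sub_le _ _).trans_lt (max_lt (hrest.trans_le ?_) h1)
      exact_mod_cast Nat.le_add_right _ _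

/-- In `ψ ^ N - ψ' ^ N = (∑ ψ ^ i ψ' ^ (N-1-i)) (ψ - ψ')` the first factor has coefficient `N ≠ 0`
in degree `(N - 1) deg`. The product has smaller degree only if `ψ = ψ'`. -/
theorem Inv.approxRoot_unique (I : Inv F S)
    (hchar : ∀ n : ℕ, 0 < n → n ≤ F.natDegree → (n : K) ≠ 0) {ψ ψ' : K⟦X⟧[X]}
    (h : IsApproxRoot F S.H.natDegree ψ) (h' : IsApproxRoot F S.H.natDegree ψ') : ψ = ψ' := by
  by_contra hne
  obtain ⟨hm, hd, hlt⟩ := h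
  obtain ⟨hm', hd', hlt'⟩ := h'
  rw [I.natDegree_sub_div] at hlt hlt'
  rw [I.natDegree_div] at hd hd'
  set N := S.H.natDegree with hN
  have h1 : (ψ ^ N - ψ' ^ N).degree < (((N - 1) * S.deg : ℕ) : WithBot ℕ) := by
    rw [show ψ ^ N - ψ' ^ N = (F - ψ' ^ N) - (F - ψ ^ N) by ring]
    exact (Polynomial.degree_sub_le _ _).trans_lt (max_lt hlt' hlt)
  rw [← (Commute.all ψ ψ').geom_sum₂_mul, Polynomial.degree_mul] at h1
  set G := ∑ i ∈ Finset.range N, ψ ^ i * ψ' ^ (N - 1 - i) with hG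
  have hcoeff : G.coeff ((N - 1) * S.deg) = N := by
    rw [hG, Polynomial.finsetSum_coeff]
    rw [Finset.sum_congr rfl (g := fun _ => (1 : K⟦X⟧))]
    · simp
    · intro i hi
      have hi' : i < N := Finset.mem_range.1 hi
      have hmon : (ψ ^ i * ψ' ^ (N - 1 - i)).Monic := (hm.pow i).mul (hm'.pow _)
      have hdeg : (ψ ^ i * ψ' ^ (N - 1 - i)).natDegree = (N - 1) * S.deg := by
        rw [(hm.pow i).natDegree_mul (hm'.pow _), hm.natDegree_pow, hm'.natDegree_pow, hd, hd',
          ← add_mul]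
        congr 1
        omega
      rw [← hdeg, hmon.coeff_natDegree]
  have hcast : ((N : ℕ) : K⟦X⟧) ≠ 0 := by
    rw [← map_natCast (PowerSeries.C (R := K)), Ne, map_eq_zero_iff _ PowerSeries.C_injective]
    refine hchar N I.natDegree_pos ?_
    rw [← I.deg_mul]
    exact Nat.le_mul_of_pos_left _ I.deg_pos
  have h2 : (((N - 1) * S.deg : ℕ) : WithBot ℕ) ≤ G.degree :=
    Polynomial.le_degree_of_ne_zero (by rw [hcoeff]; exact hcast)
  have h3 : 0 ≤ (ψ - ψ').degree := Polynomial.zero_le_degree_iff.2 (sub_ne_zero.2 hne)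
  exact absurd h1 (not_lt.2 (h2.trans (le_add_of_nonneg_right h3)))

/-- The approximate root exists, and it is as close to `π(x, 0)` as every supporting line of the
Newton polygon of `H` requires. -/
theorem Inv.good_approxRoot (I : Inv F S) (hF : F.Monic)
    (hchar : ∀ n : ℕ, 0 < n → n ≤ F.natDegree → (n : K) ≠ 0) {q m : ℕ} (hq : 0 < q) (hm : 0 < m)
    (hline : ∀ i j, PowerSeries.coeff j (S.H.coeff i) ≠ 0 → m * S.H.natDegree ≤ q * j + m * i)
    {v : ℕ} {u₀ : S.L} {χ : K⟦X⟧[X]} (hχ : χ.Monic) (hχd : χ.natDegree = S.deg)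
    (hgood : Good q m (S.pb χ) v u₀) :
    ∃ ψ, IsApproxRoot F S.H.natDegree ψ ∧ Good q m (S.pb ψ) v u₀ := by
  refine I.exists_approxRoot_of_good hF hchar hq hm hline S.deg χ le_rfl hχ hχd hgood ?_
  have h1 : (S.H.natDegree - 1) * S.deg + S.deg = S.H.natDegree * S.deg := by
    obtain ⟨n, hn⟩ : ∃ n, S.H.natDegree = n + 1 := ⟨_, (Nat.sub_add_cancel I.natDegree_pos).symm⟩
    rw [hn, Nat.add_sub_cancel]; ring
  rw [h1]
  have hd : F.degree = (χ ^ S.H.natDegree).degree := by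
    rw [Polynomial.degree_eq_natDegree hF.ne_zero,
      Polynomial.degree_eq_natDegree (hχ.pow _).ne_zero, hχ.natDegree_pow, hχd, ← I.deg_mul,
      mul_comm]
  refine (Polynomial.degree_sub_lt_left hd hF.ne_zero ?_).trans_le ?_
  · rw [hF.leadingCoeff, (hχ.pow _).leadingCoeff]
  · rw [Polynomial.degree_eq_natDegree hF.ne_zero, ← I.deg_mul, mul_comm]

end ApproximateRoot

/-! ### The sequence of stages and its termination -/

section Sequence

variable {K : Type u} [Field K] {F : K⟦X⟧[X]}

/-- The hypotheses on `F` under which the algorithm is run. -/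
structure Admissible (F : K⟦X⟧[X]) : Prop where
  weierstrass : IsWeierstrass F
  natDegree_pos : 0 < F.natDegree
  squarefree : Squarefree F
  cast_ne_zero : ∀ n : ℕ, 0 < n → n ≤ F.natDegree → (n : K) ≠ 0

theorem stage_succ {k : ℕ} (h : IsDegenerated (stage F k).H) :
    stage F (k + 1) = nextStage (stage F k) h.some := by
  rw [stage, dif_pos h]

theorem isDegenerated_of_not_stops {k : ℕ} (h : ¬ Stops F k) : IsDegenerated (stage F k).H :=
  not_not.1 (not_or.1 h).2

theorem Admissible.ne_X_pow (hF : Admissible F) {k : ℕ} (I : Inv F (stage F k))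
    (h : ¬ Stops F k) : (stage F k).H ≠ Polynomial.X ^ (stage F k).H.natDegree :=
  I.ne_X_pow hF.weierstrass.1 hF.squarefree (not_or.1 h).1

theorem Admissible.inv (hF : Admissible F) : ∀ k, (∀ j < k, ¬ Stops F j) → Inv F (stage F k)
  | 0, _ => Inv.initial hF.weierstrass hF.natDegree_pos
      (hF.cast_ne_zero _ hF.natDegree_pos le_rfl)
  | k + 1, h => by
    have I := hF.inv k fun j hj => h j (hj.trans (Nat.lt_succ_self k))
    have hk := h k (Nat.lt_succ_self k)
    rw [stage_succ (isDegenerated_of_not_stops hk)]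
    exact I.nextStage hF.cast_ne_zero _ (hF.ne_X_pow I hk)

theorem qell_eq {k : ℕ} (h : IsDegenerated (stage F k).H) :
    qell F k = h.some.q * h.some.P.natDegree := by
  rw [qell, dif_pos h]

theorem Stage.deg_nextStage {S : Stage K} (I : Inv F S) (D : EdgeData S.H) :
    (nextStage S D).deg = D.q * D.P.natDegree * S.deg := by
  have : Fact (Irreducible D.P) := ⟨D.irreducible⟩
  exact deg_next D I

theorem Admissible.deg_succ (hF : Admissible F) {k : ℕ} (h : ∀ j < k + 1, ¬ Stops F j) :
    (stage F (k + 1)).deg = qell F k * (stage F k).deg := by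
  have I := hF.inv k fun j hj => h j (hj.trans (Nat.lt_succ_self k))
  have hk := isDegenerated_of_not_stops (h k (Nat.lt_succ_self k))
  rw [stage_succ hk, Stage.deg_nextStage I, qell_eq hk]

theorem Admissible.one_lt_qell (hF : Admissible F) {k : ℕ} (h : ∀ j < k + 1, ¬ Stops F j) :
    1 < qell F k := by
  have I := hF.inv k fun j hj => h j (hj.trans (Nat.lt_succ_self k))
  have hk := h k (Nat.lt_succ_self k)
  rw [qell_eq (isDegenerated_of_not_stops hk)]
  exact EdgeData.one_lt_q_mul_natDegree _ I.weierstrass (hF.ne_X_pow I hk)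
    (I.degree_conditions hF.cast_ne_zero dvd_rfl _) I.tschirnhaus

/-- The algorithm stops. -/
theorem Admissible.exists_stops (hF : Admissible F) : ∃ k, Stops F k := by
  by_contra! h
  -- The degree of a stage divides `d`, but it would grow strictly at each step because `q ℓ > 1`.
  have hlt : ∀ k, k < (stage F k).deg := by
    intro k
    induction k with
    | zero => exact (hF.inv 0 fun j _ => h j).deg_pos
    | succ k ih =>
      rw [hF.deg_succ fun j _ => h j]
      have := hF.one_lt_qell (k := k) fun j _ => h j
      nlinarith
  have I := hF.inv F.natDegree fun j _ => h j
  have h1 := hlt F.natDegree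
  have h2 : (stage F F.natDegree).deg ≤ F.natDegree := by
    conv_rhs => rw [← I.deg_mul]
    exact Nat.le_mul_of_pos_right _ I.natDegree_pos
  omega

end Sequence

/-! ### Minimal polynomials and approximate roots have the same initial forms -/

section KeyPolynomials

variable {K : Type u} [Field K] {F : K⟦X⟧[X]}

/-- Points with `i < N` have `j ≥ 1`, so the line of slope `-1/N` through `(N, 0)` supports every
Weierstrass polynomial. This line suffices for the existence of the approximate root. -/
theorem IsWeierstrass.exists_line {L : Type u} [Field L] {H : L⟦X⟧[X]} (hH : IsWeierstrass H) :
    ∀ i j, PowerSeries.coeff j (H.coeff i) ≠ 0 →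
      1 * H.natDegree ≤ H.natDegree * j + 1 * i := by
  intro i j h
  rcases Nat.eq_zero_or_pos j with rfl | hj
  · by_contra! hlt
    refine h ?_
    rw [PowerSeries.coeff_zero_eq_constantCoeff_apply, hH.2 i (by omega)]
  · have := Nat.le_mul_of_pos_right H.natDegree hj
    omega

/-- A monic polynomial of degree less than `deg` pulls back to a power of `x` times a polynomial
that is nonzero at the origin, so it does not vanish at `π(x, 0)`. A product of two such factors
does not either. -/
theorem Inv.irreducible_of_root {S : Stage K} (I : Inv F S) {χ : K⟦X⟧[X]} (hχ : χ.Monic)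
    (hdeg : χ.natDegree = S.deg) (h0 : (S.pb χ).coeff 0 = 0) : Irreducible χ := by
  have key : ∀ f : K⟦X⟧[X], f.Monic → f.natDegree < S.deg → (S.pb f).coeff 0 ≠ 0 := by
    intro f hf hlt h
    obtain ⟨w, p, hp, hp0⟩ := I.ini f hf.ne_zero (by
      rw [Polynomial.degree_eq_natDegree hf.ne_zero]; exact_mod_cast hlt)
    rw [← (hp.exists_map_coeff 0).2, h, map_zero] at hp0
    exact hp0 rfl
  refine (hχ.irreducible_iff_natDegree).2 ⟨?_, fun f g hf hg hfg => ?_⟩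
  · rintro rfl
    rw [Polynomial.natDegree_one] at hdeg
    exact I.deg_pos.ne hdeg
  · have hsum : f.natDegree + g.natDegree = S.deg := by rw [← hf.natDegree_mul hg, hfg, hdeg]
    rw [← hfg, map_mul, Polynomial.mul_coeff_zero, mul_eq_zero] at h0
    by_contra! hne
    rcases h0 with h | h
    · exact key f hf (by omega) h
    · exact key g hg (by omega) h

theorem Inv.isMinimalPoly {k : ℕ} (I : Inv F (stage F k)) :
    IsMinimalPoly F k (minimalPoly F k) := by
  obtain ⟨χ, hχ, hd, h0⟩ := I.exists_root
  have : IsMinimalPoly F k χ :=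
    ⟨hχ, I.irreducible_of_root hχ hd h0, hd, by rw [← Stage.coeff_zero_pb]; exact h0⟩
  exact Classical.epsilon_spec (p := IsMinimalPoly F k) ⟨χ, this⟩

theorem Admissible.isApproxRoot (hF : Admissible F) {k : ℕ} (I : Inv F (stage F k)) :
    IsApproxRoot F (degN F k) (approxRoot F k) := by
  obtain ⟨χ, hχ, hd, h0⟩ := I.exists_root
  obtain ⟨v, u₀, hgood⟩ := I.good_of_root hχ hd h0
  obtain ⟨ψ, hψ, -⟩ := I.good_approxRoot hF.weierstrass.1 hF.cast_ne_zero I.natDegree_pos one_pos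
    I.weierstrass.exists_line hχ hd (hgood _ _)
  exact Classical.epsilon_spec (p := IsApproxRoot F (degN F k)) ⟨ψ, hψ⟩

theorem Admissible.approxRoot_monic (hF : Admissible F) {k : ℕ} (I : Inv F (stage F k)) :
    (approxRoot F k).Monic := (hF.isApproxRoot I).1

theorem Admissible.natDegree_approxRoot (hF : Admissible F) {k : ℕ} (I : Inv F (stage F k)) :
    (approxRoot F k).natDegree = (stage F k).deg :=
  (hF.isApproxRoot I).2.1.trans I.natDegree_div

/-- The approximate root and the minimal polynomial have the same initial terms. -/
theorem Admissible.exists_good (hF : Admissible F) {k : ℕ} (I : Inv F (stage F k)) {q m : ℕ}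
    (hq : 0 < q) (hm : 0 < m) (hline : ∀ i j, PowerSeries.coeff j ((stage F k).H.coeff i) ≠ 0 →
      m * (stage F k).H.natDegree ≤ q * j + m * i) :
    ∃ v u₀, Good q m ((stage F k).pb (approxRoot F k)) v u₀ ∧
      Good q m ((stage F k).pb (minimalPoly F k)) v u₀ := by
  obtain ⟨hφ, -, hd, h0⟩ := I.isMinimalPoly
  rw [← Stage.coeff_zero_pb] at h0
  obtain ⟨v, u₀, hgood⟩ := I.good_of_root hφ hd h0
  obtain ⟨ψ, hψ, hψg⟩ := I.good_approxRoot hF.weierstrass.1 hF.cast_ne_zero hq hm hline hφ hd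
    (hgood _ _)
  refine ⟨v, u₀, ?_, hgood _ _⟩
  rwa [I.approxRoot_unique hF.cast_ne_zero (hF.isApproxRoot I) hψ]

/-- The pull-backs of `Q` and `Q'` have the same valuation, and initial forms with the same
nonzero constant coefficient. -/
def SameIni (S : Stage K) (Q Q' : K⟦X⟧[X]) : Prop :=
  ∃ w p, p.coeff 0 ≠ 0 ∧ Ini (S.pb Q) w p ∧ Ini (S.pb Q') w p

theorem pb_nextStage (S : Stage K) (D : EdgeData S.H) [Fact (Irreducible D.P)] (Q : K⟦X⟧[X]) :
    (nextStage S D).pb Q = D.sigma (S.pb Q) := pullHom_sigma S D Q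

theorem ini_nextStage {S : Stage K} (I : Inv F S) (D : EdgeData S.H) [Fact (Irreducible D.P)]
    (hne : S.H ≠ Polynomial.X ^ S.H.natDegree) {Q : K⟦X⟧[X]} {w : ℕ} {p : S.L[X]}
    (h : Ini (S.pb Q) w p) : Ini (D.sigma (S.pb Q)) (D.q * w)
      (Polynomial.C ((AdjoinRoot.root D.P ^ D.t) ^ w * algebraMap _ _ (p.coeff 0))) :=
  h.pullHom _ _ _ (map_constantCoeff_C_X_pow_mul (D.m_pos I.weierstrass hne) _)

theorem coeff_zero_ini_nextStage_ne_zero {S : Stage K} (I : Inv F S) (D : EdgeData S.H)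
    [Fact (Irreducible D.P)] (hne : S.H ≠ Polynomial.X ^ S.H.natDegree) (w : ℕ) {a : S.L}
    (ha : a ≠ 0) : (Polynomial.C ((AdjoinRoot.root D.P ^ D.t) ^ w *
      algebraMap _ (AdjoinRoot D.P) a)).coeff 0 ≠ 0 := by
  rw [Polynomial.coeff_C_zero]
  exact mul_ne_zero (pow_ne_zero _ (pow_ne_zero _ (root_ne_zero' D I hne))) (by simpa using ha)

theorem SameIni.nextStage {S : Stage K} (I : Inv F S) (D : EdgeData S.H)
    (hne : S.H ≠ Polynomial.X ^ S.H.natDegree) {Q Q' : K⟦X⟧[X]} (h : SameIni S Q Q') :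
    SameIni (nextStage S D) Q Q' := by
  have : Fact (Irreducible D.P) := ⟨D.irreducible⟩
  obtain ⟨w, p, hp, h1, h2⟩ := h
  exact ⟨_, _, coeff_zero_ini_nextStage_ne_zero I D hne w hp,
    by rw [pb_nextStage]; exact ini_nextStage I D hne h1,
    by rw [pb_nextStage]; exact ini_nextStage I D hne h2⟩

/-- The polynomial `p` depends on `v` and `u₀` only, so all good elements with the same data acquire
the same initial form at the next stage. -/
theorem good_ini_nextStage {S : Stage K} (I : Inv F S)
    (hchar : ∀ n : ℕ, 0 < n → n ≤ F.natDegree → (n : K) ≠ 0) (D : EdgeData S.H)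
    [Fact (Irreducible D.P)] (hne : S.H ≠ Polynomial.X ^ S.H.natDegree) {v : ℕ} {u₀ : S.L} :
    ∃ p : (AdjoinRoot D.P)[X], (u₀ ≠ 0 → p.coeff 0 ≠ 0) ∧
      ∀ Q : K⟦X⟧[X], Good D.q D.m (S.pb Q) v u₀ → Ini (D.sigma (S.pb Q)) (D.q * v + D.m) p := by
  refine ⟨_, ?_, fun Q hQ => hQ.pullHom _ D.q_pos (D.m_pos I.weierstrass hne) D.shift⟩
  intro hu
  have hz := root_ne_zero' D I hne
  rw [map_shift D I hchar hne, Polynomial.coeff_C_mul]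
  refine mul_ne_zero (mul_ne_zero (pow_ne_zero _ (pow_ne_zero _ hz)) (by simpa using hu)) ?_
  rw [Polynomial.coeff_add, Polynomial.coeff_X_zero, zero_add, Polynomial.coeff_C_zero]
  exact pow_ne_zero _ hz

/-- Closeness at stage `i` becomes equality of initial forms at stage `i + 1`. Later stages preserve
it, because the new initial form is determined by the order and the constant term of the old one. -/
theorem Admissible.sameIni (hF : Admissible F) {k : ℕ} (h : ∀ j < k, ¬ Stops F j) {i : ℕ}
    (hi : i < k) : SameIni (stage F k) (approxRoot F i) (minimalPoly F i) := by
  induction k with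
  | zero => omega
  | succ k ih =>
    have h' : ∀ j < k, ¬ Stops F j := fun j hj => h j (hj.trans (Nat.lt_succ_self k))
    have I := hF.inv k h'
    have hk := h k (Nat.lt_succ_self k)
    have hne := hF.ne_X_pow I hk
    have hdeg := isDegenerated_of_not_stops hk
    rw [stage_succ hdeg]
    rcases (Nat.lt_succ_iff.1 hi).lt_or_eq with hik | rfl
    · exact (ih h' hik).nextStage I _ hne
    · have : Fact (Irreducible hdeg.some.P) := ⟨hdeg.some.irreducible⟩
      obtain ⟨v, u₀, h1, h2⟩ := hF.exists_good I hdeg.some.q_pos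
        (hdeg.some.m_pos I.weierstrass hne)
        (fun i j hij => hdeg.some.mul_natDegree_le_of_coeff I.weierstrass hij)
      obtain ⟨p, hp, hini⟩ := good_ini_nextStage I hF.cast_ne_zero hdeg.some hne (v := v)
        (u₀ := u₀)
      exact ⟨_, p, hp h1.1, by rw [pb_nextStage]; exact hini _ h1,
        by rw [pb_nextStage]; exact hini _ h2⟩

end KeyPolynomials

/-! ### Expansions with bounded exponents -/

section Box

/-- The exponents `(b_0, …, b_(n-1))` with `b_i < β_i`. -/
def box (β : ℕ → ℕ) (n : ℕ) : Finset (Fin n → ℕ) := Fintype.piFinset fun i => Finset.range (β i)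

theorem mem_box {β : ℕ → ℕ} {n : ℕ} {b : Fin n → ℕ} : b ∈ box β n ↔ ∀ i : Fin n, b i < β i := by
  simp [box]

theorem snoc_mem_box {β : ℕ → ℕ} {n : ℕ} {b : Fin n → ℕ} {j : ℕ} :
    (Fin.snoc b j : Fin (n + 1) → ℕ) ∈ box β (n + 1) ↔ b ∈ box β n ∧ j < β n := by
  simp [mem_box, Fin.forall_fin_succ']

theorem sum_box_succ {M : Type*} [AddCommMonoid M] (β : ℕ → ℕ) (n : ℕ)
    (f : (Fin (n + 1) → ℕ) → M) :
    ∑ b ∈ box β (n + 1), f b =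
      ∑ j ∈ Finset.range (β n), ∑ b ∈ box β n, f (Fin.snoc b j) := by
  rw [← Finset.sum_product']
  refine Finset.sum_nbij' (fun b => (b (Fin.last n), Fin.init b))
    (fun x => Fin.snoc x.2 x.1) ?_ ?_ ?_ ?_ ?_
  · intro b hb
    rw [← Fin.snoc_init_self b, snoc_mem_box] at hb
    simpa [and_comm] using hb
  · rintro ⟨j, b⟩ hb
    simpa [snoc_mem_box, and_comm] using hb
  · intro b _
    simp
  · rintro ⟨j, b⟩ _
    simp
  · intro b _
    simp

variable {K : Type u} [Field K] (ψ : ℕ → K⟦X⟧[X]) (β : ℕ → ℕ)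

/-- The polynomial `∑ a_b ψ ^ b`, where `b` runs through a box of exponents. -/
def boxSum (n : ℕ) (a : (Fin n → ℕ) → K⟦X⟧) : K⟦X⟧[X] :=
  ∑ b ∈ box β n, Polynomial.C (a b) * ∏ i : Fin n, ψ i ^ b i

/-- Splitting off the last exponent presents a box sum as a `ψ n`-adic expansion whose digits are
box sums. The inductions on `n` rest on this. -/
theorem boxSum_succ (n : ℕ) (a : (Fin (n + 1) → ℕ) → K⟦X⟧) :
    boxSum ψ β (n + 1) a =
      ∑ j ∈ Finset.range (β n), boxSum ψ β n (fun b => a (Fin.snoc b j)) * ψ n ^ j := by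
  rw [boxSum, sum_box_succ]
  refine Finset.sum_congr rfl fun j _ => ?_
  rw [boxSum, Finset.sum_mul]
  refine Finset.sum_congr rfl fun b _ => ?_
  rw [Fin.prod_univ_castSucc]
  simp [mul_assoc]

theorem boxSum_zero (a : (Fin 0 → ℕ) → K⟦X⟧) :
    boxSum ψ β 0 a = Polynomial.C (a default) := by
  rw [boxSum, show box β 0 = {default} from by
    ext b; simp [mem_box, Subsingleton.elim b default]]
  simp

theorem boxSum_congr {n : ℕ} {a a' : (Fin n → ℕ) → K⟦X⟧} (h : ∀ b ∈ box β n, a b = a' b) :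
    boxSum ψ β n a = boxSum ψ β n a' :=
  Finset.sum_congr rfl fun b hb => by rw [h b hb]

theorem box_congr {β β' : ℕ → ℕ} {n : ℕ} (h : ∀ i < n, β i = β' i) : box β n = box β' n := by
  ext b
  simp only [mem_box]
  exact forall_congr' fun i => by rw [h i i.2]

variable {ψ β}

theorem degree_boxSum_lt {d : ℕ → ℕ} (hd0 : d 0 = 1) {n : ℕ} (hψ : ∀ i < n, (ψ i).Monic)
    (hψd : ∀ i < n, (ψ i).natDegree = d i) (hd : ∀ i < n, d (i + 1) = β i * d i)
    (a : (Fin n → ℕ) → K⟦X⟧) : (boxSum ψ β n a).degree < (d n : WithBot ℕ) := by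
  induction n with
  | zero =>
    rw [boxSum_zero, hd0]
    exact Polynomial.degree_C_le.trans_lt (by norm_num)
  | succ n ih =>
    rw [boxSum_succ, hd n (Nat.lt_succ_self n)]
    exact degree_digits_lt (hψ n (Nat.lt_succ_self n)) (hψd n (Nat.lt_succ_self n)) _ fun j =>
      ih (fun i hi => hψ i (hi.trans (Nat.lt_succ_self n)))
        (fun i hi => hψd i (hi.trans (Nat.lt_succ_self n)))
        (fun i hi => hd i (hi.trans (Nat.lt_succ_self n))) _

theorem exists_boxSum {d : ℕ → ℕ} (hd0 : d 0 = 1) {n : ℕ} (hψ : ∀ i < n, (ψ i).Monic)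
    (hψd : ∀ i < n, (ψ i).natDegree = d i) (hd : ∀ i < n, d (i + 1) = β i * d i)
    (Q : K⟦X⟧[X]) (hQ : Q.degree < (d n : WithBot ℕ)) : ∃ a, Q = boxSum ψ β n a := by
  induction n generalizing Q with
  | zero =>
    rw [hd0] at hQ
    refine ⟨fun _ => Q.coeff 0, ?_⟩
    rw [boxSum_zero]
    exact Polynomial.eq_C_of_degree_le_zero (Nat.WithBot.lt_one_iff_le_zero.1
      (by simpa using hQ))
  | succ n ih =>
    rw [hd n (Nat.lt_succ_self n)] at hQ
    obtain ⟨A, hA, rfl⟩ := exists_digits (hψ n (Nat.lt_succ_self n)) (hψd n (Nat.lt_succ_self n))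
      _ Q hQ
    choose a ha using fun j => ih (fun i hi => hψ i (hi.trans (Nat.lt_succ_self n)))
        (fun i hi => hψd i (hi.trans (Nat.lt_succ_self n)))
        (fun i hi => hd i (hi.trans (Nat.lt_succ_self n))) (A j) (hA j)
    refine ⟨fun b => a (b (Fin.last n)) (Fin.init b), ?_⟩
    rw [boxSum_succ]
    refine Finset.sum_congr rfl fun j _ => ?_
    simp [ha]

end Box

/-! ### Weights of the terms of an expansion -/

section Weights

variable {K : Type u} [Field K] {F : K⟦X⟧[X]}

theorem SameIni.val_eq {k : ℕ} {Q Q' : K⟦X⟧[X]} (h : SameIni (stage F k) Q Q') :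
    val F k Q = val F k Q' := by
  obtain ⟨w, p, hp, h1, h2⟩ := h
  have hp' := ne_zero_of_coeff_zero_ne_zero hp
  rw [val, val, show pullPi F k Q = (stage F k).pb Q from rfl,
    show pullPi F k Q' = (stage F k).pb Q' from rfl, h1.xVal_eq hp', h2.xVal_eq hp']

theorem Ini.val_eq {k : ℕ} {Q : K⟦X⟧[X]} {w : ℕ} {p : (stage F k).L[X]}
    (h : Ini ((stage F k).pb Q) w p) (hp : p ≠ 0) : val F k Q = w := by
  rw [val, show pullPi F k Q = (stage F k).pb Q from rfl, h.xVal_eq hp, ENat.toNat_natCast]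

theorem Ini.lam_eq {k : ℕ} {Q : K⟦X⟧[X]} {w : ℕ} {p : (stage F k).L[X]}
    (h : Ini ((stage F k).pb Q) w p) (hp : p.coeff 0 ≠ 0) : lam F k Q = p.coeff 0 := by
  rw [lam, show pullPi F k Q = (stage F k).pb Q from rfl,
    h.lead_eq (ne_zero_of_coeff_zero_ne_zero hp), trailingCoeff_of_coeff_zero_ne_zero hp]

theorem Stage.pb_C_X (S : Stage K) : Ini (S.pb (Polynomial.C PowerSeries.X)) S.e
    (Polynomial.C S.μ) := by
  rw [Stage.pb, pullHom_C, scaleHom_X]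
  exact ⟨Polynomial.C (PowerSeries.C S.μ), by rw [← Polynomial.C_mul, mul_comm], by simp⟩

theorem Inv.val_X {k : ℕ} (I : Inv F (stage F k)) :
    val F k (Polynomial.C PowerSeries.X) = (stage F k).e :=
  (stage F k).pb_C_X.val_eq (by simpa using I.mu_ne_zero)

theorem Inv.lam_X {k : ℕ} (I : Inv F (stage F k)) :
    lam F k (Polynomial.C PowerSeries.X) = (stage F k).μ := by
  rw [(stage F k).pb_C_X.lam_eq (by simpa using I.mu_ne_zero), Polynomial.coeff_C_zero]

theorem Stage.deg_zero : (stage F 0).deg = 1 :=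
  (one_mul _).trans (Module.finrank_self K)

theorem Admissible.degree_boxSum_lt (hF : Admissible F) {k : ℕ} (h : ∀ j < k, ¬ Stops F j)
    (a : (Fin k → ℕ) → K⟦X⟧) : (boxSum (approxRoot F) (qell F) k a).degree <
      ((stage F k).deg : WithBot ℕ) :=
  NewtonPuiseux.degree_boxSum_lt (d := fun i => (stage F i).deg) Stage.deg_zero
    (fun i hi => hF.approxRoot_monic (hF.inv i fun j hj => h j (hj.trans hi)))
    (fun i hi => hF.natDegree_approxRoot (hF.inv i fun j hj => h j (hj.trans hi)))
    (fun i hi => hF.deg_succ fun j hj => h j (by omega)) a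

theorem Admissible.exists_boxSum (hF : Admissible F) {k : ℕ} (h : ∀ j < k, ¬ Stops F j)
    (Q : K⟦X⟧[X]) (hQ : Q.degree < ((stage F k).deg : WithBot ℕ)) :
    ∃ a, Q = boxSum (approxRoot F) (qell F) k a :=
  NewtonPuiseux.exists_boxSum (d := fun i => (stage F i).deg) Stage.deg_zero
    (fun i hi => hF.approxRoot_monic (hF.inv i fun j hj => h j (hj.trans hi)))
    (fun i hi => hF.natDegree_approxRoot (hF.inv i fun j hj => h j (hj.trans hi)))
    (fun i hi => hF.deg_succ fun j hj => h j (by omega)) Q hQ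

/-- The exponents of the terms of a box expansion: their valuation is not less than that of
the sum. -/
theorem Admissible.le_weight_of_ini (hF : Admissible F) {k : ℕ} (h : ∀ j < k, ¬ Stops F j)
    (a : (Fin k → ℕ) → K⟦X⟧) {W : ℕ} {p : (stage F k).L[X]}
    (hini : Ini ((stage F k).pb (boxSum (approxRoot F) (qell F) k a)) W p) :
    ∀ b ∈ box (qell F) k, ∀ j, PowerSeries.coeff j (a b) ≠ 0 →
      W ≤ j * (stage F k).e + ∑ i : Fin k, b i * val F k (approxRoot F i) := by
  induction k generalizing W with
  | zero =>
    intro b _ j hj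
    rw [Subsingleton.elim b default] at hj
    rw [boxSum_zero, Stage.pb, pullHom_C] at hini
    by_contra! hlt
    have h1 := (hini.exists_map_coeff 0).1 _ hlt
    rw [Polynomial.coeff_C_zero, coeff_scaleHom, if_pos (by simp)] at h1
    have I := hF.inv 0 h
    rw [show (j * (stage F 0).e + ∑ i : Fin 0, b i * val F 0 (approxRoot F i)) / (stage F 0).e = j
      by simp [Nat.mul_div_cancel _ (stage F 0).e_pos]] at h1
    exact mul_ne_zero (pow_ne_zero _ I.mu_ne_zero) (by simpa using hj) h1
  | succ k ih =>
    have h' : ∀ j < k, ¬ Stops F j := fun j hj => h j (hj.trans (Nat.lt_succ_self k))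
    have I := hF.inv k h'
    have hk := h k (Nat.lt_succ_self k)
    have hne := hF.ne_X_pow I hk
    have hdeg := isDegenerated_of_not_stops hk
    have : Fact (Irreducible hdeg.some.P) := ⟨hdeg.some.irreducible⟩
    have hm := hdeg.some.m_pos I.weierstrass hne
    obtain ⟨v, u₀, hgood, -⟩ := hF.exists_good I hdeg.some.q_pos hm
      (fun i j hij => hdeg.some.mul_natDegree_le_of_coeff I.weierstrass hij)
    obtain ⟨r, hr, hrini⟩ := good_ini_nextStage I hF.cast_ne_zero hdeg.some hne (v := v) (u₀ := u₀)
    -- In passing to stage `k + 1` the valuations of `x` and of the `ψ_i` with `i < k` are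
    -- multiplied by `q`, and that of `ψ_k` becomes `q v + m`. The weights transform like the orders
    -- of the terms.
    have hvk : val F (k + 1) (approxRoot F k) = hdeg.some.q * v + hdeg.some.m := by
      have : ∃ p : (stage F (k + 1)).L[X], p.coeff 0 ≠ 0 ∧
          Ini ((stage F (k + 1)).pb (approxRoot F k)) (hdeg.some.q * v + hdeg.some.m) p := by
        rw [stage_succ hdeg]
        exact ⟨r, hr hgood.1, by rw [pb_nextStage]; exact hrini _ hgood⟩
      obtain ⟨p, hp, hp'⟩ := this
      exact hp'.val_eq (ne_zero_of_coeff_zero_ne_zero hp)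
    have hvi : ∀ i < k, val F (k + 1) (approxRoot F i) =
        hdeg.some.q * val F k (approxRoot F i) := by
      intro i hi
      obtain ⟨w, p, hp, hp', -⟩ := hF.sameIni h' hi
      have : ∃ p : (stage F (k + 1)).L[X], p.coeff 0 ≠ 0 ∧
          Ini ((stage F (k + 1)).pb (approxRoot F i)) (hdeg.some.q * w) p := by
        rw [stage_succ hdeg]
        exact ⟨_, coeff_zero_ini_nextStage_ne_zero I hdeg.some hne w hp,
          by rw [pb_nextStage]; exact ini_nextStage I hdeg.some hne hp'⟩
      obtain ⟨p', h1, h2⟩ := this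
      rw [h2.val_eq (ne_zero_of_coeff_zero_ne_zero h1),
        hp'.val_eq (ne_zero_of_coeff_zero_ne_zero hp)]
    have he : (stage F (k + 1)).e = hdeg.some.q * (stage F k).e := by
      rw [stage_succ hdeg, mul_comm]; rfl
    intro b hb j hj
    obtain ⟨c, i, rfl⟩ : ∃ c i, b = (Fin.snoc c i : Fin (k + 1) → ℕ) :=
      ⟨Fin.init b, b (Fin.last k), by simp⟩
    rw [snoc_mem_box] at hb
    have hweight : j * (stage F (k + 1)).e + ∑ l : Fin (k + 1),
        (Fin.snoc c i : Fin (k + 1) → ℕ) l * val F (k + 1) (approxRoot F l) =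
        hdeg.some.q * (j * (stage F k).e + ∑ l : Fin k, c l * val F k (approxRoot F l)) +
          i * (hdeg.some.q * v + hdeg.some.m) := by
      rw [Fin.sum_univ_castSucc, he]
      simp only [Fin.snoc_castSucc, Fin.snoc_last, Fin.val_castSucc, Fin.val_last, hvk]
      rw [Finset.sum_congr rfl fun (l : Fin k) _ => by rw [hvi l l.2, mul_left_comm], ← Finset.mul_sum]
      ring
    rw [hweight]
    have hlow : ∀ w, w ≤ j * (stage F k).e + ∑ l : Fin k, c l * val F k (approxRoot F l) →
        w ≤ hdeg.some.q * (j * (stage F k).e + ∑ l : Fin k, c l * val F k (approxRoot F l)) +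
          i * (hdeg.some.q * v + hdeg.some.m) := fun w hw =>
      hw.trans ((Nat.le_mul_of_pos_left _ hdeg.some.q_pos).trans (Nat.le_add_right _ _))
    -- A vanishing digit has an initial form `0` at any order, in particular at `W`, so the
    -- induction hypothesis still applies.
    have hzero : boxSum (approxRoot F) (qell F) k (fun b => a (Fin.snoc b i)) = 0 → W ≤
        hdeg.some.q * (j * (stage F k).e + ∑ l : Fin k, c l * val F k (approxRoot F l)) +
          i * (hdeg.some.q * v + hdeg.some.m) := by
      intro h0
      refine hlow _ (ih h' (fun b => a (Fin.snoc b i)) (p := 0) ?_ c hb.1 j hj)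
      rw [h0, map_zero]
      exact Ini.zero W
    have hdl : ∀ l, (boxSum (approxRoot F) (qell F) k (fun b => a (Fin.snoc b l))).degree <
        ((stage F k).deg : WithBot ℕ) := fun l =>
      hF.degree_boxSum_lt h' _
    rw [boxSum_succ] at hini
    by_cases h0 : ∑ j ∈ Finset.range (qell F k),
        boxSum (approxRoot F) (qell F) k (fun b => a (Fin.snoc b j)) * approxRoot F k ^ j = 0
    · refine hzero (digits_eq_zero (hF.approxRoot_monic I) (hF.natDegree_approxRoot I) hdl 0 _
        ?_ i (Nat.zero_le _) hb.2)
      rw [h0, Polynomial.degree_zero]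
      exact WithBot.bot_lt_coe _
    · by_cases hi0 : boxSum (approxRoot F) (qell F) k (fun b => a (Fin.snoc b i)) = 0
      · exact hzero hi0
      have hb2 := hb.2
      rw [qell_eq hdeg] at h0 hini hb2
      -- There is no cancellation among the digits, so the order `M` of the sum bounds the order of
      -- each of them from below.
      obtain ⟨M, r, hMini, hr0, hM⟩ := sigma_ini hdeg.some I hne
        (map_shift _ I hF.cast_ne_zero hne) hgood hdl h0
      have hWM : W ≤ M := by
        have : ∃ p, Ini (hdeg.some.sigma ((stage F k).pb
            (∑ j ∈ Finset.range (hdeg.some.q * hdeg.some.P.natDegree),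
              boxSum (approxRoot F) (qell F) k (fun b => a (Fin.snoc b j)) *
                approxRoot F k ^ j))) W p := by
          rw [← pb_nextStage]
          revert hini
          revert p
          rw [stage_succ hdeg]
          intro p hp
          exact ⟨p, hp⟩
        obtain ⟨p, hp⟩ := this
        exact hMini.le_of_ne_zero (ne_zero_of_coeff_zero_ne_zero hr0) hp
      obtain ⟨w, r', hw, -, hMw⟩ := hM i hb2 hi0
      have h1 := Nat.mul_le_mul_left hdeg.some.q (ih h' (fun b => a (Fin.snoc b i)) hw c hb.1 j hj)
      omega

end Weights

/-! ### Leading coefficients of expansions -/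

section InitialForms

variable {K : Type u} [Field K] {F : K⟦X⟧[X]}

/-- The series `c` becomes `c(μ x ^ e)`, so only the exponent `j` with `j e + w = W` contributes at
order `W`. The range of `j` suffices since `e ≥ 1`. -/
theorem Stage.ini_pb_C_mul (S : Stage K) (c : K⟦X⟧) {Q : K⟦X⟧[X]} {w : ℕ} {p : S.L[X]}
    (hQ : Ini (S.pb Q) w p) {W : ℕ}
    (hW : ∀ j, PowerSeries.coeff j c ≠ 0 → W ≤ j * S.e + w) :
    ∃ r, Ini (S.pb (Polynomial.C c * Q)) W r ∧ r.coeff 0 = ∑ j ∈ Finset.range (W + 1),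
      if j * S.e + w = W then
        algebraMap K S.L (PowerSeries.coeff j c) * (S.μ ^ j * p.coeff 0) else 0 := by
  have hC : S.pb (Polynomial.C c) = Polynomial.C (scaleHom K S.μ S.e S.e_pos c) := pullHom_C _ _ _ _ _
  rcases Nat.lt_or_ge W w with hlt | hle
  · refine ⟨0, ?_, ?_⟩
    · rw [map_mul, hC]
      exact ((Ini.C_of_order_le (n := 0) (by simp)).mul hQ).of_lt (by omega)
    · rw [Polynomial.coeff_zero, Finset.sum_eq_zero]
      intro j _
      rw [if_neg (by omega)]
  · obtain ⟨n, rfl⟩ := Nat.exists_eq_add_of_le hle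
    refine ⟨Polynomial.C (PowerSeries.coeff n (scaleHom K S.μ S.e S.e_pos c)) * p, ?_, ?_⟩
    · rw [map_mul, hC]
      refine ((Ini.C_of_order_le (n := n) (PowerSeries.le_order _ _ fun i hi => ?_)).mul hQ).cast
        (by ring) rfl
      have hi' : i < n := by exact_mod_cast hi
      rw [coeff_scaleHom]
      split_ifs with hd
      · obtain ⟨j, rfl⟩ := hd
        rw [Nat.mul_div_cancel_left _ S.e_pos]
        by_cases hj : PowerSeries.coeff j c = 0
        · rw [hj, map_zero, mul_zero]
        · have := hW j hj
          rw [mul_comm] at this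
          omega
      · rfl
    · rw [Polynomial.coeff_C_mul, coeff_scaleHom]
      by_cases hd : S.e ∣ n
      · obtain ⟨j, rfl⟩ := hd
        rw [if_pos ⟨j, rfl⟩, Nat.mul_div_cancel_left _ S.e_pos, Finset.sum_eq_single j]
        · rw [if_pos (by ring)]; ring
        · intro j' _ hj'
          rw [if_neg]
          intro heq
          exact hj' (Nat.eq_of_mul_eq_mul_left S.e_pos (by rw [mul_comm]; omega))
        · intro hj
          have := Nat.le_mul_of_pos_left j S.e_pos
          exact absurd (Finset.mem_range.2 (by omega)) hj
      · rw [if_neg hd, zero_mul, Finset.sum_eq_zero]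
        intro j _
        rw [if_neg]
        intro heq
        exact hd ⟨j, by rw [mul_comm]; omega⟩

/-- The orders and leading coefficients of the `ψ_i` are replaced by those of the `φ_i` through
`Admissible.sameIni`. This is where `V` and `Λ` enter. -/
theorem Admissible.ini_boxSum (hF : Admissible F) {k : ℕ} (h : ∀ j < k, ¬ Stops F j)
    (a : (Fin k → ℕ) → K⟦X⟧) {W : ℕ} (hW : ∀ b ∈ box (qell F) k, ∀ j,
      PowerSeries.coeff j (a b) ≠ 0 →
        W ≤ j * (stage F k).e + ∑ i : Fin k, b i * val F k (approxRoot F i)) :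
    ∃ r, Ini ((stage F k).pb (boxSum (approxRoot F) (qell F) k a)) W r ∧
      r.coeff 0 = ∑ b ∈ box (qell F) k, ∑ j ∈ Finset.range (W + 1),
        if j * (stage F k).e + ∑ i : Fin k, b i * val F k (minimalPoly F i) = W then
          algebraMap K (resField F k) (PowerSeries.coeff j (a b)) *
            ((stage F k).μ ^ j * ∏ i : Fin k, lam F k (minimalPoly F i) ^ b i) else 0 := by
  have hsame : ∀ i : Fin k, SameIni (stage F k) (approxRoot F i) (minimalPoly F i) :=
    fun i => hF.sameIni h i.2
  choose w p hp h1 h2 using hsame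
  have hw : ∀ i : Fin k, val F k (approxRoot F i) = w i := fun i =>
    (h1 i).val_eq (ne_zero_of_coeff_zero_ne_zero (hp i))
  have hw' : ∀ i : Fin k, val F k (minimalPoly F i) = w i := fun i =>
    (h2 i).val_eq (ne_zero_of_coeff_zero_ne_zero (hp i))
  have hl : ∀ i : Fin k, lam F k (minimalPoly F i) = (p i).coeff 0 := fun i => (h2 i).lam_eq (hp i)
  simp only [hw, hw', hl] at hW ⊢
  have hterm : ∀ b, ∃ r : (stage F k).L[X], b ∈ box (qell F) k → Ini ((stage F k).pb
      (Polynomial.C (a b) * ∏ i : Fin k, approxRoot F i ^ b i)) W r ∧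
      r.coeff 0 = ∑ j ∈ Finset.range (W + 1),
        if j * (stage F k).e + ∑ i : Fin k, b i * w i = W then
          algebraMap K (resField F k) (PowerSeries.coeff j (a b)) *
            ((stage F k).μ ^ j * ∏ i : Fin k, (p i).coeff 0 ^ b i) else 0 := by
    intro b
    by_cases hb : b ∈ box (qell F) k
    · have hprod : Ini ((stage F k).pb (∏ i : Fin k, approxRoot F i ^ b i))
          (∑ i, b i * w i) (∏ i, p i ^ b i) := by
        rw [map_prod]
        refine Ini.prod _ fun i _ => ?_
        rw [map_pow]
        exact (h1 i).pow _
      obtain ⟨r, hr, hr0⟩ := (stage F k).ini_pb_C_mul (a b) hprod (hW b hb)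
      refine ⟨r, fun _ => ⟨hr, ?_⟩⟩
      rw [hr0, Polynomial.coeff_zero_prod]
      simp only [Polynomial.coeff_zero_eq_eval_zero, Polynomial.eval_pow]
    · exact ⟨0, fun hb' => absurd hb' hb⟩
  choose r hr using hterm
  refine ⟨∑ b ∈ box (qell F) k, r b, ?_, ?_⟩
  · rw [boxSum, map_sum]
    exact Ini.sum _ fun b hb => (hr b hb).1
  · rw [Polynomial.finsetSum_coeff]
    exact Finset.sum_congr rfl fun b hb => (hr b hb).2

end InitialForms

/-! ### The `Ψ`-adic expansion of `F` -/

section Expansion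

variable {K : Type u} [Field K] {F : K⟦X⟧[X]}

/-- The definition of the expansion does not bound the last exponent, so the box is given an
auxiliary bound `n` in that coordinate. -/
theorem boxSum_update_succ (ψ : ℕ → K⟦X⟧[X]) (β : ℕ → ℕ) (k n : ℕ)
    (a : (Fin (k + 1) → ℕ) → K⟦X⟧) : boxSum ψ (Function.update β k n) (k + 1) a =
      ∑ j ∈ Finset.range n, boxSum ψ β k (fun b => a (Fin.snoc b j)) * ψ k ^ j := by
  rw [boxSum_succ, Function.update_self]
  refine Finset.sum_congr rfl fun j _ => ?_
  rw [boxSum, box_congr (β' := β) fun i hi => Function.update_of_ne hi.ne _ _]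
  rfl

theorem Admissible.exists_isPsiExpansion (hF : Admissible F) {k : ℕ} (h : ∀ j < k, ¬ Stops F j) :
    ∃ a, IsPsiExpansion F k a := by
  classical
  have I := hF.inv k h
  obtain ⟨A, hA, -, hFA⟩ := I.exists_digits_F hF.weierstrass.1 (hF.approxRoot_monic I)
    (hF.natDegree_approxRoot I)
  choose α hα using fun i => hF.exists_boxSum h (A i) (hA i)
  set β := Function.update (qell F) k ((stage F k).H.natDegree + 1) with hβ
  set a' : (Fin (k + 1) → ℕ) → K⟦X⟧ := fun b =>
    if b ∈ box β (k + 1) then α (b (Fin.last k)) (Fin.init b) else 0 with ha'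
  refine ⟨Finsupp.onFinset (box β (k + 1)) a' fun b hb => ?_, fun b hb i => ?_, ?_⟩
  · by_contra hb'
    exact hb (by rw [ha']; exact if_neg hb')
  · have h1 := mem_box.1 (Finsupp.support_onFinset_subset hb) i.castSucc
    rwa [hβ, Fin.val_castSucc, Function.update_of_ne i.2.ne] at h1
  · rw [Finsupp.sum_of_support_subset _ Finsupp.support_onFinset_subset _ (by simp)]
    have h1 : boxSum (approxRoot F) β (k + 1) a' =
        boxSum (approxRoot F) β (k + 1) fun b => α (b (Fin.last k)) (Fin.init b) :=
      boxSum_congr _ _ fun b hb => if_pos hb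
    have h2 := h1.trans (boxSum_update_succ _ _ _ _ _)
    refine Eq.trans ?_ h2.symm
    simp only [Fin.snoc_last, Fin.init_snoc, ← hα]
    exact hFA

theorem IsPsiExpansion.exists_eq_boxSum {k : ℕ} {a : (Fin (k + 1) → ℕ) →₀ K⟦X⟧}
    (ha : IsPsiExpansion F k a) (N : ℕ) : ∃ n, N < n ∧
      F = boxSum (approxRoot F) (Function.update (qell F) k n) (k + 1) a ∧
      ∀ b, b ∉ box (Function.update (qell F) k n) (k + 1) → a b = 0 := by
  classical
  set n := N + 1 + a.support.sup (fun b => b (Fin.last k)) with hn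
  have hsub : a.support ⊆ box (Function.update (qell F) k n) (k + 1) := by
    intro b hb
    refine mem_box.2 (Fin.lastCases ?_ fun i => ?_)
    · rw [Fin.val_last, Function.update_self]
      have := Finset.le_sup (f := fun b : Fin (k + 1) → ℕ => b (Fin.last k)) hb
      omega
    · rw [Fin.val_castSucc, Function.update_of_ne i.2.ne]
      exact ha.1 b hb i
  refine ⟨n, by omega, ?_, fun b hb => ?_⟩
  · conv_lhs => rw [ha.2]
    rw [Finsupp.sum_of_support_subset _ hsub _ (by simp)]
    rfl
  · by_contra h0
    exact hb (hsub (Finsupp.mem_support_iff.2 h0))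

/-- The coefficient of `ψ_k ^ i` in the `Ψ`-adic expansion of `F`. -/
def psiDigit (F : K⟦X⟧[X]) (k i : ℕ) : K⟦X⟧[X] :=
  boxSum (approxRoot F) (qell F) k
    fun b => Classical.epsilon (IsPsiExpansion F k) (Fin.snoc b i : Fin (k + 1) → ℕ)

theorem Admissible.psiCoeff_snoc (hF : Admissible F) {k : ℕ} (h : ∀ j < k, ¬ Stops F j)
    (b : Fin k → ℕ) (hb : b ∉ box (qell F) k) (i j : ℕ) : psiCoeff F k (j, Fin.snoc b i) = 0 := by
  have ha := Classical.epsilon_spec (hF.exists_isPsiExpansion h)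
  obtain ⟨n, -, -, hz⟩ := ha.exists_eq_boxSum 0
  rw [psiCoeff, hz, map_zero]
  rw [snoc_mem_box, box_congr (β' := qell F) fun i hi => Function.update_of_ne hi.ne _ _]
  exact fun h' => hb h'.1

/-- The chosen expansion could a priori involve powers of `ψ_k` beyond `N`. Uniqueness of digits
identifies it with the `ψ_k`-adic expansion of `F`, whose top digit is `1`. -/
theorem Admissible.psiDigit_spec (hF : Admissible F) {k : ℕ} (h : ∀ j < k, ¬ Stops F j) :
    psiDigit F k (stage F k).H.natDegree = 1 ∧
      F = ∑ i ∈ Finset.range ((stage F k).H.natDegree + 1),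
        psiDigit F k i * approxRoot F k ^ i := by
  have I := hF.inv k h
  have hm := hF.approxRoot_monic I
  have hd := hF.natDegree_approxRoot I
  have ha := Classical.epsilon_spec (hF.exists_isPsiExpansion h)
  obtain ⟨n, hn, hFa, -⟩ := ha.exists_eq_boxSum (stage F k).H.natDegree
  rw [boxSum_update_succ] at hFa
  change F = ∑ i ∈ Finset.range n, psiDigit F k i * approxRoot F k ^ i at hFa
  have hdeg : ∀ i, (psiDigit F k i).degree < ((stage F k).deg : WithBot ℕ) :=
    fun i => hF.degree_boxSum_lt h _
  obtain ⟨A, hA, hA1, hFA⟩ := I.exists_digits_F hF.weierstrass.1 hm hd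
  -- The digits are padded by zeros, so that both expansions run over the same range.
  set A' : ℕ → K⟦X⟧[X] := fun i => if i < (stage F k).H.natDegree + 1 then A i else 0 with hA'
  have hA'd : ∀ i, (A' i).degree < ((stage F k).deg : WithBot ℕ) := by
    intro i
    by_cases hi : i < (stage F k).H.natDegree + 1
    · exact (congrArg Polynomial.degree (if_pos hi)).trans_lt (hA i)
    · refine (congrArg Polynomial.degree (if_neg hi)).trans_lt ?_
      rw [Polynomial.degree_zero]; exact WithBot.bot_lt_coe _
  have hFA' : F = ∑ i ∈ Finset.range n, A' i * approxRoot F k ^ i := by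
    conv_lhs => rw [hFA]
    rw [← Finset.sum_subset (Finset.range_subset_range.2 (Nat.succ_le_of_lt hn))]
    · refine Finset.sum_congr rfl fun i hi => ?_
      rw [hA']
      simp only [if_pos (Finset.mem_range.1 hi)]
    · intro i _ hi
      rw [hA']
      simp only [if_neg (fun h' => hi (Finset.mem_range.2 h')), zero_mul]
  have heq : ∀ i < n, psiDigit F k i = A' i := by
    intro i hi
    refine sub_eq_zero.1 (digits_eq_zero (A := fun i => psiDigit F k i - A' i) hm hd
      (fun i => (Polynomial.degree_sub_le _ _).trans_lt (max_lt (hdeg i) (hA'd i))) 0 n ?_ i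
      (Nat.zero_le _) hi)
    simp only [sub_mul, Finset.sum_sub_distrib]
    rw [← hFa, ← hFA', sub_self, Polynomial.degree_zero]
    exact WithBot.bot_lt_coe _
  have heq' : ∀ i < (stage F k).H.natDegree + 1, psiDigit F k i = A i := by
    intro i hi
    rw [heq i (by omega), hA']
    exact if_pos hi
  refine ⟨by rw [heq' _ (Nat.lt_succ_self _), hA1], ?_⟩
  conv_lhs => rw [hFA]
  exact Finset.sum_congr rfl fun i hi => by rw [heq' i (Finset.mem_range.1 hi)]

end Expansion

/-! ### The heights `w'_i` and the coefficients they carry -/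

section Weights

variable {K : Type u} [Field K] {F : K⟦X⟧[X]}

theorem weight_snoc {k : ℕ} (b : Fin k → ℕ) (i j : ℕ) :
    weight F k (j, Fin.snoc b i) = (j * val F k (Polynomial.C PowerSeries.X) +
      ∑ l : Fin k, b l * val F k (minimalPoly F l)) + i * val F k (minimalPoly F k) := by
  rw [weight, Fin.sum_univ_castSucc]
  simp [add_assoc]

theorem lamPow_snoc {k : ℕ} (b : Fin k → ℕ) (i j : ℕ) :
    lamPow F k (j, Fin.snoc b i) = (lam F k (Polynomial.C PowerSeries.X) ^ j *
      ∏ l : Fin k, lam F k (minimalPoly F l) ^ b l) * lam F k (minimalPoly F k) ^ i := by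
  rw [lamPow, Fin.prod_univ_castSucc]
  simp [mul_assoc]

theorem lamPow_baseExponent (k : ℕ) :
    lamPow F k (baseExponent F k) = lam F k (minimalPoly F k) ^ degN F k := by
  rw [lamPow, baseExponent, Fin.prod_univ_castSucc, Finset.prod_eq_one]
  · simp
  · intro l _
    change _ ^ (Pi.single (Fin.last k) (degN F k) : Fin (k + 1) → ℕ) l.castSucc = 1
    rw [Pi.single_eq_of_ne (Fin.castSucc_lt_last l).ne, pow_zero]

theorem Good.val_eq {k q m v : ℕ} {u₀ : (stage F k).L} {Q : K⟦X⟧[X]}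
    (h : Good q m ((stage F k).pb Q) v u₀) : val F k Q = v := by
  obtain ⟨p, hp, hp0⟩ := h.ini
  refine hp.val_eq (mul_ne_zero Polynomial.X_ne_zero (ne_zero_of_coeff_zero_ne_zero ?_))
  rw [hp0]; exact h.1

theorem Good.lam_eq {k q m v : ℕ} {u₀ : (stage F k).L} {Q : K⟦X⟧[X]}
    (h : Good q m ((stage F k).pb Q) v u₀) : lam F k Q = u₀ := by
  obtain ⟨p, hp, hp0⟩ := h.ini
  have hp0' : p.coeff 0 ≠ 0 := by rw [hp0]; exact h.1
  rw [lam, show pullPi F k Q = (stage F k).pb Q from rfl, hp.lead_eq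
    (mul_ne_zero Polynomial.X_ne_zero (ne_zero_of_coeff_zero_ne_zero hp0')),
    Polynomial.trailingCoeff_mul, trailingCoeff_of_coeff_zero_ne_zero hp0', hp0,
    ← Polynomial.monomial_one_one_eq_X, Polynomial.trailingCoeff, Polynomial.natTrailingDegree_monomial one_ne_zero,
    Polynomial.coeff_monomial, if_pos rfl, one_mul]

theorem Admissible.sum_val_eq (hF : Admissible F) {k : ℕ} (h : ∀ j < k, ¬ Stops F j)
    (b : Fin k → ℕ) : ∑ i : Fin k, b i * val F k (approxRoot F i) =
      ∑ i : Fin k, b i * val F k (minimalPoly F i) :=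
  Finset.sum_congr rfl fun i _ => by rw [(hF.sameIni h i.2).val_eq]

/-- The terms of the `i`-th digit of the expansion have weight at least the order of the digit. -/
theorem Admissible.le_weight (hF : Admissible F) {k : ℕ} (h : ∀ j < k, ¬ Stops F j) {i W : ℕ}
    {p : (stage F k).L[X]} (hini : Ini ((stage F k).pb (psiDigit F k i)) W p) (B : Exponent k)
    (hB : B.2 (Fin.last k) = i) (hB0 : psiCoeff F k B ≠ 0) :
    W + i * val F k (minimalPoly F k) ≤ weight F k B := by
  obtain ⟨j, b⟩ := B
  obtain ⟨c, i', rfl⟩ : ∃ c i', b = (Fin.snoc c i' : Fin (k + 1) → ℕ) :=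
    ⟨Fin.init b, b (Fin.last k), by simp⟩
  obtain rfl : i' = i := by simpa using hB
  rw [weight_snoc, (hF.inv k h).val_X, ← hF.sum_val_eq h]
  refine Nat.add_le_add_right (hF.le_weight_of_ini h _ hini c ?_ j hB0) _
  by_contra hc
  exact hB0 (hF.psiCoeff_snoc h c hc i' j)

/-- If every term had weight greater than the order of the digit, its terms would sum to a
polynomial of order at least `w + 1`, contrary to `p ≠ 0`. -/
theorem Admissible.iInf_weight (hF : Admissible F) {k : ℕ} (h : ∀ j < k, ¬ Stops F j) {i w : ℕ}
    {p : (stage F k).L[X]} (hini : Ini ((stage F k).pb (psiDigit F k i)) w p) (hp : p ≠ 0) :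
    (⨅ (B : Exponent k) (_ : B.2 (Fin.last k) = i ∧ psiCoeff F k B ≠ 0), (weight F k B : ℕ∞)) =
      ((w + i * val F k (minimalPoly F k) : ℕ) : ℕ∞) := by
  refine le_antisymm ?_ (le_iInf₂ fun B hB => by
    exact_mod_cast hF.le_weight h hini B hB.1 hB.2)
  by_contra! hlt
  obtain ⟨r, hr, -⟩ := hF.ini_boxSum h
    (fun b => Classical.epsilon (IsPsiExpansion F k) (Fin.snoc b i : Fin (k + 1) → ℕ))
    (W := w + 1) fun b _ j hj => by
      have h1 := hlt.trans_le (iInf₂_le (j, (Fin.snoc b i : Fin (k + 1) → ℕ))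
        ⟨by simp, hj⟩)
      rw [weight_snoc, (hF.inv k h).val_X, ← hF.sum_val_eq h] at h1
      have h2 := Nat.cast_lt.1 h1
      omega
  exact absurd (hini.le_of_ne_zero hp hr) (by omega)

theorem Admissible.iInf_weight_of_zero (hF : Admissible F) {k : ℕ} (h : ∀ j < k, ¬ Stops F j)
    {i : ℕ} (h0 : psiDigit F k i = 0) :
    (⨅ (B : Exponent k) (_ : B.2 (Fin.last k) = i ∧ psiCoeff F k B ≠ 0), (weight F k B : ℕ∞)) =
      ⊤ := by
  refine iInf₂_eq_top.2 fun B hB => ?_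
  have h1 := hF.le_weight h (W := weight F k B + 1) (i := i) (p := 0)
    (by rw [h0, map_zero]; exact Ini.zero _) B hB.1 hB.2
  omega

/-- The sum over the exponents of least weight is the constant term of the initial form computed in
`Admissible.ini_boxSum`. The common factor `λ(φ_k) ^ i` comes from `b_k = i`. -/
theorem Admissible.finsum_eq (hF : Admissible F) {k : ℕ} (h : ∀ j < k, ¬ Stops F j) {i w : ℕ}
    {p : (stage F k).L[X]} (hini : Ini ((stage F k).pb (psiDigit F k i)) w p)
    (c : resField F k) :
    ∑ᶠ B ∈ {B : Exponent k | B.2 (Fin.last k) = i ∧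
        weight F k B = w + i * val F k (minimalPoly F k)},
      algebraMap K (resField F k) (psiCoeff F k B) * (lamPow F k B / c) =
        p.coeff 0 * lam F k (minimalPoly F k) ^ i / c := by
  classical
  have I := hF.inv k h
  obtain ⟨r, hr, hr0⟩ := hF.ini_boxSum h _ (hF.le_weight_of_ini h _ hini)
  rw [hini.unique hr, hr0]
  set T : Finset (Exponent k) := ((box (qell F) k ×ˢ Finset.range (w + 1)).image
    fun x => (x.2, (Fin.snoc x.1 i : Fin (k + 1) → ℕ))).filter
    fun B => weight F k B = w + i * val F k (minimalPoly F k) with hT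
  rw [finsum_cond_eq_sum_of_cond_iff (t := T)]
  · rw [hT, Finset.sum_filter, Finset.sum_image, Finset.sum_product, Finset.sum_mul,
      Finset.sum_div]
    · refine Finset.sum_congr rfl fun b _ => ?_
      rw [Finset.sum_mul, Finset.sum_div]
      refine Finset.sum_congr rfl fun j _ => ?_
      simp only [weight_snoc, lamPow_snoc, I.val_X, I.lam_X, Nat.add_right_cancel_iff]
      split_ifs
      · rw [psiCoeff]; ring
      · ring
    · rintro ⟨b, j⟩ _ ⟨b', j'⟩ _ heq
      obtain ⟨h1, h2⟩ := Prod.mk.inj heq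
      have h3 := congrArg Fin.init h2
      simp only [Fin.init_snoc] at h3
      rw [h3]; exact congrArg _ h1
  · rintro ⟨j, b⟩ hB
    obtain ⟨b, i', rfl⟩ : ∃ c i', b = (Fin.snoc c i' : Fin (k + 1) → ℕ) :=
      ⟨Fin.init b, b (Fin.last k), by simp⟩
    have hbox : b ∈ box (qell F) k := by
      by_contra hb
      rw [hF.psiCoeff_snoc h b hb, map_zero, zero_mul] at hB
      exact hB rfl
    simp only [hT, Set.mem_ofPred_eq, Finset.mem_filter, Finset.mem_image, Finset.mem_product,
      Finset.mem_range, Prod.exists, Fin.snoc_last]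
    refine and_congr_left fun hw => ⟨?_, ?_⟩
    · rintro rfl
      refine ⟨b, j, ⟨hbox, ?_⟩, rfl⟩
      rw [weight_snoc, I.val_X] at hw
      have := Nat.le_mul_of_pos_right j (stage F k).e_pos
      omega
    · rintro ⟨b', j', -, heq⟩
      have := congrFun (Prod.mk.inj heq).2 (Fin.last k)
      simpa using this.symm

/-- The coefficients of the expansion of `F` and those of `H` along a supporting line of the
Newton polygon of `H`. -/
theorem Admissible.psi_comparison (hF : Admissible F) {k : ℕ} (h : ∀ j < k, ¬ Stops F j) {q m : ℕ}
    (hq : 0 < q) (hm : 0 < m) (hline : ∀ i j, PowerSeries.coeff j ((polyH F k).coeff i) ≠ 0 →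
      m * degN F k ≤ q * j + m * i) :
    (∀ i ≤ degN F k, ∀ w : ℤ, psiHeight F k i = (w : WithTop ℤ) →
      (m * degN F k : ℤ) ≤ q * w + m * i) ∧
    ∀ i ≤ degN F k, ∀ j, q * j + m * i = m * degN F k →
      (psiHeight F k i = ((j : ℤ) : WithTop ℤ) ↔ PowerSeries.coeff j ((polyH F k).coeff i) ≠ 0) ∧
      (psiHeight F k i = ((j : ℤ) : WithTop ℤ) →
        ∑ᶠ B ∈ {B : Exponent k | B.2 (Fin.last k) = i ∧ weight F k B = j + val F k F},
          algebraMap K (resField F k) (psiCoeff F k B) *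
            (lamPow F k B / lamPow F k (baseExponent F k)) =
          PowerSeries.coeff j ((polyH F k).coeff i)) := by
  have I := hF.inv k h
  obtain ⟨v, u₀, hψ, hφ⟩ := hF.exists_good I hq hm hline
  have hdeg : ∀ i, (psiDigit F k i).degree < ((stage F k).deg : WithBot ℕ) :=
    fun i => hF.degree_boxSum_lt h _
  obtain ⟨hA1, hFA⟩ := hF.psiDigit_spec h
  obtain ⟨⟨pF, hpF, hFini⟩, hle, hco⟩ := I.comparison hq hm hline hψ hdeg hA1 hFA
  have hvF : val F k F = degN F k * v :=
    hFini.val_eq (mul_ne_zero (pow_ne_zero _ Polynomial.X_ne_zero)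
      (ne_zero_of_coeff_zero_ne_zero hpF))
  have hheight : ∀ i w p, Ini ((stage F k).pb (psiDigit F k i)) w p → p.coeff 0 ≠ 0 →
      psiHeight F k i = (((w + i * v : ℕ) : ℤ) - (degN F k * v : ℕ) : ℤ) := by
    intro i w p hini hp
    rw [psiHeight, hF.iInf_weight h hini (ne_zero_of_coeff_zero_ne_zero hp), ENat.map_natCast,
      hφ.val_eq, hvF]
  have hcases : ∀ i, psiHeight F k i = ⊤ ∧ psiDigit F k i = 0 ∨ ∃ w p,
      Ini ((stage F k).pb (psiDigit F k i)) w p ∧ p.coeff 0 ≠ 0 ∧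
      psiHeight F k i = (((w + i * v : ℕ) : ℤ) - (degN F k * v : ℕ) : ℤ) := by
    intro i
    by_cases h0 : psiDigit F k i = 0
    · left
      rw [psiHeight, hF.iInf_weight_of_zero h h0, ENat.map_top]
      exact ⟨rfl, h0⟩
    · obtain ⟨w, p, hini, hp⟩ := I.ini _ h0 (hdeg i)
      exact Or.inr ⟨w, p, hini, hp, hheight i w p hini hp⟩
  have hineq : ∀ i ≤ degN F k, ∀ w p, Ini ((stage F k).pb (psiDigit F k i)) w p →
      p.coeff 0 ≠ 0 → q * (degN F k * v) + m * degN F k ≤ q * (w + i * v) + m * i := by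
    intro i hi w p hini hp
    have h1 := hle i hi (by
      intro h0
      rw [h0, map_zero] at hini
      exact hini.ne_zero (ne_zero_of_coeff_zero_ne_zero hp) rfl) w p hini hp
    calc _ ≤ q * w + i * (q * v + m) := h1
      _ = _ := by ring
  refine ⟨fun i hi w hw => ?_, fun i hi j hj => ?_⟩
  · rcases hcases i with ⟨htop, -⟩ | ⟨w', p, hini, hp, hw'⟩
    · rw [htop] at hw
      exact absurd hw WithTop.top_ne_coe
    · rw [hw] at hw'
      rw [WithTop.coe_inj.1 hw']
      have h1 : ((q * (degN F k * v) + m * degN F k : ℕ) : ℤ) ≤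
          ((q * (w' + i * v) + m * i : ℕ) : ℤ) := by exact_mod_cast hineq i hi w' p hini hp
      push_cast at h1 ⊢
      linarith
  · have hsum : psiHeight F k i = ((j : ℤ) : WithTop ℤ) → ∃ w p,
        Ini ((stage F k).pb (psiDigit F k i)) w p ∧ p.coeff 0 ≠ 0 ∧
        w + i * v = degN F k * v + j := by
      intro hw
      rcases hcases i with ⟨htop, -⟩ | ⟨w', p, hini, hp, hw'⟩
      · rw [htop] at hw
        exact absurd hw WithTop.top_ne_coe
      · rw [hw] at hw'
        have := WithTop.coe_inj.1 hw'
        exact ⟨w', p, hini, hp, by omega⟩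
    refine ⟨⟨fun hw => ?_, fun hne => ?_⟩, fun hw => ?_⟩
    · obtain ⟨w, p, hini, hp, hwj⟩ := hsum hw
      have h1 := hco i hi j w p hj hwj hini
      intro h0
      rw [show (stage F k).H = polyH F k from rfl, h0, mul_zero] at h1
      exact mul_ne_zero hp (pow_ne_zero _ hψ.1) h1
    · have hiv : i * v ≤ degN F k * v := Nat.mul_le_mul_right _ hi
      have hw0 : (degN F k * v + j - i * v) + i * v = degN F k * v + j :=
        Nat.sub_add_cancel (hiv.trans (Nat.le_add_right _ _))
      -- If the digit had order above the line, the comparison would make the coefficient of `H` at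
      -- that point zero.
      have hzero : ¬ Ini ((stage F k).pb (psiDigit F k i)) (degN F k * v + j - i * v) 0 := by
        intro hini
        have h1 := hco i hi j _ 0 hj hw0 hini
        rw [Polynomial.coeff_zero, zero_mul] at h1
        exact mul_ne_zero (pow_ne_zero _ hψ.1) hne h1.symm
      rcases hcases i with ⟨-, h0⟩ | ⟨w', p, hini, hp, hw'⟩
      · refine absurd ?_ hzero
        rw [h0, map_zero]
        exact Ini.zero _
      · rw [hw']
        have h1 := hineq i hi w' p hini hp
        have h2 : degN F k * v + j ≤ w' + i * v := by
          refine Nat.le_of_mul_le_mul_left ?_ hq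
          rw [Nat.mul_add]
          omega
        have h3 : ¬ degN F k * v + j - i * v < w' := fun hlt => hzero (hini.of_lt hlt)
        congr 1
        omega
    · obtain ⟨w, p, hini, hp, hwj⟩ := hsum hw
      -- Dividing by `Λ ^ B_0 = u₀ ^ N` removes exactly the factor by which the digits and the
      -- coefficients of `H` differ in the comparison.
      have h1 := hF.finsum_eq h hini (lamPow F k (baseExponent F k))
      rw [hφ.val_eq, hφ.lam_eq, hwj, add_comm (degN F k * v), ← hvF] at h1
      rw [h1, lamPow_baseExponent, hφ.lam_eq, hco i hi j w p hj hwj hini]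
      exact mul_div_cancel_left₀ _ (pow_ne_zero _ hψ.1)

end Weights

/-! ### The lowest edge of a lower hull -/

section Geometry

variable {S : Set (ℝ × ℝ)} {q m n x₀ y₀ : ℝ}

theorem mem_convexHull_of_line (hq : 0 < q) (hx : x₀ < n)
    (h₀ : (x₀, y₀) ∈ S) (hline : q * y₀ + m * x₀ = m * n) (hn : (n, (0 : ℝ)) ∈ S) {p : ℝ × ℝ}
    (h1 : x₀ ≤ p.1) (h2 : p.1 ≤ n) (hp : q * p.2 + m * p.1 = m * n) : p ∈ convexHull ℝ S := by
  have hd : 0 < n - x₀ := sub_pos.2 hx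
  have hmem := convex_convexHull ℝ S (subset_convexHull ℝ S h₀) (subset_convexHull ℝ S hn)
    (a := (n - p.1) / (n - x₀)) (b := (p.1 - x₀) / (n - x₀))
    (div_nonneg (sub_nonneg.2 h2) hd.le) (div_nonneg (sub_nonneg.2 h1) hd.le)
    (by rw [← add_div, div_eq_one_iff_eq hd.ne']; ring)
  convert hmem using 1
  ext
  · simp only [Prod.smul_mk, Prod.mk_add_mk, smul_eq_mul]
    field_simp
    ring
  · simp only [Prod.smul_mk, Prod.mk_add_mk, smul_eq_mul]
    field_simp
    refine mul_left_cancel₀ hq.ne' ?_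
    linear_combination (n - x₀) * hp - (n - p.1) * hline

/-- The hull lies on or above the line and contains the segment over `[x₀, n]`, so its lower
boundary there is that segment. -/
theorem line_of_mem_lowerHull (hq : 0 < q) (hS : ∀ p ∈ S, m * n ≤ q * p.2 + m * p.1) (hx : x₀ < n)
    (h₀ : (x₀, y₀) ∈ S) (hline : q * y₀ + m * x₀ = m * n) (hn : (n, (0 : ℝ)) ∈ S) {p : ℝ × ℝ}
    (hp : p ∈ lowerHull S) (h1 : x₀ ≤ p.1) (h2 : p.1 ≤ n) : q * p.2 + m * p.1 = m * n := by
  have hmem := mem_convexHull_of_line (p := (p.1, m * (n - p.1) / q)) hq hx h₀ hline hn h1 h2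
    (by simp only; field_simp; ring)
  have h3 := hp.2 _ hmem
  rw [le_div_iff₀ hq] at h3
  have h4 := le_of_mem_convexHull (a := m) (b := q) (c := m * n)
    (fun p hp => by linarith [hS p hp]) p hp.1
  linarith

/-- The lowest point is `(n, 0)`. A segment of the lower boundary that ends there follows the line
near that end, so all of it lies on the line. By convexity, a point of the hull on the line is not
to the left of `x₀`. -/
theorem lowestEdge_lowerHull (hq : 0 < q) (hm : 0 < m)
    (hS : ∀ p ∈ S, p.1 ≤ n ∧ m * n ≤ q * p.2 + m * p.1) (hx : x₀ < n)
    (h₀ : (x₀, y₀) ∈ S) (hline : q * y₀ + m * x₀ = m * n) (hn : (n, (0 : ℝ)) ∈ S)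
    (hleft : ∀ p ∈ S, q * p.2 + m * p.1 = m * n → x₀ ≤ p.1) :
    lowestEdge (lowerHull S) = {p | x₀ ≤ p.1 ∧ p.1 ≤ n ∧ q * p.2 + m * p.1 = m * n} := by
  have hconv : Convex ℝ {p : ℝ × ℝ | p.1 ≤ n ∧ m * n ≤ q * p.2 + m * p.1 ∧
      (q * p.2 + m * p.1 = m * n → x₀ ≤ p.1)} := by
    rintro ⟨a, b⟩ ⟨ha1, ha2, ha3⟩ ⟨a', b'⟩ ⟨hb1, hb2, hb3⟩ s t hs ht hst
    simp only at ha1 ha2 ha3 hb1 hb2 hb3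
    obtain rfl : s = 1 - t := by linarith
    simp only [Prod.smul_mk, Prod.mk_add_mk, smul_eq_mul, Set.mem_ofPred_eq]
    have e1 := mul_le_mul_of_nonneg_left ha1 hs
    have e2 := mul_le_mul_of_nonneg_left hb1 ht
    have e3 := mul_le_mul_of_nonneg_left ha2 hs
    have e4 := mul_le_mul_of_nonneg_left hb2 ht
    refine ⟨by linarith, by linarith, fun heq => ?_⟩
    rcases hs.eq_or_lt with h0 | h0
    · obtain rfl : t = 1 := by linarith
      have := hb3 (by linarith)
      linarith
    rcases ht.eq_or_lt with h0' | h0'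
    · obtain rfl : t = 0 := h0'.symm
      have := ha3 (by linarith)
      linarith
    -- A combination with two positive weights of points on or above the line is on the line only if
    -- both points are.
    have e5 : q * b + m * a = m * n := by
      by_contra hne
      have := mul_lt_mul_of_pos_left (lt_of_le_of_ne ha2 (Ne.symm hne)) h0
      linarith
    have e6 : q * b' + m * a' = m * n := by
      by_contra hne
      have := mul_lt_mul_of_pos_left (lt_of_le_of_ne hb2 (Ne.symm hne)) h0'
      linarith
    have e7 := mul_le_mul_of_nonneg_left (ha3 e5) hs
    have e8 := mul_le_mul_of_nonneg_left (hb3 e6) ht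
    linarith
  have hhull : ∀ p ∈ convexHull ℝ S, p.1 ≤ n ∧ m * n ≤ q * p.2 + m * p.1 ∧
      (q * p.2 + m * p.1 = m * n → x₀ ≤ p.1) := fun p hp =>
    convexHull_min (t := {p : ℝ × ℝ | p.1 ≤ n ∧ m * n ≤ q * p.2 + m * p.1 ∧
      (q * p.2 + m * p.1 = m * n → x₀ ≤ p.1)})
      (fun p hp => ⟨(hS p hp).1, (hS p hp).2, hleft p hp⟩) hconv hp
  have hedge : ∀ p : ℝ × ℝ, x₀ ≤ p.1 → p.1 ≤ n → q * p.2 + m * p.1 = m * n →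
      p ∈ lowerHull S := fun p h1 h2 h3 =>
    mem_lowerHull_of_support (a := m) hq (mem_convexHull_of_line hq hx h₀ hline hn h1 h2 h3)
      fun p' hp' => by linarith [(hS p' hp').2]
  have htop : (n, (0 : ℝ)) ∈ lowerHull S := hedge _ hx.le le_rfl (by simp)
  have hnonneg : ∀ p ∈ lowerHull S, 0 ≤ p.2 := fun p hp => by
    obtain ⟨h1, h2, -⟩ := hhull p hp.1
    have := mul_le_mul_of_nonneg_left h1 hm.le
    exact nonneg_of_mul_nonneg_right (by linarith : 0 ≤ q * p.2) hq
  ext p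
  constructor
  · rintro ⟨hp, r, hr, hlow, hseg⟩
    have hr2 : r.2 = 0 := le_antisymm (hlow _ htop) (hnonneg r hr)
    have hr1 : r.1 = n := by
      obtain ⟨h1, h2, -⟩ := hhull r hr.1
      rw [hr2, mul_zero, zero_add] at h2
      exact le_antisymm h1 (le_of_mul_le_mul_left h2 hm)
    obtain rfl : r = (n, 0) := Prod.ext hr1 hr2
    obtain ⟨h1, h2, h3⟩ := hhull p hp.1
    suffices hon : q * p.2 + m * p.1 = m * n from ⟨h3 hon, h1, hon⟩
    rcases h1.lt_or_eq with hlt | heq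
    -- The point of the segment with abscissa `c` lies over `[x₀, n]`, hence on the line. The line
    -- through it and `(n, 0)` contains `p`.
    · set c := max p.1 x₀ with hc
      have hcn : c < n := max_lt hlt hx
      have hd : 0 < n - p.1 := sub_pos.2 hlt
      set t := (n - c) / (n - p.1) with ht
      have ht0 : 0 < t := div_pos (sub_pos.2 hcn) hd
      have ht1 : t ≤ 1 := (div_le_one hd).2 (by linarith [le_max_left p.1 x₀])
      have hmem : t • p + (1 - t) • ((n, 0) : ℝ × ℝ) ∈ lowerHull S :=
        hseg ⟨t, 1 - t, ht0.le, by linarith, by ring, rfl⟩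
      have htd : t * (n - p.1) = n - c := div_mul_cancel₀ _ hd.ne'
      have hfst : (t • p + (1 - t) • ((n, 0) : ℝ × ℝ)).1 = c := by
        simp only [Prod.fst_add, Prod.smul_fst, smul_eq_mul]
        linarith
      have hsnd : (t • p + (1 - t) • ((n, 0) : ℝ × ℝ)).2 = t * p.2 := by
        simp
      have hon := line_of_mem_lowerHull hq (fun p hp => (hS p hp).2) hx h₀ hline hn hmem
        (by rw [hfst]; exact le_max_right _ _) (by rw [hfst]; exact hcn.le)
      rw [hfst, hsnd] at hon
      refine mul_left_cancel₀ ht0.ne' ?_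
      linear_combination hon - m * htd
    · have := hp.2 0 (by rw [heq]; exact subset_convexHull ℝ S hn)
      have h4 : p.2 = 0 := le_antisymm this (hnonneg p hp)
      rw [h4, heq]; ring
  · rintro ⟨h1, h2, h3⟩
    refine ⟨hedge p h1 h2 h3, (n, 0), htop, fun p' hp' => hnonneg p' hp', ?_⟩
    rintro _ ⟨s, t, hs, ht, hst, rfl⟩
    obtain rfl : s = 1 - t := by linarith
    refine hedge _ ?_ ?_ ?_
    · simp only [Prod.fst_add, Prod.smul_fst, smul_eq_mul]
      nlinarith
    · simp only [Prod.fst_add, Prod.smul_fst, smul_eq_mul]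
      nlinarith
    · simp only [Prod.fst_add, Prod.smul_fst, Prod.snd_add, Prod.smul_snd, smul_eq_mul]
      linear_combination (1 - t) * h3

end Geometry

/-! ### Supporting lines of Newton polygons of polynomials -/

section Polynomials

variable {L : Type u} [Field L] {H R : L⟦X⟧[X]} {q m : ℕ}

/-- A point on a supporting line is a point of the Newton polygon. -/
theorem mem_points_of_line (hq : 0 < q) {n : ℕ}
    (hline : ∀ i j, PowerSeries.coeff j (R.coeff i) ≠ 0 → m * n ≤ q * j + m * i) {i j : ℕ}
    (h : PowerSeries.coeff j (R.coeff i) ≠ 0) (hij : q * j + m * i = m * n) :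
    ((i : ℝ), (j : ℝ)) ∈ points R := by
  obtain ⟨j', hj', hord⟩ := exists_order_of_coeff_ne_zero h
  have h1 := hline i j' (order_eq_nat_iff_coeff.1 hord).1
  have h2 : j ≤ j' := Nat.le_of_mul_le_mul_left (by omega : q * j ≤ q * j') hq
  exact ⟨i, j, by rw [hord, le_antisymm hj' h2], rfl⟩

theorem mem_newtonPolygon_of_line (hq : 0 < q) {n : ℕ}
    (hline : ∀ i j, PowerSeries.coeff j (R.coeff i) ≠ 0 → m * n ≤ q * j + m * i) {i j : ℕ}
    (h : PowerSeries.coeff j (R.coeff i) ≠ 0) (hij : q * j + m * i = m * n) :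
    ((i : ℝ), (j : ℝ)) ∈ newtonPolygon R := by
  refine mem_lowerHull_of_support (a := m) (b := q) (by exact_mod_cast hq)
    (subset_convexHull ℝ _ (mem_points_of_line hq hline h hij)) ?_
  rintro _ ⟨i', j', hord, rfl⟩
  have h1 := hline i' j' (order_eq_nat_iff_coeff.1 hord).1
  rw [← hij] at h1
  have h2 : ((q * j + m * i : ℕ) : ℝ) ≤ ((q * j' + m * i' : ℕ) : ℝ) := by exact_mod_cast h1
  push_cast at h2 ⊢
  linarith

/-- The lowest edge of a Newton polygon, all of whose points are on or above a line. -/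
theorem lowestEdge_newtonPolygon (hq : 0 < q) (hm : 0 < m) {n i₀ j₀ : ℕ}
    (hline : ∀ i j, PowerSeries.coeff j (R.coeff i) ≠ 0 → i ≤ n ∧ m * n ≤ q * j + m * i)
    (hn : PowerSeries.coeff 0 (R.coeff n) ≠ 0) (hi₀ : i₀ < n)
    (h₀ : PowerSeries.coeff j₀ (R.coeff i₀) ≠ 0) (h₀' : q * j₀ + m * i₀ = m * n)
    (hleft : ∀ i j, PowerSeries.coeff j (R.coeff i) ≠ 0 → q * j + m * i = m * n → i₀ ≤ i) :
    lowestEdge (newtonPolygon R) =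
      {p : ℝ × ℝ | (i₀ : ℝ) ≤ p.1 ∧ p.1 ≤ n ∧ (q : ℝ) * p.2 + m * p.1 = m * n} := by
  have hline' := fun i j h => (hline i j h).2
  refine lowestEdge_lowerHull (q := q) (m := m) (n := n) (y₀ := j₀) (by exact_mod_cast hq) (by exact_mod_cast hm) ?_
    (by exact_mod_cast hi₀) (mem_points_of_line hq hline' h₀ h₀') (by exact_mod_cast h₀') ?_ ?_
  · rintro _ ⟨i, j, hord, rfl⟩
    obtain ⟨h1, h2⟩ := hline i j (order_eq_nat_iff_coeff.1 hord).1
    exact ⟨Nat.cast_le.2 h1, by dsimp only; exact_mod_cast h2⟩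
  · have := mem_points_of_line hq hline' hn (by ring)
    rwa [Nat.cast_zero] at this
  · rintro _ ⟨i, j, hord, rfl⟩ hij
    dsimp only at hij
    exact Nat.cast_le.2 (hleft i j (order_eq_nat_iff_coeff.1 hord).1 (by exact_mod_cast hij))

/-- The slope of the lowest edge of the Newton polygon. -/
theorem IsWeierstrass.exists_lowest_slope (hH : IsWeierstrass H)
    (hne : H ≠ Polynomial.X ^ H.natDegree) : ∃ q m : ℕ, 0 < q ∧ 0 < m ∧
      (∀ i j, PowerSeries.coeff j (H.coeff i) ≠ 0 → m * H.natDegree ≤ q * j + m * i) ∧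
      ∃ i < H.natDegree, ∃ j, PowerSeries.coeff j (H.coeff i) ≠ 0 ∧
        q * j + m * i = m * H.natDegree := by
  classical
  obtain ⟨i₁, hi₁, h₁⟩ := hH.exists_coeff_ne_zero hne
  obtain ⟨i₀, hi₀, hmin⟩ := ((Finset.range H.natDegree).filter fun i => H.coeff i ≠ 0).exists_min_image
    (fun i => ((H.coeff i).order.toNat : ℚ) / ((H.natDegree - i : ℕ) : ℚ))
    ⟨i₁, Finset.mem_filter.2 ⟨Finset.mem_range.2 hi₁, h₁⟩⟩
  obtain ⟨hi₀N, h₀⟩ := Finset.mem_filter.1 hi₀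
  rw [Finset.mem_range] at hi₀N
  have hord : ∀ i, H.coeff i ≠ 0 → (H.coeff i).order = ((H.coeff i).order.toNat : ℕ∞) :=
    fun i hi => (ENat.natCast_toNat (PowerSeries.order_eq_top.not.2 hi)).symm
  have hc₀ := (order_eq_nat_iff_coeff.1 (hord i₀ h₀)).1
  set m := (H.coeff i₀).order.toNat with hm
  -- The lowest edge has the least slope in absolute value among the segments from points with `i <
  -- N` to `(N, 0)`. Here `q` and `m` need not be coprime.
  refine ⟨H.natDegree - i₀, m, by omega, ?_, ?_, i₀, hi₀N, m, hc₀, ?_⟩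
  · refine Nat.pos_of_ne_zero fun hm0 => ?_
    rw [hm0, PowerSeries.coeff_zero_eq_constantCoeff_apply, hH.2 i₀ hi₀N] at hc₀
    exact hc₀ rfl
  · intro i j hij
    rcases Nat.lt_or_ge i H.natDegree with hi | hi
    · have hi0 : H.coeff i ≠ 0 := fun h0 => by rw [h0, map_zero] at hij; exact hij rfl
      have h1 := hmin i (Finset.mem_filter.2 ⟨Finset.mem_range.2 hi, hi0⟩)
      rw [div_le_div_iff₀ (by exact_mod_cast Nat.sub_pos_of_lt hi₀N)
        (by exact_mod_cast Nat.sub_pos_of_lt hi)] at h1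
      have h2 : m * (H.natDegree - i) ≤ (H.coeff i).order.toNat * (H.natDegree - i₀) := by
        exact_mod_cast h1
      have h3 : (H.coeff i).order.toNat ≤ j := by
        have := PowerSeries.order_le j hij
        rw [hord i hi0] at this
        exact_mod_cast this
      have h4 := Nat.mul_le_mul_right (H.natDegree - i₀) h3
      have h5 : m * H.natDegree = m * (H.natDegree - i) + m * i := by
        rw [← Nat.mul_add, Nat.sub_add_cancel hi.le]
      rw [h5, mul_comm (H.natDegree - i₀)]
      omega
    · exact (Nat.mul_le_mul_left m hi).trans (Nat.le_add_left _ _)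
  · rw [mul_comm, ← Nat.mul_add, Nat.sub_add_cancel hi₀N.le]

end Polynomials

/-! ### Agreement of the boundary polynomials -/

section Boundary

variable {K : Type u} [Field K] {F : K⟦X⟧[X]}

open Classical in
theorem coeff_psiBoundaryPoly (k : ℕ) (E : Set (ℝ × ℝ)) (i j : ℕ) :
    PowerSeries.coeff j ((psiBoundaryPoly F k E).coeff i) =
      if i ≤ degN F k ∧ psiHeight F k i = ((j : ℤ) : WithTop ℤ) ∧ ((i : ℝ), (j : ℝ)) ∈ E then
        ∑ᶠ B ∈ {B : Exponent k | B.2 (Fin.last k) = i ∧ weight F k B = j + val F k F},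
          algebraMap K (resField F k) (psiCoeff F k B) *
            (lamPow F k B / lamPow F k (baseExponent F k))
      else 0 := by
  rw [psiBoundaryPoly, Polynomial.finsetSum_coeff]
  simp only [Polynomial.coeff_monomial]
  rw [Finset.sum_ite_eq']
  by_cases hi : i ≤ degN F k
  · rw [if_pos (Finset.mem_range.2 (Nat.lt_succ_of_le hi)), PowerSeries.coeff_mk]
    simp only [hi, true_and]
  · rw [if_neg (fun h => hi (Nat.lt_succ_iff.1 (Finset.mem_range.1 h))), map_zero,
      if_neg fun h => hi h.1]

/-- The points `(i, w'_i)`, of which `psiPolygon` is the lower hull. -/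
def psiPoints (F : K⟦X⟧[X]) (k : ℕ) : Set (ℝ × ℝ) :=
  {p | ∃ i ≤ degN F k, ∃ w : ℤ, psiHeight F k i = (w : WithTop ℤ) ∧ p = ((i : ℝ), (w : ℝ))}

variable {k q m : ℕ}

theorem Admissible.le_of_mem_psiPoints (hF : Admissible F) (h : ∀ j < k, ¬ Stops F j)
    (hq : 0 < q) (hm : 0 < m) (hline : ∀ i j, PowerSeries.coeff j ((polyH F k).coeff i) ≠ 0 →
      m * degN F k ≤ q * j + m * i) : ∀ p ∈ psiPoints F k,
        (m : ℝ) * degN F k ≤ q * p.2 + m * p.1 := by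
  rintro _ ⟨i, hi, w, hw, rfl⟩
  have := (hF.psi_comparison h hq hm hline).1 i hi w hw
  dsimp only
  exact_mod_cast this

theorem Admissible.mem_psiPolygon_of_line (hF : Admissible F) (h : ∀ j < k, ¬ Stops F j)
    (hq : 0 < q) (hm : 0 < m) (hline : ∀ i j, PowerSeries.coeff j ((polyH F k).coeff i) ≠ 0 →
      m * degN F k ≤ q * j + m * i) {i j : ℕ} (hi : i ≤ degN F k)
    (hij : q * j + m * i = m * degN F k) (hw : psiHeight F k i = ((j : ℤ) : WithTop ℤ)) :
    ((i : ℝ), (j : ℝ)) ∈ psiPolygon F k := by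
  refine mem_lowerHull_of_support (a := m) (b := q) (by exact_mod_cast hq)
    (subset_convexHull ℝ _ ⟨i, hi, j, hw, by simp⟩) fun p hp => ?_
  refine le_trans (le_of_eq ?_) ((hF.le_of_mem_psiPoints h hq hm hline p hp).trans_eq (add_comm _ _))
  dsimp only
  rw [add_comm]
  exact_mod_cast hij

/-- Along a supporting line of the Newton polygon of `H`, the polynomial that is computed from
the expansion of `F` agrees with `H`. -/
theorem Admissible.psiBoundaryPoly_line (hF : Admissible F) (h : ∀ j < k, ¬ Stops F j)
    (hq : 0 < q) (hm : 0 < m) (hline : ∀ i j, PowerSeries.coeff j ((polyH F k).coeff i) ≠ 0 →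
      m * degN F k ≤ q * j + m * i) {E : Set (ℝ × ℝ)}
    (hE : E = newtonPolygon (polyH F k) ∨ E = psiPolygon F k) :
    (∀ i j, PowerSeries.coeff j ((psiBoundaryPoly F k E).coeff i) ≠ 0 →
      i ≤ degN F k ∧ m * degN F k ≤ q * j + m * i) ∧
    ∀ i j, q * j + m * i = m * degN F k → PowerSeries.coeff j ((psiBoundaryPoly F k E).coeff i) =
      PowerSeries.coeff j ((polyH F k).coeff i) := by
  classical
  obtain ⟨h1, h2⟩ := hF.psi_comparison h hq hm hline
  constructor
  · intro i j hij
    rw [coeff_psiBoundaryPoly] at hij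
    obtain ⟨hi, hw, -⟩ := (ite_ne_right_iff.1 hij).1
    refine ⟨hi, ?_⟩
    exact_mod_cast h1 i hi j hw
  · intro i j hij
    have hi : i ≤ degN F k := Nat.le_of_mul_le_mul_left (by omega : m * i ≤ m * degN F k) hm
    obtain ⟨h3, h4⟩ := h2 i hi j hij
    rw [coeff_psiBoundaryPoly]
    split_ifs with hc
    · exact h4 hc.2.1
    · by_contra hne
      have hne' := Ne.symm hne
      have hw := h3.2 hne'
      refine hc ⟨hi, hw, ?_⟩
      rcases hE with rfl | rfl
      · exact mem_newtonPolygon_of_line hq hline hne' hij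
      · exact hF.mem_psiPolygon_of_line h hq hm hline hi hij hw

/-- This has the form of `Admissible.psiBoundaryPoly_line`, so that the same argument determines the
lowest edge of both polynomials. -/
theorem boundaryPoly_line {L : Type u} [Field L] {H : L⟦X⟧[X]} (hq : 0 < q)
    (hline : ∀ i j, PowerSeries.coeff j (H.coeff i) ≠ 0 → m * H.natDegree ≤ q * j + m * i) :
    (∀ i j, PowerSeries.coeff j ((boundaryPoly H).coeff i) ≠ 0 →
      i ≤ H.natDegree ∧ m * H.natDegree ≤ q * j + m * i) ∧
    ∀ i j, q * j + m * i = m * H.natDegree → PowerSeries.coeff j ((boundaryPoly H).coeff i) =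
      PowerSeries.coeff j (H.coeff i) := by
  classical
  constructor
  · intro i j hij
    rw [boundaryPoly, coeff_restrictTo] at hij
    have hne := (ite_ne_right_iff.1 hij).2
    refine ⟨?_, hline i j hne⟩
    by_contra! hlt
    rw [Polynomial.coeff_eq_zero_of_natDegree_lt hlt, map_zero] at hne
    exact hne rfl
  · intro i j hij
    rw [boundaryPoly, coeff_restrictTo]
    split_ifs with hc
    · rfl
    · by_contra hne
      exact hc (mem_newtonPolygon_of_line hq hline (Ne.symm hne) hij)

/-- If the Newton polygon of `H` is straight, then the boundary polynomial can be computed from the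
expansion of `F`. -/
theorem Admissible.boundaryPoly_eq (hF : Admissible F) (h : ∀ j < k + 1, ¬ Stops F j)
    {E : Set (ℝ × ℝ)} (hE : E = newtonPolygon (polyH F k) ∨ E = psiPolygon F k) :
    boundaryPoly (polyH F k) = psiBoundaryPoly F k E := by
  classical
  have h' : ∀ j < k, ¬ Stops F j := fun j hj => h j (hj.trans (Nat.lt_succ_self k))
  have I := hF.inv k h'
  have hk := h k (Nat.lt_succ_self k)
  have hne := hF.ne_X_pow I hk
  obtain ⟨D⟩ := isDegenerated_of_not_stops hk
  have hm := D.m_pos I.weierstrass hne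
  have hline : ∀ i j, PowerSeries.coeff j ((polyH F k).coeff i) ≠ 0 →
      D.m * degN F k ≤ D.q * j + D.m * i :=
    fun i j hij => D.mul_natDegree_le_of_coeff I.weierstrass hij
  obtain ⟨h1, h2⟩ := hF.psiBoundaryPoly_line h' D.q_pos hm hline hE
  ext i j
  refine (D.coeff_boundaryPoly I.weierstrass i j).trans ?_
  split_ifs with hij
  · exact (h2 i j hij).symm
  · by_contra hc
    have hc' := Ne.symm hc
    rw [coeff_psiBoundaryPoly] at hc'
    obtain ⟨hi, hw, hmem⟩ := (ite_ne_right_iff.1 hc').1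
    refine hij ?_
    rcases hE with rfl | rfl
    · have h3 := D.straight _ hmem _ I.weierstrass.top_mem_newtonPolygon
      dsimp only at h3
      have h4 : (D.q : ℝ) * j + D.m * i = D.m * (stage F k).H.natDegree := by linarith
      exact_mod_cast h4
    -- Since `P(0) ≠ 0`, the line carries a point of `H` over `i = 0`, and `(N, 0)` is on it too. By
    -- the comparison both are points `(i, w'_i)`, so the lower hull over `[0, N]` follows the line.
    · obtain ⟨j₀, hj₀, hj₀'⟩ : ∃ j₀, D.q * j₀ = D.m * degN F k ∧
          PowerSeries.coeff j₀ ((polyH F k).coeff 0) ≠ 0 := by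
        obtain ⟨c, hc, hb⟩ := D.boundary_eq
        have h5 : (boundaryPoly (stage F k).H).coeff 0 = PowerSeries.monomial
            (D.N * (D.m * D.P.natDegree)) (c * D.P.coeff 0 ^ D.N) := by
          have h6 := coeff_quasiHom D.q D.m D.P D.q_pos 0
          rw [mul_zero, Nat.sub_zero] at h6
          rw [hb, Polynomial.coeff_C_mul, Polynomial.coeff_zero_eq_eval_zero, Polynomial.eval_pow,
            ← Polynomial.coeff_zero_eq_eval_zero, h6, PowerSeries.monomial_pow,
            ← PowerSeries.monomial_zero_eq_C_apply, PowerSeries.monomial_mul_monomial, zero_add]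
        have h7 : D.q * (D.N * (D.m * D.P.natDegree)) = D.m * degN F k := by
          rw [show degN F k = D.q * D.P.natDegree * D.N from (D.natDegree_eq I.weierstrass).symm]
          ring
        refine ⟨D.N * (D.m * D.P.natDegree), h7, ?_⟩
        have h8 := congrArg (PowerSeries.coeff (D.N * (D.m * D.P.natDegree))) h5
        rw [D.coeff_boundaryPoly I.weierstrass, if_pos (by rw [mul_zero, add_zero]; exact h7),
          PowerSeries.coeff_monomial_same] at h8
        rw [show polyH F k = (stage F k).H from rfl, h8]
        exact mul_ne_zero hc (pow_ne_zero _ (D.P_coeff_zero_ne_zero I.weierstrass hne))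
      have h5 := hF.psi_comparison h' D.q_pos hm hline
      have hw₀ := (h5.2 0 (Nat.zero_le _) j₀ (by rw [hj₀, mul_zero, add_zero])).1.2 hj₀'
      have hwn := (h5.2 (degN F k) le_rfl 0 (by ring)).1.2 (by
        rw [show (polyH F k).coeff (degN F k) = 1 from I.weierstrass.1.coeff_natDegree]
        simp)
      have h6 := line_of_mem_lowerHull (S := psiPoints F k) (q := D.q) (m := D.m) (n := degN F k)
        (x₀ := 0) (y₀ := j₀) (by exact_mod_cast D.q_pos)
        (hF.le_of_mem_psiPoints h' D.q_pos hm hline) (by exact_mod_cast I.natDegree_pos)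
        ⟨0, Nat.zero_le _, j₀, hw₀, by simp⟩ (by rw [mul_zero, add_zero]; exact_mod_cast hj₀)
        ⟨degN F k, le_rfl, 0, hwn, by simp⟩ hmem (by simp) (by simpa using hi)
      dsimp only at h6
      exact_mod_cast h6

/-- At every stage, the lowest edges agree. -/
theorem Admissible.lowestEdge_eq (hF : Admissible F) (h : ∀ j < k, ¬ Stops F j)
    (hne : polyH F k ≠ Polynomial.X ^ degN F k)
    {E : Set (ℝ × ℝ)} (hE : E = newtonPolygon (polyH F k) ∨ E = psiPolygon F k) :
    lowestEdge (newtonPolygon (boundaryPoly (polyH F k))) =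
        lowestEdge (newtonPolygon (psiBoundaryPoly F k E)) ∧
      restrictTo (lowestEdge (newtonPolygon (boundaryPoly (polyH F k)))) (boundaryPoly (polyH F k)) =
        restrictTo (lowestEdge (newtonPolygon (psiBoundaryPoly F k E))) (psiBoundaryPoly F k E) := by
  classical
  have I := hF.inv k h
  obtain ⟨q, m, hq, hm, hline, i₁, hi₁, h₁⟩ :=
    (show IsWeierstrass (polyH F k) from I.weierstrass).exists_lowest_slope hne
  change ∀ i j, PowerSeries.coeff j ((polyH F k).coeff i) ≠ 0 →
    m * degN F k ≤ q * j + m * i at hline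
  change i₁ < degN F k at hi₁
  -- The least such `i` is the left end of the lowest edge. It is read from the coefficients on the
  -- line, which both boundary polynomials share with `H`.
  have hex : ∃ i j, PowerSeries.coeff j ((polyH F k).coeff i) ≠ 0 ∧
      q * j + m * i = m * degN F k := ⟨i₁, h₁⟩
  obtain ⟨j₀, hj₀, hj₀'⟩ := Nat.find_spec hex
  have hi₀ : Nat.find hex < degN F k := (Nat.find_min' hex h₁).trans_lt hi₁
  have hN : PowerSeries.coeff 0 ((polyH F k).coeff (degN F k)) ≠ 0 := by
    rw [show (polyH F k).coeff (degN F k) = 1 from I.weierstrass.1.coeff_natDegree]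
    simp
  have key : ∀ R : (resField F k)⟦X⟧[X],
      ((∀ i j, PowerSeries.coeff j (R.coeff i) ≠ 0 →
        i ≤ degN F k ∧ m * degN F k ≤ q * j + m * i) ∧
      ∀ i j, q * j + m * i = m * degN F k → PowerSeries.coeff j (R.coeff i) =
        PowerSeries.coeff j ((polyH F k).coeff i)) →
      lowestEdge (newtonPolygon R) = {p : ℝ × ℝ | ((Nat.find hex : ℕ) : ℝ) ≤ p.1 ∧
        p.1 ≤ degN F k ∧ (q : ℝ) * p.2 + m * p.1 = m * degN F k} := by
    rintro R ⟨hR1, hR2⟩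
    refine lowestEdge_newtonPolygon hq hm hR1 (by rwa [hR2 _ _ (by ring)]) hi₀
      (by rwa [hR2 _ _ hj₀']) hj₀' fun i j hij hij' => ?_
    rw [hR2 _ _ hij'] at hij
    exact Nat.find_min' hex ⟨j, hij, hij'⟩
  have hR := boundaryPoly_line hq hline
  have hR' := hF.psiBoundaryPoly_line h hq hm hline hE
  have e1 := key _ hR
  have e2 := key _ hR'
  refine ⟨e1.trans e2.symm, ?_⟩
  rw [e1, e2]
  ext i j
  rw [coeff_restrictTo, coeff_restrictTo]
  split_ifs with hc
  · have hij' := hc.2.2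
    dsimp only at hij'
    have hij : q * j + m * i = m * degN F k := by exact_mod_cast hij'
    rw [hR.2 i j hij, hR'.2 i j hij]
  · rfl

/-- If `H` is a power of `y`, then so are both boundary polynomials. -/
theorem Admissible.boundaryPoly_eq_of_X_pow (hF : Admissible F) (h : ∀ j < k, ¬ Stops F j)
    (hX : polyH F k = Polynomial.X ^ degN F k) {E : Set (ℝ × ℝ)}
    (hE : E = newtonPolygon (polyH F k) ∨ E = psiPolygon F k) :
    boundaryPoly (polyH F k) = psiBoundaryPoly F k E := by
  have hline : ∀ (m i j : ℕ), PowerSeries.coeff j ((polyH F k).coeff i) ≠ 0 →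
      m * degN F k ≤ 1 * j + m * i := by
    intro m i j hij
    have : i = degN F k := by
      by_contra hne
      rw [hX, Polynomial.coeff_X_pow, if_neg hne, map_zero] at hij
      exact hij rfl
    rw [this]
    exact Nat.le_add_left _ _
  have hR := fun m => boundaryPoly_line (H := polyH F k) one_pos (m := m) (hline m)
  have hR' := fun m hm => hF.psiBoundaryPoly_line h one_pos (m := m) hm (hline m) hE
  ext i j
  -- For `H = y ^ N` all slopes are allowed. The slope `j + 1` excludes a term `x ^ j y ^ i` with `i
  -- < N`.
  have hzero : ∀ a : resField F k,
      (a ≠ 0 → i ≤ degN F k ∧ (j + 1) * degN F k ≤ 1 * j + (j + 1) * i) → degN F k ≠ i → a = 0 := by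
    intro a ha hi
    by_contra h0
    obtain ⟨h1, h2⟩ := ha h0
    obtain ⟨c, hc⟩ := Nat.exists_eq_add_of_lt (lt_of_le_of_ne h1 hi.symm)
    rw [hc] at h2
    nlinarith
  rcases eq_or_ne (degN F k) i with rfl | hi
  · rcases Nat.eq_zero_or_pos j with rfl | hj
    · rw [(hR 1).2 _ _ (by rw [mul_zero, zero_add]; rfl), (hR' 1 one_pos).2 _ _ (by ring)]
    · have hN : (polyH F k).coeff (degN F k) = 1 := by
        rw [hX, Polynomial.coeff_X_pow, if_pos rfl]
      have hw := (((hF.psi_comparison h one_pos one_pos (hline 1)).2 _ le_rfl 0 (by ring)).1).2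
        (by rw [hN]; simp)
      rw [boundaryPoly, coeff_restrictTo, hN, coeff_psiBoundaryPoly, PowerSeries.coeff_one,
        if_neg hj.ne', ite_self, if_neg]
      rintro ⟨-, h2, -⟩
      rw [hw] at h2
      have := WithTop.coe_inj.1 h2
      omega
  · rw [hzero _ ((hR (j + 1)).1 i j) hi, hzero _ ((hR' (j + 1) (Nat.succ_pos j)).1 i j) hi]

end Boundary

end NewtonPuiseux

end

/-! ### The main theorem -/

theorem mainTheorem5 {K : Type u} [Field K] [PerfectField K] (F : K⟦X⟧[X])
    (hF : NewtonPuiseux.IsWeierstrass F) (hd : 0 < F.natDegree) (hsq : Squarefree F)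
    (hchar : ringChar K = 0 ∨ F.natDegree < ringChar K) :
    ∃ g : ℕ, IsLeast {k | NewtonPuiseux.Stops F k} g ∧
      (∀ k < g, ∀ E : Set (ℝ × ℝ),
        (E = NewtonPuiseux.newtonPolygon (NewtonPuiseux.polyH F k) ∨
          E = NewtonPuiseux.psiPolygon F k) →
        NewtonPuiseux.boundaryPoly (NewtonPuiseux.polyH F k) =
          NewtonPuiseux.psiBoundaryPoly F k E) ∧
      (∀ E : Set (ℝ × ℝ),
        (E = NewtonPuiseux.newtonPolygon (NewtonPuiseux.polyH F g) ∨
          E = NewtonPuiseux.psiPolygon F g) →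
        NewtonPuiseux.lowestEdge (NewtonPuiseux.newtonPolygon
            (NewtonPuiseux.boundaryPoly (NewtonPuiseux.polyH F g))) =
          NewtonPuiseux.lowestEdge (NewtonPuiseux.newtonPolygon
            (NewtonPuiseux.psiBoundaryPoly F g E)) ∧
        NewtonPuiseux.restrictTo (NewtonPuiseux.lowestEdge (NewtonPuiseux.newtonPolygon
            (NewtonPuiseux.boundaryPoly (NewtonPuiseux.polyH F g))))
            (NewtonPuiseux.boundaryPoly (NewtonPuiseux.polyH F g)) =
          NewtonPuiseux.restrictTo (NewtonPuiseux.lowestEdge (NewtonPuiseux.newtonPolygon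
            (NewtonPuiseux.psiBoundaryPoly F g E)))
            (NewtonPuiseux.psiBoundaryPoly F g E)) := by
  classical
  have hA : NewtonPuiseux.Admissible F := by
    refine ⟨hF, hd, hsq, fun n hn hle h0 => ?_⟩
    have hdvd := (ringChar.spec K n).1 h0
    rcases hchar with h | h
    · rw [h, zero_dvd_iff] at hdvd
      exact hn.ne' hdvd
    · exact absurd (Nat.le_of_dvd hn hdvd) (by omega)
  have hex := hA.exists_stops
  have hmin : ∀ k ≤ Nat.find hex, ∀ j < k, ¬ NewtonPuiseux.Stops F j :=
    fun k hk j hj => Nat.find_min hex (hj.trans_le hk)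
  refine ⟨Nat.find hex, ⟨Nat.find_spec hex, fun k hk => Nat.find_min' hex hk⟩,
    fun k hk E hE => hA.boundaryPoly_eq (hmin (k + 1) hk) hE, fun E hE => ?_⟩
  -- If `H_g = y ^ N`, the polygon is a single point and there is no lowest slope. In that case the
  -- two boundary polynomials are equal outright.
  by_cases hX : NewtonPuiseux.polyH F (Nat.find hex) =
      Polynomial.X ^ NewtonPuiseux.degN F (Nat.find hex)
  · rw [hA.boundaryPoly_eq_of_X_pow (hmin _ le_rfl) hX hE]
    exact ⟨rfl, rfl⟩
  · exact hA.lowestEdge_eq (hmin _ le_rfl) hX hE
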